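/- **Theorem 4 (Uplink Coverage Probability).** *Parameters.* $\lambda_{\rm b},\lambda_{\rm o},L_{\rm o},\lambda_f,\delta,p_0,p_{\max},\sigma'^2>0$, $\mu\in[0,1]$, $\epsilon\in(0,1]$, $\alpha_{\rm L}>0$, $\alpha_{\rm N}>2$, integers $N_{\rm b}\ge 2$, $N_{\rm r},m_{\rm L},m_{\rm N}\ge 1$. Put $\lambda_{\rm r}=\mu\lambda_{\rm o}$, $\beta=2\lambda_{\rm o}L_{\rm o}/\pi$, $\zeta=(\lambda_f/4\pi)^2$, $G_{\rm b}=N_{\rm b}$, $G_{\rm r}=N_{\rm r}^2$, $\mathcal P_{\rm L}(t)=e^{-\beta t}$, $\mathcal P_{\rm N}=1-\mathcal P_{\rm L}$, $m_{\rm DL}=m_{\rm CL}=m_{\rm L}$, $m_{\rm DN}=m_{\rm N}$, $\beta_q=(m_q!)^{-1/m_q}$. *Serving link.* Base stations form a homogeneous Poisson process of density $\lambda_{\rm b}$ in the plane; the typical user, at the origin, is served by the nearest one, at distance $t_{\rm bu}$. The direct link is line-of-sight (LoS) with probability $\mathcal P_{\rm L}(t_{\rm bu})$, and then the serving link is of type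 DL. Reconfigurable surfaces (RISs) form an independent Poisson process of density $\lambda_{\rm r}$; one with polar coordinates $(t,\theta)$, relative to the user and the direction of its base station, offers a cascaded LoS link independently with probability $$a(t_{\rm bu},t,\theta)=\mathcal P_{\rm L}(t)\Big(\tfrac12-\tfrac1{2\pi}\arccos\tfrac{t-t_{\rm bu}\cos\theta}{\sqrt{t_{\rm bu}^2+t^2-2t_{\rm bu}t\cos\theta}}\Big).$$ Without a direct LoS link the user is served over the nearest such RIS, at distance $t_{\rm ru}$ (type CL), if there is one, and over the direct non-LoS link (type DN) otherwise. In type CL the RIS to base station distance is $t_{\rm br}=\sqrt{t_{\rm bu}^2+t_{\rm ru}^2-2t_{\rm bu}t_{\rm ru}\cos\theta_0}$ with $\theta_0$ uniform on $(-\pi,\pi)$, independent of everything else. With $T_{\max}=(p_{\max}/p_0)^{1/(\alpha_{\rm L}\epsilon)}$ the transmit powers are $p_{\rm u,DL}=p_0t_{\rm bu}^{\alpha_{\rm L}\epsilon}$ if $t_{\rm bu}<T_{\max}$, $p_{\rm u,DN}=p_0t_{\rm bu}^{\alpha_{\rm N}\epsilon}$ if $t_{\rm bu}<T_{\max}^{\alpha_{\rm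 L}/\alpha_{\rm N}}$, $p_{\rm u,CL}=p_0\big((t_{\rm br}t_{\rm ru})^{\alpha_{\rm L}}G_{\rm r}^{-1}\big)^{\epsilon}$ if $t_{\rm br}t_{\rm ru}<T_{\max}G_{\rm r}^{1/\alpha_{\rm L}}$, and $p_{\max}$ otherwise. The received serving power is $P'_q=p_{{\rm u},q}\,g_q\,H'_q$, where $g_{\rm DL}=G_{\rm b}\zeta t_{\rm bu}^{-\alpha_{\rm L}}$, $g_{\rm CL}=G_{\rm r}G_{\rm b}\zeta(t_{\rm ru}t_{\rm br})^{-\alpha_{\rm L}}$, $g_{\rm DN}=G_{\rm b}\zeta t_{\rm bu}^{-\alpha_{\rm N}}$ and $H'_q$ is Gamma distributed with shape and rate $m_q$. Write $\mathcal T_{\rm DL}=\mathcal T_{\rm DN}=(t_{\rm bu})$, $\mathcal T_{\rm CL}=(t_{\rm bu},t_{\rm ru},t_{\rm br})$. *Averages over the serving link.* Put $\bar a(t_{\rm bu},t)=\int_{-\pi}^{\pi}a(t_{\rm bu},t,\theta)\,d\theta$, $\mathcal P_{\rm CL}(t_{\rm bu})=1-e^{-\lambda_{\rm r}\int_0^\infty\bar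 a(t_{\rm bu},t)t\,dt}$, $\mathcal A_{\rm DL}=\mathcal P_{\rm L}(t_{\rm bu})$, $\mathcal A_{\rm CL}=\mathcal P_{\rm N}(t_{\rm bu})\mathcal P_{\rm CL}(t_{\rm bu})$, $\mathcal A_{\rm DN}=\mathcal P_{\rm N}(t_{\rm bu})(1-\mathcal P_{\rm CL}(t_{\rm bu}))$, $f_{T_{\rm bu}}(t)=2\pi\lambda_{\rm b}te^{-\pi\lambda_{\rm b}t^2}$ and $f_{T_{\rm ru}|t_{\rm bu}}(r)=\lambda_{\rm r}r\,\bar a(t_{\rm bu},r)e^{-\lambda_{\rm r}\int_0^r\bar a(t_{\rm bu},t)t\,dt}/\mathcal P_{\rm CL}(t_{\rm bu})$. For functions $F_q$ of $\mathcal T_q$ let $$\mathbb E_{t_{\rm bu},t_{\rm ru},t_{\rm br}}\Big[\sum_q\mathcal A_qF_q\Big]=\int_0^\infty\Big[\mathcal A_{\rm DL}F_{\rm DL}+\int_0^\infty\!\!\int_{-\pi}^{\pi}\mathcal A_{\rm CL}F_{\rm CL}\tfrac1{2\pi}f_{T_{\rm ru}|t_{\rm bu}}(t_{\rm ru})\,d\theta_0\,dt_{\rm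 ru}+\mathcal A_{\rm DN}F_{\rm DN}\Big]f_{T_{\rm bu}}(t_{\rm bu})\,dt_{\rm bu}$$ (the CL term is $0$ where $\mathcal P_{\rm CL}=0$). *Interference.* Relative to the tagged base station, the interfering users form a non-homogeneous Poisson process of density $\lambda_{\rm iu}(d)=\lambda_{\rm b}(1-e^{-\pi\lambda_{\rm b}d^2})$ at distance $d$, independent of the serving link. Its points are independently marked: the link of a user at distance $d$ to the tagged base station is in state $v={\rm L}$ or ${\rm N}$ with probability $\mathcal P_v(d)$; its fading $H'_v$ is Gamma with shape and rate $m_v$; its beam deviation is $\Delta'=\frac12\cos\phi-\frac12\cos\phi^*$ with $\phi,\phi^*$ uniform on $[0,2\pi]$; and its transmit power $p$ is distributed as that of the typical user. With $G_{\rm ULA}(x)=\frac{\sin^2(\pi N_{\rm b}x)}{N_{\rm b}\sin^2(\pi x)}$, $G_{\rm ULA}(0)=N_{\rm b}$, and $\tilde N_{\rm b}=\lfloor N_{\rm b}/2\rfloor-1$, let $G_0=\frac\delta2G_{\rm ULA}(0)$, $G_n=\frac\delta2G_{\rm ULA}(\frac{2n+1}{2N_{\rm b}})$ for $1\le n\le\tilde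 N_{\rm b}$, $G_{\tilde N_{\rm b}+1}=0$. For $|\Delta|\le\frac12$, $G_{\rm B}(\Delta)=G_0$ if $|\Delta|\le\frac1{N_{\rm b}}$, $G_n$ if $\frac n{N_{\rm b}}<|\Delta|\le\frac{n+1}{N_{\rm b}}$ with $1\le n\le\tilde N_{\rm b}$, and $0$ otherwise; $G_{\rm B}(\Delta)=G_{\rm B}(1-|\Delta|)$ for $\frac12<|\Delta|\le1$. Let $I_{\rm U}=\sum_i p_iG_{\rm B}(\Delta'_i)\zeta d_i^{-\alpha_{v_i}}H'_{v_i,i}$; let $\bar I_{\rm U}$ be the same sum with every $p_i$ replaced by $\bar p_{\rm u}=\mathbb E_{t_{\rm bu},t_{\rm ru},t_{\rm br}}[\sum_q\mathcal A_qp_{{\rm u},q}]$. Let $\Upsilon'$ be the SINR $P'_q/(\sigma'^2+I_{\rm U})$ of the typical user, $q$ being the type of its serving link, and $\bar\Upsilon'$ the same with $\bar I_{\rm U}$; $\bar F_{\Upsilon'_q|\mathcal T_q}(\gamma')$ is the probability that $P'_q/(\sigma'^2+I_{\rm U})>\gamma'$ for fixed distances $\mathcal T_q$, and $\bar F_{\bar\Upsilon'_q|\mathcal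 T_q}$ is defined likewise. *Formula.* Let $f_\Phi(x)=\frac2{\pi\sqrt{1-4x^2}}$ on $[-\frac12,\frac12]$ and $0$ elsewhere, $f_\Delta(y)=\int_{-1/2}^{1/2}f_\Phi(x)f_\Phi(y+x)\,dx$, $p_n=2\int_{n/N_{\rm b}}^{(n+1)/N_{\rm b}}f_\Delta+2\int_{1-(n+1)/N_{\rm b}}^{1-n/N_{\rm b}}f_\Delta$ for $0\le n\le\tilde N_{\rm b}$, $p_{\tilde N_{\rm b}+1}=1-\sum_{n\le\tilde N_{\rm b}}p_n$, $\kappa_v(x)=\sum_{n=0}^{\tilde N_{\rm b}+1}p_n(1+\frac{xG_n}{m_v})^{-m_v}$, $$\mathcal L(s)=\prod_{v\in\{{\rm L},{\rm N}\}}\exp\Big(-2\pi\int_0^\infty\big[1-\kappa_v(s\bar p_{\rm u}\zeta d^{-\alpha_v})\big]\,d\,\lambda_{\rm iu}(d)\,\mathcal P_v(d)\,{\rm d}d\Big),$$ $$C_q^{b}=\sum_{k=1}^{m_q}\binom{m_q}k(-1)^{k+1}e^{-kbs'_q\sigma'^2}\mathcal L(kbs'_q),\qquad s'_q=\frac{m_q\gamma'}{p_{{\rm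 u},q}\,g_q}.$$ *Claim.* For every $\gamma'>0$: 1. Given the serving link, the probability that $\Upsilon'>\gamma'$ is $\bar F_{\Upsilon'_q|\mathcal T_q}(\gamma')$ at its type and distances, and $\mathbb P(\Upsilon'>\gamma')=\mathbb E_{t_{\rm bu},t_{\rm ru},t_{\rm br}}[\sum_q\mathcal A_q\bar F_{\Upsilon'_q|\mathcal T_q}(\gamma')]$. The same holds for $\bar\Upsilon'$. 2. $\bar p_{\rm u}$ is the (finite) mean transmit power of the typical user, $\bar I_{\rm U}<\infty$ almost surely, and $\mathbb E[e^{-s\bar I_{\rm U}}]=\mathcal L(s)$ for all $s\ge0$. 3. For all positive distances, the approximation $\bar F_{\bar\Upsilon'_q|\mathcal T_q}(\gamma')\approx C_q^{\beta_q}$ holds in the following sense: it becomes an equality if the law of $H'_q$ is replaced by the law on $[0,\infty)$ with distribution function $(1-e^{-\beta_qm_qx})^{m_q}$; for the actual law, $C_q^{1}\le\bar F_{\bar\Upsilon'_q|\mathcal T_q}(\gamma')\le C_q^{\beta_q}$, with equality if $m_q=1$. 4. Consequently $\mathbb E_{t_{\rm bu},t_{\rm ru},t_{\rm br}}[\sum_q\mathcal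 A_qC_q^{1}]\le\mathbb P(\bar\Upsilon'>\gamma')\le\mathbb E_{t_{\rm bu},t_{\rm ru},t_{\rm br}}[\sum_q\mathcal A_qC_q^{\beta_q}]$, with equalities if $m_{\rm L}=m_{\rm N}=1$. -/

import Mathlib

open MeasureTheory ProbabilityTheory
open scoped ENNReal NNReal

namespace RISUplink

noncomputable section

/-! ### Poisson point processes -/

/-- `N` is a Poisson point process on `E` with intensity measure `Λ`, seen as a random
counting measure. -/
structure IsPoissonProcess {Ω E : Type*} [MeasurableSpace Ω] [MeasurableSpace E]
    (P : Measure Ω) (N : Ω → Measure E) (Λ : Measure E) : Prop where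
  measurable : Measurable N
  integer_valued : ∀ ω B, MeasurableSet B → ∃ n : ℕ∞, N ω B = (n : ℝ≥0∞)
  poisson : ∀ B, MeasurableSet B → Λ B ≠ ∞ →
    P.map (fun ω => N ω B) = (poissonMeasure (Λ B).toNNReal).map (fun n : ℕ => (n : ℝ≥0∞))
  indep : ∀ (n : ℕ) (B : Fin n → Set E), (∀ i, MeasurableSet (B i)) →
    (∀ i j, i ≠ j → Disjoint (B i) (B j)) → iIndepFun (fun i ω => N ω (B i)) P

/-- Uniform law on the interval `[a, b]`. -/
def uniformLaw (a b : ℝ) : Measure ℝ := volume[|Set.Icc a b]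

/-! ### System parameters -/

/-- System parameters. -/
structure Params where
  /-- density of the base stations -/
  lamB : ℝ
  /-- density of the obstacles -/
  lamO : ℝ
  /-- fraction of the obstacles that carry an RIS -/
  mu : ℝ
  /-- mean obstacle length -/
  Lo : ℝ
  /-- number of antennas of a base station -/
  Nb : ℕ
  /-- number of elements of an RIS -/
  Nr : ℕ
  /-- wavelength -/
  wavelength : ℝ
  /-- roll-off compensation factor of the discrete antenna pattern -/
  delta : ℝ
  /-- LoS path-loss exponent -/
  alphaL : ℝ
  /-- NLoS path-loss exponent -/
  alphaN : ℝ
  /-- LoS Nakagami parameter -/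
  mL : ℕ
  /-- NLoS Nakagami parameter -/
  mN : ℕ
  /-- power-control constant -/
  p0 : ℝ
  /-- maximal transmit power of a user -/
  pmax : ℝ
  /-- power-control factor -/
  eps : ℝ
  /-- noise power at a base station -/
  noise : ℝ
  lamB_pos : 0 < lamB
  lamO_pos : 0 < lamO
  mu_nonneg : 0 ≤ mu
  mu_le_one : mu ≤ 1
  Lo_pos : 0 < Lo
  two_le_Nb : 2 ≤ Nb
  Nr_pos : 0 < Nr
  wavelength_pos : 0 < wavelength
  delta_pos : 0 < delta
  alphaL_pos : 0 < alphaL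
  two_lt_alphaN : 2 < alphaN
  mL_pos : 0 < mL
  mN_pos : 0 < mN
  p0_pos : 0 < p0
  pmax_pos : 0 < pmax
  eps_pos : 0 < eps
  eps_le_one : eps ≤ 1
  noise_pos : 0 < noise

/-- Propagation state of a link: line of sight or not. -/
inductive LinkState
  | L
  | N

/-- Type of a serving link: direct LoS, cascaded LoS, direct NLoS. -/
inductive LinkType
  | DL
  | CL
  | DN

/-- A serving link: its type `q` together with the tuple of distances that belongs to that type,
`(t_bu)` for the direct links and `(t_bu, t_ru, t_br)` for the cascaded one. -/
inductive Link
  | direct (tbu : ℝ)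
  | cascaded (tbu tru tbr : ℝ)
  | nlos (tbu : ℝ)

/-- The type of a serving link. -/
def Link.type : Link → LinkType
  | .direct _ => .DL
  | .cascaded _ _ _ => .CL
  | .nlos _ => .DN

/-- All distances of the link are positive. -/
def Link.Proper : Link → Prop
  | .direct t => 0 < t
  | .cascaded t r d => 0 < t ∧ 0 < r ∧ 0 < d
  | .nlos t => 0 < t

namespace Params

variable (par : Params)

/-- RIS density. -/
def lamR : ℝ := par.mu * par.lamO

/-- Blockage parameter. -/
def blockage : ℝ := 2 * par.lamO * par.Lo / Real.pi

/-- Reference path loss. -/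
def zeta : ℝ := (par.wavelength / (4 * Real.pi)) ^ 2

/-- Maximal gain of a base station antenna. -/
def Gb : ℝ := par.Nb

/-- RIS gain. -/
def Gr : ℝ := (par.Nr : ℝ) ^ 2

/-- Path-loss exponent of a propagation state. -/
def alpha : LinkState → ℝ
  | .L => par.alphaL
  | .N => par.alphaN

/-- Nakagami parameter of a propagation state. -/
def mState : LinkState → ℕ
  | .L => par.mL
  | .N => par.mN

/-- Nakagami parameter of a serving link type. -/
def mType : LinkType → ℕ
  | .DL => par.mL
  | .CL => par.mL
  | .DN => par.mN

/-- LoS probability of a link of length `t`. -/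
def PLoS (t : ℝ) : ℝ := Real.exp (-par.blockage * t)

/-- Probability of a propagation state for a link of length `t`. -/
def PState : LinkState → ℝ → ℝ
  | .L, t => par.PLoS t
  | .N, t => 1 - par.PLoS t

/-! ### Association -/

/-- Probability that user and base station both lie on the front side of an RIS whose polar
coordinates are `(t, θ)` in the frame centred at the user with axis towards the base station. -/
def PRefl (tbu t θ : ℝ) : ℝ :=
  1 / 2 - 1 / (2 * Real.pi) * Real.arccos
    ((t - tbu * Real.cos θ) / Real.sqrt (tbu ^ 2 + t ^ 2 - 2 * tbu * t * Real.cos θ))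

/-- Probability that such an RIS provides a cascaded LoS link. -/
def viable (tbu t θ : ℝ) : ℝ := par.PLoS t * PRefl tbu t θ

/-- Angular integral of the previous probability. -/
def viableBar (tbu t : ℝ) : ℝ := ∫ θ in (-Real.pi)..Real.pi, par.viable tbu t θ

/-- Probability that a cascaded LoS link exists. -/
def PCL (tbu : ℝ) : ℝ :=
  1 - Real.exp (-par.lamR * ∫ t in Set.Ioi (0 : ℝ), par.viableBar tbu t * t)

/-- Association probabilities, given the user to base station distance. -/
def assoc : LinkType → ℝ → ℝ
  | .DL, tbu => par.PLoS tbu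
  | .CL, tbu => (1 - par.PLoS tbu) * par.PCL tbu
  | .DN, tbu => (1 - par.PLoS tbu) * (1 - par.PCL tbu)

/-- Density of the user to base station distance. -/
def pdfTbu (t : ℝ) : ℝ :=
  2 * Real.pi * par.lamB * t * Real.exp (-Real.pi * par.lamB * t ^ 2)

/-- Conditional density of the RIS to user distance in a cascaded link. -/
def pdfTru (tbu tru : ℝ) : ℝ :=
  par.lamR * tru * par.viableBar tbu tru *
    Real.exp (-par.lamR * ∫ t in (0 : ℝ)..tru, par.viableBar tbu t * t) / par.PCL tbu

/-- Base station to RIS distance (law of cosines). -/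
def distBR (tbu tru θ : ℝ) : ℝ :=
  Real.sqrt (tbu ^ 2 + tru ^ 2 - 2 * tbu * tru * Real.cos θ)

/-- The average `E_{t_bu, t_ru, t_br} [∑ q, A_q F_q]` of a function `F` of the serving link: the
average over the distances of the association-weighted sum. -/
def linkAverage (F : Link → ℝ) : ℝ :=
  ∫ tbu in Set.Ioi (0 : ℝ),
    (par.assoc .DL tbu * F (.direct tbu)
      + (∫ tru in Set.Ioi (0 : ℝ), ∫ θ in (-Real.pi)..Real.pi,
          par.assoc .CL tbu * F (.cascaded tbu tru (distBR tbu tru θ))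
            * (1 / (2 * Real.pi) * par.pdfTru tbu tru))
      + par.assoc .DN tbu * F (.nlos tbu)) * par.pdfTbu tbu

/-! ### Power control and received serving power -/

/-- Distance beyond which a user in a direct LoS link transmits at full power. -/
def Tmax : ℝ := (par.pmax / par.p0) ^ (1 / (par.alphaL * par.eps))

open Classical in
/-- Transmit power of a user with a given serving link. -/
def txPower : Link → ℝ
  | .direct t =>
      if t < par.Tmax then par.p0 * t ^ (par.alphaL * par.eps) else par.pmax
  | .cascaded _ r d =>
      if d * r < par.Tmax * par.Gr ^ (1 / par.alphaL) then
        par.p0 * ((d * r) ^ par.alphaL * par.Gr⁻¹) ^ par.eps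
      else par.pmax
  | .nlos t =>
      if t < par.Tmax ^ (par.alphaL / par.alphaN) then
        par.p0 * t ^ (par.alphaN * par.eps)
      else par.pmax

/-- Mean power gain of a serving link: antenna gain, RIS gain and path loss. -/
def linkGain : Link → ℝ
  | .direct t => par.Gb * par.zeta * t ^ (-par.alphaL)
  | .cascaded _ r d => par.Gr * par.Gb * par.zeta * (r * d) ^ (-par.alphaL)
  | .nlos t => par.Gb * par.zeta * t ^ (-par.alphaN)

/-- SINR of a serving link with fading coefficient `h` under interference `i`. -/
def sinrAt (ℓ : Link) (h : ℝ) (i : ℝ≥0∞) : ℝ≥0∞ :=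
  ENNReal.ofReal (par.txPower ℓ * par.linkGain ℓ * h) / (ENNReal.ofReal par.noise + i)

/-- Law of the Nakagami power fading coefficient with parameter `m`. -/
def fadingLaw (m : ℕ) : Measure ℝ := gammaMeasure m m

/-- Probability that the SINR exceeds `γ` for the fixed serving link `ℓ`, when the fading
coefficient has law `ν` and, independently, the interference has law `η`. -/
def coverageGiven (ν : Measure ℝ) (η : Measure ℝ≥0∞) (γ : ℝ) (ℓ : Link) : ℝ :=
  (ν.prod η).real {x | ENNReal.ofReal γ < par.sinrAt ℓ x.1 x.2}

/-- Average transmit power of a user. -/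
def meanPower : ℝ := par.linkAverage par.txPower

/-! ### Antenna pattern -/

open Classical in
/-- Gain of the uniform linear array, with its limit value where the denominator vanishes. -/
def GULA (Δ : ℝ) : ℝ :=
  if Real.sin (Real.pi * Δ) = 0 then par.Nb
  else Real.sin (Real.pi * par.Nb * Δ) ^ 2 / (par.Nb * Real.sin (Real.pi * Δ) ^ 2)

/-- Gain levels `G_n`; the last one, `n = ⌊N_b / 2⌋`, is zero. -/
def gainLevel (n : ℕ) : ℝ :=
  if n = 0 then par.delta / 2 * par.GULA 0
  else if n < par.Nb / 2 then par.delta / 2 * par.GULA ((2 * n + 1) / (2 * par.Nb))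
  else 0

open Classical in
/-- The discrete multi-lobe pattern for a deviation `x` with `|x| ≤ 1/2`. -/
def lobe (x : ℝ) : ℝ :=
  if |x| ≤ 1 / par.Nb then par.gainLevel 0
  else ∑ n ∈ Finset.Icc 1 (par.Nb / 2 - 1),
    if (n : ℝ) / par.Nb < |x| ∧ |x| ≤ ((n : ℝ) + 1) / par.Nb then par.gainLevel n else 0

open Classical in
/-- The discrete multi-lobe pattern on `[-1, 1]`. -/
def GB (Δ : ℝ) : ℝ :=
  if Δ < -(1 / 2) then par.lobe |Δ + 1|
  else if 1 / 2 < Δ then par.lobe |Δ - 1|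
  else par.lobe Δ

open Classical in
/-- Density of the spatial AoD. -/
def pdfPhi (x : ℝ) : ℝ :=
  if -(1 / 2) ≤ x ∧ x ≤ 1 / 2 then 2 / (Real.pi * Real.sqrt (1 - 4 * x ^ 2)) else 0

/-- Density of the spatial AoD deviation. -/
def pdfDelta (y : ℝ) : ℝ := ∫ x in (-(1 / 2) : ℝ)..(1 / 2), pdfPhi x * pdfPhi (y + x)

/-- Probability of the gain level `n < ⌊N_b / 2⌋`. -/
def gainProbAux (n : ℕ) : ℝ :=
  2 * (∫ y in ((n : ℝ) / par.Nb)..(((n : ℝ) + 1) / par.Nb), pdfDelta y)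
    + 2 * (∫ y in (1 - ((n : ℝ) + 1) / par.Nb)..(1 - (n : ℝ) / par.Nb), pdfDelta y)

/-- Probabilities `p_n` of the gain levels. -/
def gainProb (n : ℕ) : ℝ :=
  if n < par.Nb / 2 then par.gainProbAux n
  else 1 - ∑ k ∈ Finset.range (par.Nb / 2), par.gainProbAux k

/-! ### Uplink interference -/

/-- Density of the interfering users at distance `d` from the tagged base station. -/
def lamIU (d : ℝ) : ℝ := par.lamB * (1 - Real.exp (-Real.pi * par.lamB * d ^ 2))

/-- The function `κ_v`. -/
def kappa (v : LinkState) (x : ℝ) : ℝ :=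
  ∑ n ∈ Finset.range (par.Nb / 2 + 1),
    par.gainProb n * ((1 + x * par.gainLevel n / par.mState v) ^ par.mState v)⁻¹

/-- Laplace transform of the interference from users with link state `v`. -/
def laplaceState (v : LinkState) (s : ℝ) : ℝ :=
  Real.exp (-(2 * Real.pi) * ∫ d in Set.Ioi (0 : ℝ),
    (1 - par.kappa v (s * par.meanPower * par.zeta * d ^ (-par.alpha v)))
      * d * par.lamIU d * par.PState v d)

/-- Laplace transform of the uplink interference. -/
def laplace (s : ℝ) : ℝ := par.laplaceState .L s * par.laplaceState .N s

/-! ### The approximate conditional coverage probability -/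

/-- The constant `(m!)^(-1/m)`. -/
def fadingConst (m : ℕ) : ℝ := (m.factorial : ℝ) ^ (-1 / (m : ℝ))

/-- The law on `[0, ∞)` with distribution function `(1 - exp (-(m!)^(-1/m) m x))^m`, which
approximates the fading law. -/
def approxFadingLaw (m : ℕ) : Measure ℝ :=
  (volume.restrict (Set.Ioi (0 : ℝ))).withDensity fun x =>
    ENNReal.ofReal (m * (fadingConst m * m) * Real.exp (-(fadingConst m * m * x))
      * (1 - Real.exp (-(fadingConst m * m * x))) ^ (m - 1))

/-- `s_q = m_q γ / (p_q × gain)`. -/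
def sParam (γ : ℝ) (ℓ : Link) : ℝ :=
  par.mType ℓ.type * γ * (par.txPower ℓ * par.linkGain ℓ)⁻¹

/-- `∑_{k=1}^{m_q} C(m_q, k) (-1)^(k+1) exp (-k b s_q σ²) ℒ (k b s_q)`. -/
def coverageSum (b γ : ℝ) (ℓ : Link) : ℝ :=
  ∑ k ∈ Finset.Icc 1 (par.mType ℓ.type),
    ((par.mType ℓ.type).choose k : ℝ) * (-1) ^ (k + 1)
      * Real.exp (-(k * b * par.sParam γ ℓ * par.noise))
      * par.laplace (k * b * par.sParam γ ℓ)

/-- The approximate conditional coverage probability, `b = β_q = (m_q!)^(-1/m_q)`. -/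
def coverageApprox (γ : ℝ) (ℓ : Link) : ℝ :=
  par.coverageSum (fadingConst (par.mType ℓ.type)) γ ℓ

end Params

/-! ### The random network -/

/-- Geometry around the typical user, who is at the origin.
RISs carry independent uniform marks that decide whether they provide a cascaded LoS link; their
positions are given in the frame whose axis points from the user to its base station. -/
structure Geometry {Ω : Type*} [MeasurableSpace Ω] (par : Params) (P : Measure Ω) where
  /-- base stations -/
  bs : Ω → Measure ℂ
  bs_poisson : IsPoissonProcess P bs (ENNReal.ofReal par.lamB • volume)
  /-- uniform variable that decides whether the direct link is LoS -/
  los : Ω → ℝ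
  los_measurable : Measurable los
  los_law : P.map los = uniformLaw 0 1
  /-- RISs with uniform marks -/
  ris : Ω → Measure (ℂ × ℝ)
  ris_poisson : IsPoissonProcess P ris
    ((ENNReal.ofReal par.lamR • (volume : Measure ℂ)).prod (uniformLaw 0 1))
  /-- angle between the user to base station link and the user to serving RIS link -/
  theta : Ω → ℝ
  theta_measurable : Measurable theta
  theta_law : P.map theta = uniformLaw (-Real.pi) Real.pi

namespace Geometry

variable {Ω : Type*} [MeasurableSpace Ω] {par : Params} {P : Measure Ω} (M : Geometry par P)

/-- Distance from the typical user to the nearest base station. -/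
def tbu (ω : Ω) : ℝ := sInf {r | 0 ≤ r ∧ M.bs ω (Metric.closedBall 0 r) ≠ 0}

/-- Marked RISs that provide a cascaded LoS link when the base station is at distance `t`. -/
def viableSet (par : Params) (t : ℝ) : Set (ℂ × ℝ) :=
  {x | x.2 < par.viable t ‖x.1‖ (Complex.arg x.1)}

/-- Distance from the typical user to the nearest RIS that provides a cascaded LoS link. -/
def tru (ω : Ω) : ℝ :=
  sInf {r | 0 ≤ r ∧ M.ris ω (viableSet par (M.tbu ω) ∩ {x | ‖x.1‖ ≤ r}) ≠ 0}

open Classical in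
/-- The serving link of the typical user. -/
def servingLink (ω : Ω) : Link :=
  if M.los ω < par.PLoS (M.tbu ω) then .direct (M.tbu ω)
  else if M.ris ω (viableSet par (M.tbu ω)) ≠ 0 then
    .cascaded (M.tbu ω) (M.tru ω) (Params.distBR (M.tbu ω) (M.tru ω) (M.theta ω))
  else .nlos (M.tbu ω)

/-- Transmit power of the typical user. -/
def power (ω : Ω) : ℝ := par.txPower (M.servingLink ω)

/-- The sigma-algebra generated by the geometry. -/
abbrev sigma : MeasurableSpace Ω :=
  MeasurableSpace.comap (fun ω => (M.bs ω, M.los ω, M.ris ω, M.theta ω)) inferInstance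

end Geometry

/-- An interfering user: position relative to the tagged base station, uniform mark that decides
whether its link to the tagged base station is LoS, transmit power, physical AoDs of the
interfering link and of the aligned direction, fading coefficients of a LoS and of an NLoS link. -/
abbrev Interferer : Type := ℂ × ℝ × ℝ × ℝ × ℝ × ℝ × ℝ

open Classical in
/-- Interfering power received from a user if its transmit power is `p`. -/
def interferingPower (par : Params) (p : ℝ) : Interferer → ℝ
  | (z, u, _, φ, φs, hL, hN) =>
    p * par.GB (Real.cos φ / 2 - Real.cos φs / 2) * par.zeta *
      (if u < par.PLoS ‖z‖ then ‖z‖ ^ (-par.alphaL) * hL else ‖z‖ ^ (-par.alphaN) * hN)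

/-- Intensity measure of the interfering users with independent marks, where the transmit power
has law `ρ`. -/
def interfererIntensity (par : Params) (ρ : Measure ℝ) : Measure Interferer :=
  ((volume : Measure ℂ).withDensity fun z => ENNReal.ofReal (par.lamIU ‖z‖)).prod
    ((uniformLaw 0 1).prod (ρ.prod ((uniformLaw 0 (2 * Real.pi)).prod
      ((uniformLaw 0 (2 * Real.pi)).prod
        ((Params.fadingLaw par.mL).prod (Params.fadingLaw par.mN))))))

/-- The uplink: the geometry around the typical user, the fading of its serving link, and the
interfering users, all independent. The transmit power of an interfering user has the same law as
that of the typical user. -/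
structure Uplink {Ω : Type*} [MeasurableSpace Ω] (par : Params) (P : Measure Ω)
    extends Geometry par P where
  /-- fading coefficients of the serving link, by type -/
  fading : LinkType → Ω → ℝ
  fading_measurable : ∀ q, Measurable (fading q)
  fading_law : ∀ q, P.map (fading q) = Params.fadingLaw (par.mType q)
  /-- interfering users -/
  users : Ω → Measure Interferer
  users_poisson : IsPoissonProcess P users (interfererIntensity par (P.map toGeometry.power))
  /-- mutual independence: the joint law is the product of the marginal laws -/
  indep : P.map (fun ω => (bs ω, los ω, ris ω, theta ω, (fun q => fading q ω), users ω)) =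
    (P.map bs).prod ((P.map los).prod ((P.map ris).prod ((P.map theta).prod
      ((P.map (fun ω q => fading q ω)).prod (P.map users)))))

namespace Uplink

variable {Ω : Type*} [MeasurableSpace Ω] {par : Params} {P : Measure Ω} (M : Uplink par P)

/-- Uplink interference at the tagged base station, with the individual transmit powers. -/
def interference (ω : Ω) : ℝ≥0∞ :=
  ∫⁻ x, ENNReal.ofReal (interferingPower par x.2.2.1 x) ∂(M.users ω)

/-- Uplink interference with all transmit powers replaced by the average transmit power. -/
def avgInterference (ω : Ω) : ℝ≥0∞ :=
  ∫⁻ x, ENNReal.ofReal (interferingPower par par.meanPower x) ∂(M.users ω)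

/-- Uplink SINR of the typical user under the interference `I`. -/
def sinr (I : Ω → ℝ≥0∞) (ω : Ω) : ℝ≥0∞ :=
  par.sinrAt (M.servingLink ω) (M.fading (M.servingLink ω).type ω) (I ω)

/-- Conditional coverage probability for the serving link `ℓ` under the interference `I`. -/
def condCoverage (_M : Uplink par P) (I : Ω → ℝ≥0∞) (γ : ℝ) (ℓ : Link) : ℝ :=
  par.coverageGiven (Params.fadingLaw (par.mType ℓ.type)) (P.map I) γ ℓ

end Uplink

end

end RISUplink

open RISUplink

namespace RISUplink

open Set Filter Topology

noncomputable section

/-! The coverage probability is determined by three laws: that of the serving link, that of the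
interference (through its Laplace transform), and that of the serving fading coefficient. Each is
handled separately, and independence puts them together.

Serving link. The distances to the nearest base station and to the nearest viable RIS are contact
distances of Poisson processes. The void probability `exp (-Λ)` gives their distribution functions,
and differentiation gives their densities (`IsPoissonProcess.map_contact`). The uniform marks turn
the random thinning of the RISs into a fixed measurable set of marked points once the base station
distance is frozen. Since the joint law is a product, Tonelli's theorem allows this freezing and
yields the explicit average over the link (`Uplink.lintegral_servingLink`,
`Uplink.integral_servingLink`). The pair of fading and interferers is independent of the geometry,
so conditioning on the geometry amounts to inserting the link into the coverage probability for a
fixed link (`Uplink.condExp_coverage`). Averaging gives the unconditional statement.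

Interference. The Laplace functional of a Poisson process
(`IsPoissonProcess.integral_expNeg_lintegral`) follows from independence of the counts for simple
functions and passes to monotone limits. For the interference with constant power the exponent is
integrated over the marks: the gamma fading gives `(1 + y/m)^(-m)`, the two uniform angles give a
beam deviation with density `pdfDelta`, and the finitely many values of the pattern turn this into
the sum `kappa`. Polar coordinates leave a radial integral. It converges for LoS links because of
the exponential LoS probability and for NLoS links because the exponent exceeds 2. No singularity
arises at distance 0, since the mean loss never exceeds 1. Finiteness of the exponent makes the
interference almost surely finite.

Fading. If the distribution function is `(1 - exp (-b m x))^m`, its tail is an alternating binomial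
sum of exponentials, and averaging over the interference produces values of the Laplace transform
(`Params.coverageGiven_expPowLaw`). The gamma tail lies between the tails for `b = 1` and `b =
(m!)^(-1/m)` (`expPowLaw_one_Ioi_le`, `fadingLaw_Ioi_le`). In both comparisons the densities cross
at most once, which orders the tails of two probability laws. In terms of `expMean u = (1 - exp
(-u)) / u` the crossing follows from monotonicity of `expMean` when `b = 1`, and from monotonicity
of `expMean u ^ (1/u)` when `b = (m!)^(-1/m)`. The latter is the `L^u` norm of `exp (-t)` on the
unit interval. For a fixed proper link and finite interference, coverage is the event that the
fading exceeds a threshold, so ordered tails give ordered coverage probabilities. For `m = 1` both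
values of `b` are 1 and the bounds coincide. -/

/-- The function `x ↦ exp (-x)` on `[0, ∞]`, with value `0` at `∞`. -/
def expNeg (x : ℝ≥0∞) : ℝ := if x = ∞ then 0 else Real.exp (-x.toReal)

@[simp] lemma expNeg_top : expNeg ∞ = 0 := by simp [expNeg]

lemma expNeg_of_ne_top {x : ℝ≥0∞} (hx : x ≠ ∞) : expNeg x = Real.exp (-x.toReal) := by
  simp [expNeg, hx]

@[simp] lemma expNeg_zero : expNeg 0 = 1 := by simp [expNeg]

lemma expNeg_ofReal {x : ℝ} (hx : 0 ≤ x) : expNeg (ENNReal.ofReal x) = Real.exp (-x) := by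
  rw [expNeg_of_ne_top ENNReal.ofReal_ne_top, ENNReal.toReal_ofReal hx]

lemma expNeg_nonneg (x : ℝ≥0∞) : 0 ≤ expNeg x := by
  unfold expNeg; split_ifs <;> positivity

lemma expNeg_le_one (x : ℝ≥0∞) : expNeg x ≤ 1 := by
  unfold expNeg; split_ifs
  · exact zero_le_one
  · simp

lemma expNeg_add (x y : ℝ≥0∞) : expNeg (x + y) = expNeg x * expNeg y := by
  by_cases hx : x = ∞
  · simp [hx]
  by_cases hy : y = ∞
  · simp [hy]
  rw [expNeg_of_ne_top hx, expNeg_of_ne_top hy, expNeg_of_ne_top (by simp [hx, hy]),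
    ENNReal.toReal_add hx hy, ← Real.exp_add]
  congr 1; ring

lemma expNeg_sum {ι : Type*} (s : Finset ι) (f : ι → ℝ≥0∞) :
    expNeg (∑ i ∈ s, f i) = ∏ i ∈ s, expNeg (f i) := by
  classical
  induction s using Finset.induction_on with
  | empty => simp
  | insert a s ha ih => rw [Finset.sum_insert ha, Finset.prod_insert ha, expNeg_add, ih]

/-- Continuity at `∞` is the point: Laplace functionals then pass to the limit without assuming that
the shot noise is finite. -/
lemma continuous_expNeg : Continuous expNeg := by
  rw [continuous_iff_continuousAt]
  intro x
  by_cases hx : x = ∞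
  · subst hx
    rw [ContinuousAt, expNeg_top, Metric.tendsto_nhds]
    intro ε hε
    obtain ⟨K, hK⟩ : ∃ K : ℝ, ∀ y ≥ K, Real.exp (-y) < ε := by
      have := (Real.tendsto_exp_neg_atTop_nhds_zero).eventually (gt_mem_nhds hε)
      exact eventually_atTop.1 this
    filter_upwards [lt_mem_nhds (ENNReal.ofReal_lt_top (r := K))] with y hy
    rw [Real.dist_eq, sub_zero, abs_of_nonneg (expNeg_nonneg y)]
    by_cases hyt : y = ∞
    · simp [hyt, hε]
    rw [expNeg_of_ne_top hyt]
    exact hK _ ((ENNReal.ofReal_le_iff_le_toReal hyt).1 hy.le)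
  · have h : (fun y : ℝ≥0∞ => Real.exp (-y.toReal)) =ᶠ[𝓝 x] expNeg := by
      filter_upwards [gt_mem_nhds (lt_top_iff_ne_top.2 hx)] with y hy
      rw [expNeg_of_ne_top hy.ne]
    refine ContinuousAt.congr ?_ h
    exact (Real.continuous_exp.tendsto _).comp (ENNReal.tendsto_toReal hx).neg

lemma measurable_expNeg : Measurable expNeg := continuous_expNeg.measurable

lemma expNeg_antitone : Antitone expNeg := by
  intro x y hxy
  by_cases hy : y = ∞
  · simp [hy, expNeg_nonneg]
  have hx : x ≠ ∞ := ne_top_of_le_ne_top hy hxy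
  rw [expNeg_of_ne_top hx, expNeg_of_ne_top hy]
  have := ENNReal.toReal_mono hy hxy
  exact Real.exp_le_exp.2 (by linarith)

lemma measurable_expNeg_const_mul (c : ℝ≥0∞) : Measurable fun x => expNeg (c * x) :=
  measurable_expNeg.comp (measurable_const_mul c)

/-- Laplace transform of the Poisson distribution. -/
lemma integral_expNeg_mul_poissonMeasure (r : ℝ≥0) (c : ℝ≥0∞) :
    ∫ n : ℕ, expNeg (c * n) ∂(poissonMeasure r) = Real.exp (-(r * (1 - expNeg c))) := by
  rw [integral_poissonMeasure]
  have h : ∀ n : ℕ, (Real.exp (-r) * (r : ℝ) ^ n / (n.factorial : ℝ)) • expNeg (c * n)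
      = Real.exp (-r) * ((r * expNeg c) ^ n / (n.factorial : ℝ)) := by
    intro n
    have : expNeg (c * n) = expNeg c ^ n := by
      rw [mul_comm, ← nsmul_eq_mul, ← Finset.card_range n, ← Finset.sum_const, expNeg_sum]
      simp
    rw [this, smul_eq_mul, mul_pow]; ring
  simp_rw [h]
  rw [tsum_mul_left, ← (NormedSpace.expSeries_div_hasSum_exp (r * expNeg c : ℝ)).tsum_eq.symm,
    ← Real.exp_eq_exp_ℝ, ← Real.exp_add]
  congr 1; ring

/-! ### Void probabilities and the Laplace functional of a Poisson process -/

namespace IsPoissonProcess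

variable {Ω E : Type*} [MeasurableSpace Ω] [MeasurableSpace E] {P : Measure Ω}
  {N : Ω → Measure E} {Λ : Measure E}

lemma measurable_apply (h : IsPoissonProcess P N Λ) {B : Set E} (hB : MeasurableSet B) :
    Measurable fun ω => N ω B := (Measure.measurable_coe hB).comp h.measurable

lemma integral_expNeg_mul (h : IsPoissonProcess P N Λ) {B : Set E} (hB : MeasurableSet B)
    (c : ℝ≥0∞) (hΛ : Λ B ≠ ∞) :
    ∫ ω, expNeg (c * N ω B) ∂P = expNeg (ENNReal.ofReal (1 - expNeg c) * Λ B) := by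
  have h1 : ∫ ω, expNeg (c * N ω B) ∂P = ∫ x, expNeg (c * x) ∂(P.map fun ω => N ω B) := by
    rw [integral_map (h.measurable_apply hB).aemeasurable]
    exact (measurable_expNeg_const_mul c).aestronglyMeasurable
  rw [h1, h.poisson B hB hΛ, integral_map Measurable.of_discrete.aemeasurable
    (measurable_expNeg_const_mul c).aestronglyMeasurable,
    integral_expNeg_mul_poissonMeasure,
    expNeg_of_ne_top (ENNReal.mul_ne_top ENNReal.ofReal_ne_top hΛ), ENNReal.toReal_mul,
    ENNReal.toReal_ofReal (by linarith [expNeg_le_one c]), ENNReal.coe_toNNReal_eq_toReal, mul_comm]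

/-- Void probabilities. -/
lemma measure_eq_zero [IsProbabilityMeasure P] (h : IsPoissonProcess P N Λ) {B : Set E}
    (hB : MeasurableSet B) (hΛ : Λ B ≠ ∞) :
    P {ω | N ω B = 0} = ENNReal.ofReal (Real.exp (-(Λ B).toReal)) := by
  have : {ω | N ω B = 0} = (fun ω => N ω B) ⁻¹' {0} := rfl
  rw [this, ← Measure.map_apply (h.measurable_apply hB) (measurableSet_singleton _),
    h.poisson B hB hΛ, Measure.map_apply Measurable.of_discrete (measurableSet_singleton _)]
  have h2 : (fun n : ℕ => (n : ℝ≥0∞)) ⁻¹' {0} = {0} := by ext; simp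
  rw [h2, poissonMeasure_singleton]
  simp [ENNReal.coe_toNNReal_eq_toReal]

lemma ae_lt_top (h : IsPoissonProcess P N Λ) {B : Set E} (hB : MeasurableSet B)
    (hΛ : Λ B ≠ ∞) : ∀ᵐ ω ∂P, N ω B < ∞ := by
  have h1 : ∀ᵐ x ∂(P.map fun ω => N ω B), x < ∞ := by
    rw [h.poisson B hB hΛ, ae_map_iff Measurable.of_discrete.aemeasurable measurableSet_Iio]
    exact ae_of_all _ fun n => ENNReal.natCast_lt_top n
  exact ae_of_ae_map (h.measurable_apply hB).aemeasurable h1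

/-- The integral of a simple function is a combination of counts on its disjoint level sets. The
counts are independent, so the exponential factorises into Poisson transforms. The level `0`
contributes nothing and may have infinite mean. -/
lemma integral_expNeg_lintegral_simpleFunc (h : IsPoissonProcess P N Λ)
    (g : SimpleFunc E ℝ≥0∞) (hΛ : ∀ c, c ≠ 0 → Λ (g ⁻¹' {c}) ≠ ∞) :
    ∫ ω, expNeg (∫⁻ x, g x ∂(N ω)) ∂P
      = expNeg (∫⁻ x, ENNReal.ofReal (1 - expNeg (g x)) ∂Λ) := by
  have hr : ∀ ω, expNeg (∫⁻ x, g x ∂(N ω))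
      = ∏ c : {c // c ∈ g.range}, expNeg (c.1 * N ω (g ⁻¹' {c.1})) := by
    intro ω
    rw [SimpleFunc.lintegral_eq_lintegral, SimpleFunc.lintegral, expNeg_sum]
    exact (Finset.prod_coe_sort g.range fun c => expNeg (c * N ω (g ⁻¹' {c}))).symm
  have hl : ∫⁻ x, ENNReal.ofReal (1 - expNeg (g x)) ∂Λ
      = ∑ c : {c // c ∈ g.range}, ENNReal.ofReal (1 - expNeg c.1) * Λ (g ⁻¹' {c.1}) := by
    rw [Finset.sum_coe_sort g.range fun c => ENNReal.ofReal (1 - expNeg c) * Λ (g ⁻¹' {c}),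
      ← SimpleFunc.map_lintegral, ← SimpleFunc.lintegral_eq_lintegral]
    rfl
  rw [hl, expNeg_sum]
  simp_rw [hr]
  have hind : iIndepFun (fun (c : {c // c ∈ g.range}) ω => N ω (g ⁻¹' {c.1})) P := by
    let e := Fintype.equivFin {c // c ∈ g.range}
    have h0 := h.indep _ (fun i => g ⁻¹' {(e.symm i).1}) (fun i => g.measurableSet_fiber _)
      (fun i j hij => by
        refine Disjoint.preimage _ (disjoint_singleton.2 fun hh => hij ?_)
        exact e.symm.injective (Subtype.ext hh))
    have := h0.precomp (g := e) e.injective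
    simpa using this
  rw [hind.integral_fun_prod_comp (f := fun c x => expNeg (c.1 * x))
    (fun c => (h.measurable_apply (g.measurableSet_fiber _)).aemeasurable)
    (fun c => (measurable_expNeg_const_mul c.1).aestronglyMeasurable)]
  refine Finset.prod_congr rfl fun c _ => ?_
  by_cases h0 : c.1 = 0
  · have := hind.isProbabilityMeasure
    simp [h0]
  · exact h.integral_expNeg_mul (g.measurableSet_fiber _) _ (hΛ _ h0)

/-- The Laplace functional of a Poisson point process. -/
theorem integral_expNeg_lintegral [IsProbabilityMeasure P] [SigmaFinite Λ]
    (h : IsPoissonProcess P N Λ)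
    {f : E → ℝ≥0∞} (hf : Measurable f) :
    ∫ ω, expNeg (∫⁻ x, f x ∂(N ω)) ∂P
      = expNeg (∫⁻ x, ENNReal.ofReal (1 - expNeg (f x)) ∂Λ) := by
  -- Besides approximating `f` from below, each `g n` is cut off outside a set of finite mean, so
  -- that its nonzero levels satisfy the finiteness condition of the simple case.
  let g : ℕ → SimpleFunc E ℝ≥0∞ := fun n =>
    (SimpleFunc.eapprox f n).restrict (spanningSets Λ n)
  have gval : ∀ n x,
      g n x = (spanningSets Λ n).indicator (SimpleFunc.eapprox f n) x := fun n x => by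
    rw [SimpleFunc.restrict_apply _ (measurableSet_spanningSets Λ n)]
  have gmono : ∀ x, Monotone fun n => g n x := by
    intro x m n hmn
    simp only [gval]
    refine (indicator_le_indicator_of_subset (monotone_spanningSets Λ hmn)
      (fun _ => zero_le) x).trans ?_
    exact indicator_le_indicator (SimpleFunc.monotone_eapprox f hmn x)
  have glim : ∀ x, Tendsto (fun n => g n x) atTop (𝓝 (f x)) := by
    intro x
    have h1 : Tendsto (fun n => SimpleFunc.eapprox f n x) atTop (𝓝 (f x)) := by
      rw [← SimpleFunc.iSup_eapprox_apply hf x]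
      exact tendsto_atTop_iSup fun m n hmn => SimpleFunc.monotone_eapprox f hmn x
    refine h1.congr' ?_
    obtain ⟨k, hk⟩ := mem_iUnion.1 (by rw [iUnion_spanningSets Λ]; trivial :
      x ∈ ⋃ i, spanningSets Λ i)
    filter_upwards [eventually_ge_atTop k] with n hn
    rw [gval, indicator_of_mem (monotone_spanningSets Λ hn hk)]
  have hfin : ∀ n c, c ≠ 0 → Λ (g n ⁻¹' {c}) ≠ ∞ := by
    intro n c hc
    refine ne_top_of_le_ne_top (measure_spanningSets_lt_top Λ n).ne (measure_mono fun x hx => ?_)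
    by_contra hxs
    apply hc
    rw [← (hx : g n x = c), gval, indicator_of_notMem hxs]
  have key := fun n => h.integral_expNeg_lintegral_simpleFunc (g n) (hfin n)
  -- Monotone convergence serves both sides: `ν = N ω` with `φ = id`, and `ν = Λ` with `φ y = 1 -
  -- exp (-y)`.
  have hlim : ∀ ν : Measure E, ∀ φ : ℝ≥0∞ → ℝ≥0∞, Monotone φ → Continuous φ →
      Tendsto (fun n => ∫⁻ x, φ (g n x) ∂ν) atTop (𝓝 (∫⁻ x, φ (f x) ∂ν)) := by
    intro ν φ hφ hc
    refine lintegral_tendsto_of_tendsto_of_monotone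
      (fun n => (hc.measurable.comp (g n).measurable).aemeasurable)
      (ae_of_all _ fun x => hφ.comp (gmono x))
      (ae_of_all _ fun x => (hc.tendsto _).comp (glim x))
  have hL : Tendsto (fun n => ∫ ω, expNeg (∫⁻ x, g n x ∂(N ω)) ∂P) atTop
      (𝓝 (∫ ω, expNeg (∫⁻ x, f x ∂(N ω)) ∂P)) := by
    refine tendsto_integral_of_dominated_convergence (fun _ => 1) (fun n => ?_)
      (integrable_const _) (fun n => ae_of_all _ fun ω => ?_) (ae_of_all _ fun ω => ?_)
    · exact (measurable_expNeg.comp ((Measure.measurable_lintegral (g n).measurable).comp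
        h.measurable)).aestronglyMeasurable
    · rw [Real.norm_eq_abs, abs_of_nonneg (expNeg_nonneg _)]
      exact expNeg_le_one _
    · exact (continuous_expNeg.tendsto _).comp (hlim (N ω) id monotone_id continuous_id)
  have hR := (continuous_expNeg.tendsto _).comp (hlim Λ (fun y => ENNReal.ofReal (1 - expNeg y))
    (fun x y hxy => ENNReal.ofReal_le_ofReal (by linarith [expNeg_antitone hxy]))
    (ENNReal.continuous_ofReal.comp (continuous_const.sub continuous_expNeg)))
  exact tendsto_nhds_unique hL (hR.congr fun n => (key n).symm)

/-- A shot noise is almost surely finite if its Laplace exponent is finite. -/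
theorem ae_lintegral_ne_top [IsProbabilityMeasure P] [SigmaFinite Λ]
    (h : IsPoissonProcess P N Λ) {f : E → ℝ≥0∞} (hf : Measurable f) (hft : ∀ x, f x ≠ ∞)
    (hΛ : ∫⁻ x, ENNReal.ofReal (1 - expNeg (f x)) ∂Λ ≠ ∞) :
    ∀ᵐ ω ∂P, ∫⁻ x, f x ∂(N ω) ≠ ∞ := by
  -- Scaling by `c n → 0` detects infinity: for the shot noise `S`, the mean of `exp (-c n S)` tends
  -- to the probability that `S` is finite, while the Laplace exponent tends to `0` by dominated
  -- convergence. Hence that probability is 1.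
  let c : ℕ → ℝ≥0∞ := fun n => ((n : ℝ≥0∞) + 1)⁻¹
  have hc1 : ∀ n, c n ≤ 1 := fun n => ENNReal.inv_le_one.2 le_add_self
  have hc0 : Tendsto c atTop (𝓝 0) := by
    have := (tendsto_add_atTop_iff_nat (f := fun n : ℕ => (n : ℝ≥0∞)⁻¹) 1).2
      ENNReal.tendsto_inv_nat_nhds_zero
    refine this.congr fun n => by simp [c]
  have hmI : Measurable fun ω => ∫⁻ x, f x ∂(N ω) :=
    (Measure.measurable_lintegral hf).comp h.measurable
  have key : ∀ n, ∫ ω, expNeg (c n * ∫⁻ x, f x ∂(N ω)) ∂P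
      = expNeg (∫⁻ x, ENNReal.ofReal (1 - expNeg (c n * f x)) ∂Λ) := by
    intro n
    rw [← h.integral_expNeg_lintegral (hf.const_mul (c n))]
    simp_rw [lintegral_const_mul (c n) hf]
  have hR : Tendsto (fun n => expNeg (∫⁻ x, ENNReal.ofReal (1 - expNeg (c n * f x)) ∂Λ)) atTop
      (𝓝 1) := by
    suffices hJ : Tendsto (fun n => ∫⁻ x, ENNReal.ofReal (1 - expNeg (c n * f x)) ∂Λ) atTop
        (𝓝 (∫⁻ _, 0 ∂Λ)) by
      have h1 := (continuous_expNeg.tendsto _).comp hJ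
      rwa [lintegral_zero, expNeg_zero] at h1
    refine tendsto_lintegral_of_dominated_convergence
      (fun x => ENNReal.ofReal (1 - expNeg (f x))) (fun n => ?_) (fun n => ae_of_all _ fun x => ?_)
      hΛ (ae_of_all _ fun x => ?_)
    · exact ENNReal.measurable_ofReal.comp
        (measurable_const.sub (measurable_expNeg.comp (hf.const_mul _)))
    · refine ENNReal.ofReal_le_ofReal (sub_le_sub_left (expNeg_antitone ?_) _)
      calc c n * f x ≤ 1 * f x := by gcongr; exact hc1 n
        _ = f x := one_mul _
    · have h1 : Tendsto (fun n => c n * f x) atTop (𝓝 0) := by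
        simpa using ENNReal.Tendsto.mul_const hc0 (Or.inr (hft x))
      have h2 := (continuous_expNeg.tendsto 0).comp h1
      have h3 := ENNReal.tendsto_ofReal (h2.const_sub 1)
      simpa using h3
  have hL : Tendsto (fun n => ∫ ω, expNeg (c n * ∫⁻ x, f x ∂(N ω)) ∂P) atTop
      (𝓝 (∫ ω, {ω | ∫⁻ x, f x ∂(N ω) ≠ ∞}.indicator (fun _ => (1 : ℝ)) ω ∂P)) := by
    refine tendsto_integral_of_dominated_convergence (fun _ => 1) (fun n => ?_)
      (integrable_const _) (fun n => ae_of_all _ fun ω => ?_) (ae_of_all _ fun ω => ?_)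
    · exact (measurable_expNeg.comp (hmI.const_mul _)).aestronglyMeasurable
    · rw [Real.norm_eq_abs, abs_of_nonneg (expNeg_nonneg _)]
      exact expNeg_le_one _
    · by_cases hω : ∫⁻ x, f x ∂(N ω) = ∞
      · have hcn : ∀ n, c n ≠ 0 := fun n => by simp [c]
        simp [hω, ENNReal.mul_top (hcn _)]
      · have h1 : Tendsto (fun n => c n * ∫⁻ x, f x ∂(N ω)) atTop (𝓝 0) := by
          simpa using ENNReal.Tendsto.mul_const hc0 (Or.inr hω)
        have h2 := (continuous_expNeg.tendsto 0).comp h1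
        simpa [hω, Function.comp_def] using h2
  have hms : MeasurableSet {ω | ∫⁻ x, f x ∂(N ω) ≠ ∞} :=
    hmI (measurableSet_singleton ∞).compl
  have := tendsto_nhds_unique hL (hR.congr fun n => (key n).symm)
  rw [integral_indicator hms, setIntegral_const, smul_eq_mul, mul_one, measureReal_def,
    ENNReal.toReal_eq_one_iff] at this
  exact (prob_compl_eq_zero_iff hms).2 this

end IsPoissonProcess

/-! ### Fading laws -/

/-- The function `(1 - exp (-u)) / u = ∫ t in 0..1, exp (-u t)`. -/
def expMean (u : ℝ) : ℝ := ∫ t in Ioc (0 : ℝ) 1, Real.exp (-(u * t))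

lemma hasDerivAt_exp_neg_mul (c t : ℝ) :
    HasDerivAt (fun t => Real.exp (-(c * t))) (-c * Real.exp (-(c * t))) t := by
  have h := ((hasDerivAt_id t).const_mul (-c)).exp
  simp only [id, neg_mul, mul_one] at h
  convert! h using 1
  ring

lemma integrable_exp_neg_mul_Ioc (u : ℝ) :
    Integrable (fun t => Real.exp (-(u * t))) (volume.restrict (Ioc (0 : ℝ) 1)) :=
  (Continuous.integrableOn_Icc (by fun_prop)).mono_set Ioc_subset_Icc_self

lemma expMean_eq {u : ℝ} (hu : 0 < u) : expMean u = (1 - Real.exp (-u)) / u := by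
  rw [expMean, ← intervalIntegral.integral_of_le zero_le_one]
  have h : ∀ t ∈ uIcc (0 : ℝ) 1, HasDerivAt (fun t => -(Real.exp (-(u * t)) / u))
      (Real.exp (-(u * t))) t := by
    intro t _
    have h2 := ((hasDerivAt_exp_neg_mul u t).div_const u).neg
    convert! h2 using 1
    field_simp
  rw [intervalIntegral.integral_eq_sub_of_hasDerivAt h
    (Continuous.intervalIntegrable (by fun_prop) _ _)]
  simp
  ring

lemma expMean_antitone {u v : ℝ} (huv : u ≤ v) : expMean v ≤ expMean u := by
  refine integral_mono_ae (integrable_exp_neg_mul_Ioc v) (integrable_exp_neg_mul_Ioc u) ?_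
  filter_upwards [ae_restrict_mem measurableSet_Ioc] with t ht
  exact Real.exp_le_exp.2 (neg_le_neg (mul_le_mul_of_nonneg_right huv ht.1.le))

lemma expMean_pos {u : ℝ} (hu : 0 < u) : 0 < expMean u := by
  rw [expMean_eq hu]
  have : Real.exp (-u) < 1 := by
    rw [← Real.exp_zero]; exact Real.exp_lt_exp.2 (by linarith)
  exact div_pos (by linarith) hu

/-- `expMean u ^ (1/u)` is the `L^u` norm of `exp (-t)` on the unit interval, a probability space,
hence nondecreasing in `u`. This is Jensen's inequality for the power `v / u ≥ 1`. -/
lemma expMean_rpow_le {u v : ℝ} (hu : 0 < u) (huv : u ≤ v) :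
    expMean u ^ (v / u) ≤ expMean v := by
  have hp : 1 ≤ v / u := (one_le_div hu).2 huv
  have : IsProbabilityMeasure (volume.restrict (Ioc (0 : ℝ) 1)) := ⟨by simp⟩
  have hpow : ∀ t : ℝ, Real.exp (-(u * t)) ^ (v / u) = Real.exp (-(v * t)) := by
    intro t
    rw [← Real.exp_mul]
    congr 1
    field_simp
  have := (convexOn_rpow hp).map_integral_le (μ := volume.restrict (Ioc (0 : ℝ) 1))
    (f := fun t => Real.exp (-(u * t)))
    (Real.continuous_rpow_const (by linarith)).continuousOn isClosed_Ici
    (ae_of_all _ fun t => (Real.exp_pos _).le) (integrable_exp_neg_mul_Ioc u)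
    (by simpa [Function.comp_def, hpow] using integrable_exp_neg_mul_Ioc v)
  simpa [expMean, hpow] using this

/-- The law on `[0, ∞)` with distribution function `(1 - exp (-b m x)) ^ m`. -/
def expPowLaw (m : ℕ) (b : ℝ) : Measure ℝ :=
  (volume.restrict (Ioi (0 : ℝ))).withDensity fun x =>
    ENNReal.ofReal (m * (b * m) * Real.exp (-(b * m * x))
      * (1 - Real.exp (-(b * m * x))) ^ (m - 1))

lemma approxFadingLaw_eq (m : ℕ) :
    Params.approxFadingLaw m = expPowLaw m (Params.fadingConst m) := rfl

lemma expPowLaw_Ioi {m : ℕ} (hm : 0 < m) {b : ℝ} (hb : 0 < b) {x : ℝ} (hx : 0 ≤ x) :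
    expPowLaw m b (Ioi x) = ENNReal.ofReal (1 - (1 - Real.exp (-(b * m * x))) ^ m) := by
  have hc : 0 < b * m := by positivity
  rw [expPowLaw, withDensity_apply _ measurableSet_Ioi,
    Measure.restrict_restrict measurableSet_Ioi, Ioi_inter_Ioi, max_eq_left hx]
  have hderiv : ∀ y ∈ Ici x, HasDerivAt (fun y => (1 - Real.exp (-(b * m * y))) ^ m)
      (m * (b * m) * Real.exp (-(b * m * y)) * (1 - Real.exp (-(b * m * y))) ^ (m - 1)) y := by
    intro y _
    have h2 := ((hasDerivAt_exp_neg_mul (b * m) y).const_sub 1).pow m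
    convert! h2 using 1
    ring
  have hpos : ∀ y ∈ Ioi x, 0 ≤ m * (b * m) * Real.exp (-(b * m * y))
      * (1 - Real.exp (-(b * m * y))) ^ (m - 1) := by
    intro y hy
    have : Real.exp (-(b * m * y)) ≤ 1 := Real.exp_le_one_iff.2 (by
      have : 0 ≤ b * m * y := mul_nonneg hc.le (hx.trans (le_of_lt hy))
      linarith)
    have h2 : 0 ≤ 1 - Real.exp (-(b * m * y)) := by linarith
    positivity
  have hlim : Tendsto (fun y => (1 - Real.exp (-(b * m * y))) ^ m) atTop (𝓝 1) := by
    have h1 : Tendsto (fun y => Real.exp (-(b * m * y))) atTop (𝓝 0) :=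
      Real.tendsto_exp_neg_atTop_nhds_zero.comp (tendsto_id.const_mul_atTop hc)
    simpa using (h1.const_sub 1).pow m
  rw [← ofReal_integral_eq_lintegral_ofReal (integrableOn_Ioi_deriv_of_nonneg' hderiv hpos hlim)
    ((ae_restrict_iff' measurableSet_Ioi).2 (ae_of_all _ hpos)),
    integral_Ioi_of_hasDerivAt_of_nonneg' hderiv hpos hlim]

lemma expPowLaw_Iic (m : ℕ) (b : ℝ) : expPowLaw m b (Iic 0) = 0 := by
  rw [expPowLaw, withDensity_apply _ measurableSet_Iic,
    Measure.restrict_restrict measurableSet_Iic, Iic_inter_Ioi, Ioc_self]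
  simp

lemma isProbabilityMeasure_expPowLaw {m : ℕ} (hm : 0 < m) {b : ℝ} (hb : 0 < b) :
    IsProbabilityMeasure (expPowLaw m b) := by
  refine ⟨?_⟩
  rw [← Iic_union_Ioi (a := (0 : ℝ)), measure_union (by simp) measurableSet_Ioi,
    expPowLaw_Iic, expPowLaw_Ioi hm hb le_rfl]
  simp [hm.ne']

/-- Density of the fading law on the positive half line. -/
def fadingDensity (m : ℕ) (x : ℝ) : ℝ :=
  m * (m * x) ^ (m - 1) * Real.exp (-(m * x)) / ((m - 1).factorial : ℝ)

lemma gammaPDF_nat {m : ℕ} (hm : 0 < m) {x : ℝ} (hx : 0 < x) :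
    gammaPDF m m x = ENNReal.ofReal (fadingDensity m x) := by
  rw [gammaPDF_of_nonneg hx.le, fadingDensity]
  congr 1
  obtain ⟨k, rfl⟩ : ∃ k, m = k + 1 := ⟨m - 1, by omega⟩
  have h1 : Real.Gamma ((k + 1 : ℕ) : ℝ) = (k.factorial : ℝ) := by
    rw [Nat.cast_add_one]; exact Real.Gamma_nat_eq_factorial k
  have h2 : (((k + 1 : ℕ) : ℝ) - 1) = k := by push_cast; ring
  rw [h1, h2, Real.rpow_natCast, Real.rpow_natCast, Nat.add_sub_cancel, mul_pow, pow_succ]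
  ring

lemma isProbabilityMeasure_fadingLaw {m : ℕ} (hm : 0 < m) :
    IsProbabilityMeasure (Params.fadingLaw m) :=
  isProbabilityMeasure_gammaMeasure (by positivity) (by positivity)

lemma fadingLaw_eq {m : ℕ} (hm : 0 < m) :
    Params.fadingLaw m
      = (volume.restrict (Ioi (0 : ℝ))).withDensity
        fun x => ENNReal.ofReal (fadingDensity m x) := by
  have h1 : (volume.restrict (Ioi (0 : ℝ))).withDensity
      (fun x => ENNReal.ofReal (fadingDensity m x))
      = (volume.restrict (Ioi (0 : ℝ))).withDensity (gammaPDF m m) := by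
    refine withDensity_congr_ae ?_
    filter_upwards [ae_restrict_mem measurableSet_Ioi] with x hx
    exact (gammaPDF_nat hm hx).symm
  rw [h1, Params.fadingLaw, gammaMeasure, ← withDensity_indicator measurableSet_Ioi]
  refine withDensity_congr_ae ?_
  -- The origin has to be discarded: for `m = 1` the gamma density is positive there.
  filter_upwards [compl_mem_ae_iff.2 (measure_singleton (0 : ℝ))] with x hx
  rcases lt_trichotomy x 0 with h | h | h
  · rw [gammaPDF_of_neg h, indicator_of_notMem (by simp [h.le])]
  · exact absurd h hx
  · rw [indicator_of_mem (mem_Ioi.2 h)]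

lemma fadingLaw_Iic {m : ℕ} (hm : 0 < m) : Params.fadingLaw m (Iic 0) = 0 := by
  rw [fadingLaw_eq hm, withDensity_apply _ measurableSet_Iic,
    Measure.restrict_restrict measurableSet_Iic, Iic_inter_Ioi, Ioc_self]
  simp

/-- Comparison of the tails of two laws on `(0, ∞)` whose densities cross once. -/
lemma withDensity_Ioi_le_of_crossing {p q : ℝ → ℝ≥0∞}
    (hp : IsProbabilityMeasure ((volume.restrict (Ioi (0 : ℝ))).withDensity p))
    (hq : IsProbabilityMeasure ((volume.restrict (Ioi (0 : ℝ))).withDensity q))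
    {x : ℝ}
    (h : (∀ y, 0 < y → y ≤ x → q y ≤ p y) ∨ ∀ y, x < y → p y ≤ q y) :
    (volume.restrict (Ioi (0 : ℝ))).withDensity p (Ioi x)
      ≤ (volume.restrict (Ioi (0 : ℝ))).withDensity q (Ioi x) := by
  -- Before the crossing the masses of `Iic x` are compared, and equality of the total masses
  -- reverses the inequality for the tails. After the crossing the tails are compared directly.
  rcases h with h | h
  · have h1 : (volume.restrict (Ioi (0 : ℝ))).withDensity q (Iic x)
        ≤ (volume.restrict (Ioi (0 : ℝ))).withDensity p (Iic x) := by
      rw [withDensity_apply _ measurableSet_Iic, withDensity_apply _ measurableSet_Iic,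
        Measure.restrict_restrict measurableSet_Iic]
      exact setLIntegral_mono' (measurableSet_Iic.inter measurableSet_Ioi)
        fun y hy => h y hy.2 hy.1
    rw [← compl_Iic (a := x), prob_compl_eq_one_sub measurableSet_Iic,
      prob_compl_eq_one_sub measurableSet_Iic]
    exact tsub_le_tsub_left h1 _
  · rw [withDensity_apply _ measurableSet_Ioi, withDensity_apply _ measurableSet_Ioi,
      Measure.restrict_restrict measurableSet_Ioi]
    exact setLIntegral_mono' (measurableSet_Ioi.inter measurableSet_Ioi)
        fun y hy => h y hy.1

lemma fadingConst_pos (m : ℕ) : 0 < Params.fadingConst m :=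
  Real.rpow_pos_of_pos (by positivity) _

lemma fadingConst_pow {m : ℕ} (hm : 0 < m) :
    Params.fadingConst m ^ m = ((m.factorial : ℝ))⁻¹ := by
  rw [Params.fadingConst, ← Real.rpow_natCast, ← Real.rpow_mul (by positivity),
    div_mul_cancel₀ _ (by positivity), Real.rpow_neg_one]

lemma fadingConst_one : Params.fadingConst 1 = 1 := by simp [Params.fadingConst]

/-- This isolates the factor `m * (m * x) ^ (m - 1)` shared with the gamma density, so comparing the
two densities becomes an inequality about `expMean`. -/
lemma fadingDensity_eq_expMean {m : ℕ} (hm : 0 < m) {b : ℝ} (hb : 0 < b) {x : ℝ} (hx : 0 < x) :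
    m * (b * m) * Real.exp (-(b * m * x)) * (1 - Real.exp (-(b * m * x))) ^ (m - 1)
      = m * (m * x) ^ (m - 1) * Real.exp (-(b * m * x))
        * (m * b ^ m * expMean (b * m * x) ^ (m - 1)) := by
  have hy : 0 < b * m * x := by positivity
  have h1 : 1 - Real.exp (-(b * m * x)) = (b * m * x) * expMean (b * m * x) := by
    rw [expMean_eq hy]; field_simp
  obtain ⟨k, rfl⟩ : ∃ k, m = k + 1 := ⟨m - 1, by omega⟩
  rw [h1, Nat.add_sub_cancel, mul_pow, mul_assoc b, mul_pow b, pow_succ]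
  ring

/-- The fading law is stochastically dominated by the approximate fading law. -/
theorem fadingLaw_Ioi_le {m : ℕ} (hm : 0 < m) (x : ℝ) :
    Params.fadingLaw m (Ioi x) ≤ expPowLaw m (Params.fadingConst m) (Ioi x) := by
  set b := Params.fadingConst m with hbdef
  have hb : 0 < b := fadingConst_pos m
  -- This identity is the reason for the constant `(m!)^(-1/m)`: it gives the two densities the same
  -- leading coefficient at `0`, and all constants cancel in `hcond`.
  have hbm : m * b ^ m = (((m - 1).factorial : ℝ))⁻¹ := by
    rw [hbdef, fadingConst_pow hm, ← Nat.mul_factorial_pred hm.ne', Nat.cast_mul]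
    field_simp
  have hcond : ∀ y, 0 < y → (m * (b * m) * Real.exp (-(b * m * y))
      * (1 - Real.exp (-(b * m * y))) ^ (m - 1) ≤ fadingDensity m y ↔
      expMean (b * m * y) ^ (m - 1) ≤ Real.exp (-((1 - b) * m * y))) := by
    intro y hy
    have hfac : (0 : ℝ) < (m - 1).factorial := by positivity
    have e : Real.exp (-(m * y)) = Real.exp (-(b * m * y)) * Real.exp (-((1 - b) * m * y)) := by
      rw [← Real.exp_add]; congr 1; ring
    rw [fadingDensity_eq_expMean hm hb hy, hbm, fadingDensity, e]
    have hC : 0 < m * (m * y) ^ (m - 1) * Real.exp (-(b * m * y)) *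
        (((m - 1).factorial : ℝ))⁻¹ := by
      positivity
    refine Iff.trans (Eq.to_iff ?_) (mul_le_mul_iff_right₀ hC)
    congr 1 <;> ring
  -- The gamma density is the larger one on an initial interval. Indeed the condition says that
  -- `expMean (b m y) ^ ((m - 1) / y) ≤ exp (-(1 - b) m)`, whose left side is nondecreasing in `y`
  -- by `expMean_rpow_le`.
  have hmono : ∀ u v, 0 < u → u ≤ v →
      expMean (b * m * v) ^ (m - 1) ≤ Real.exp (-((1 - b) * m * v)) →
      expMean (b * m * u) ^ (m - 1) ≤ Real.exp (-((1 - b) * m * u)) := by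
    intro u v hu huv hv
    have hv0 : 0 < v := hu.trans_le huv
    have hm' : (0 : ℝ) < m := by positivity
    have hbu : 0 < b * m * u := by positivity
    have hbv : 0 < b * m * v := by positivity
    have h1 := expMean_rpow_le hbu (show b * m * u ≤ b * m * v by gcongr)
    have h2 : expMean (b * m * u) ≤ expMean (b * m * v) ^ (u / v) := by
      have h3 := Real.rpow_le_rpow (by have := expMean_pos hbu; positivity) h1
        (by positivity : 0 ≤ u / v)
      rwa [← Real.rpow_mul (expMean_pos hbu).le,
        show (b * m * v) / (b * m * u) * (u / v) = 1 by field_simp, Real.rpow_one] at h3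
    calc expMean (b * m * u) ^ (m - 1) ≤ (expMean (b * m * v) ^ (u / v)) ^ (m - 1) :=
          pow_le_pow_left₀ (expMean_pos hbu).le h2 _
      _ = (expMean (b * m * v) ^ (m - 1)) ^ (u / v) := by
          rw [← Real.rpow_natCast, ← Real.rpow_natCast, ← Real.rpow_mul (expMean_pos hbv).le,
            ← Real.rpow_mul (expMean_pos hbv).le,
            mul_comm (u / v)]
      _ ≤ Real.exp (-((1 - b) * m * v)) ^ (u / v) :=
          Real.rpow_le_rpow (by have := expMean_pos hbv; positivity) hv (by positivity)
      _ = Real.exp (-((1 - b) * m * u)) := by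
          rw [← Real.exp_mul]; congr 1; field_simp
  have hP := isProbabilityMeasure_fadingLaw hm
  rw [fadingLaw_eq hm] at hP ⊢
  refine withDensity_Ioi_le_of_crossing hP (isProbabilityMeasure_expPowLaw hm hb) ?_
  -- The question is whether the crossing lies to the left of `x`. For `x ≤ 0` the second case
  -- applies and is vacuous.
  by_cases hC : 0 < x ∧ ¬ expMean (b * m * x) ^ (m - 1) ≤ Real.exp (-((1 - b) * m * x))
  · right
    intro y hy
    have hy0 := hC.1.trans hy
    refine ENNReal.ofReal_le_ofReal ?_
    by_contra hlt
    exact hC.2 (hmono x y hC.1 hy.le ((hcond y hy0).1 (not_le.1 hlt).le))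
  · left
    intro y hy hyx
    refine ENNReal.ofReal_le_ofReal ((hcond y hy).2 ?_)
    by_contra hlt
    exact hC ⟨hy.trans_le hyx, fun h => hlt (hmono y x hy hyx h)⟩

/-- The fading law dominates the law of the maximum of `m` exponential variables of rate `m`. -/
theorem expPowLaw_one_Ioi_le {m : ℕ} (hm : 0 < m) (x : ℝ) :
    expPowLaw m 1 (Ioi x) ≤ Params.fadingLaw m (Ioi x) := by
  have hm' : (0 : ℝ) < m := by positivity
  have hcond : ∀ y, 0 < y → (fadingDensity m y ≤ m * (1 * m) * Real.exp (-(1 * m * y))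
      * (1 - Real.exp (-(1 * m * y))) ^ (m - 1) ↔
      (((m - 1).factorial : ℝ))⁻¹ ≤ m * expMean (m * y) ^ (m - 1)) := by
    intro y hy
    rw [fadingDensity_eq_expMean hm one_pos hy, fadingDensity, one_mul, one_pow, mul_one]
    have hC : 0 < m * (m * y) ^ (m - 1) * Real.exp (-(m * y)) := by positivity
    rw [div_eq_mul_inv]
    exact mul_le_mul_iff_right₀ hC
  -- With `b = 1` the exponential factors agree, and since `expMean` is decreasing, the gamma
  -- density is the smaller one on an initial interval.
  have hmono : ∀ u v, 0 < u → u ≤ v →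
      (((m - 1).factorial : ℝ))⁻¹ ≤ m * expMean (m * v) ^ (m - 1) →
      (((m - 1).factorial : ℝ))⁻¹ ≤ m * expMean (m * u) ^ (m - 1) := by
    intro u v hu huv hv
    refine hv.trans ?_
    have h0 : 0 < m * v := mul_pos hm' (hu.trans_le huv)
    have h1 : expMean (m * v) ≤ expMean (m * u) := expMean_antitone (by gcongr)
    have := (expMean_pos h0).le
    gcongr
  have hP := isProbabilityMeasure_fadingLaw hm
  rw [fadingLaw_eq hm] at hP ⊢
  refine withDensity_Ioi_le_of_crossing (isProbabilityMeasure_expPowLaw hm one_pos) hP ?_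
  by_cases hC : 0 < x ∧ ¬ (((m - 1).factorial : ℝ))⁻¹ ≤ m * expMean (m * x) ^ (m - 1)
  · right
    intro y hy
    have hy0 := hC.1.trans hy
    refine ENNReal.ofReal_le_ofReal ?_
    by_contra hlt
    exact hC.2 (hmono x y hC.1 hy.le ((hcond y hy0).1 (not_le.1 hlt).le))
  · left
    intro y hy hyx
    refine ENNReal.ofReal_le_ofReal ((hcond y hy).2 ?_)
    by_contra hlt
    exact hC ⟨hy.trans_le hyx, fun h => hlt (hmono y x hy hyx h)⟩

/-- Laplace transform of the fading law. -/
lemma integral_exp_neg_fadingLaw {m : ℕ} (hm : 0 < m) {x : ℝ} (hx : 0 ≤ x) :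
    ∫ h, Real.exp (-(x * h)) ∂(Params.fadingLaw m) = ((1 + x / m) ^ m)⁻¹ := by
  have hm' : (0 : ℝ) < m := by positivity
  have hmeas : Measurable (fadingDensity m) := by unfold fadingDensity; fun_prop
  rw [fadingLaw_eq hm, integral_withDensity_eq_integral_toReal_smul
    hmeas.ennreal_ofReal (ae_of_all _ fun _ => ENNReal.ofReal_lt_top)]
  have h1 : ∫ h in Ioi (0 : ℝ), (ENNReal.ofReal (fadingDensity m h)).toReal • Real.exp (-(x * h))
      = ∫ h in Ioi (0 : ℝ), (m ^ m / ((m - 1).factorial : ℝ)) *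
        (h ^ ((m : ℝ) - 1) * Real.exp (-((m + x) * h))) := by
    refine setIntegral_congr_fun measurableSet_Ioi fun h hh => ?_
    have hh : 0 < h := hh
    have h0 : 0 ≤ fadingDensity m h := by unfold fadingDensity; positivity
    simp only [ENNReal.toReal_ofReal h0, smul_eq_mul]
    obtain ⟨k, rfl⟩ : ∃ k, m = k + 1 := ⟨m - 1, by omega⟩
    have h2 : (((k + 1 : ℕ) : ℝ) - 1) = k := by push_cast; ring
    have e : Real.exp (-((((k + 1 : ℕ) : ℝ) + x) * h))
        = Real.exp (-(((k + 1 : ℕ) : ℝ) * h)) * Real.exp (-(x * h)) := by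
      rw [← Real.exp_add]; congr 1; ring
    rw [h2, Real.rpow_natCast, fadingDensity, Nat.add_sub_cancel, mul_pow, e, pow_succ]
    ring
  rw [h1, integral_const_mul, Real.integral_rpow_mul_exp_neg_mul_Ioi hm' (by positivity)]
  obtain ⟨k, rfl⟩ : ∃ k, m = k + 1 := ⟨m - 1, by omega⟩
  have h3 : Real.Gamma ((k + 1 : ℕ) : ℝ) = (k.factorial : ℝ) := by
    rw [Nat.cast_add_one]; exact Real.Gamma_nat_eq_factorial k
  rw [h3, Real.rpow_natCast, Nat.add_sub_cancel]
  have hs : 1 + x / ((k + 1 : ℕ) : ℝ) = (((k + 1 : ℕ) : ℝ) + x) / ((k + 1 : ℕ) : ℝ) := by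
    field_simp
  rw [hs, div_pow, div_pow, one_pow]
  have : (0 : ℝ) < ((k + 1 : ℕ) : ℝ) + x := by positivity
  field_simp

/-! ### Conditional coverage -/

namespace Params

variable (par : Params)

lemma lamR_nonneg : 0 ≤ par.lamR := mul_nonneg par.mu_nonneg par.lamO_pos.le

lemma blockage_pos : 0 < par.blockage := by
  have := par.lamO_pos; have := par.Lo_pos
  unfold blockage; positivity

lemma zeta_pos : 0 < par.zeta := by
  have := par.wavelength_pos
  unfold zeta; positivity

lemma Gb_pos : 0 < par.Gb := by
  have := par.two_le_Nb
  unfold Gb; positivity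

lemma Gr_pos : 0 < par.Gr := by
  have := par.Nr_pos
  unfold Gr; positivity

lemma mType_pos (q : LinkType) : 0 < par.mType q := by
  cases q
  exacts [par.mL_pos, par.mL_pos, par.mN_pos]

lemma mState_pos (v : LinkState) : 0 < par.mState v := by
  cases v
  exacts [par.mL_pos, par.mN_pos]

lemma txPower_pos {ℓ : Link} (h : ℓ.Proper) : 0 < par.txPower ℓ := by
  have := par.p0_pos
  have := par.pmax_pos
  have := par.Gr_pos
  cases ℓ with
  | direct t => have ht : 0 < t := h; simp only [txPower]; split_ifs <;> positivity
  | cascaded t r d =>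
    have hr : 0 < r := h.2.1
    have hd : 0 < d := h.2.2
    simp only [txPower]; split_ifs <;> positivity
  | nlos t => have ht : 0 < t := h; simp only [txPower]; split_ifs <;> positivity

lemma linkGain_pos {ℓ : Link} (h : ℓ.Proper) : 0 < par.linkGain ℓ := by
  have := par.Gr_pos
  have := par.Gb_pos
  have := par.zeta_pos
  cases ℓ with
  | direct t => have ht : 0 < t := h; simp only [linkGain]; positivity
  | cascaded t r d =>
    have hr : 0 < r := h.2.1
    have hd : 0 < d := h.2.2
    simp only [linkGain]; positivity
  | nlos t => have ht : 0 < t := h; simp only [linkGain]; positivity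

lemma measurable_sinrAt (ℓ : Link) :
    Measurable fun x : ℝ × ℝ≥0∞ => par.sinrAt ℓ x.1 x.2 := by
  unfold sinrAt; fun_prop

lemma measurableSet_coverage (γ : ℝ) (ℓ : Link) :
    MeasurableSet {x : ℝ × ℝ≥0∞ | ENNReal.ofReal γ < par.sinrAt ℓ x.1 x.2} :=
  measurableSet_lt measurable_const (par.measurable_sinrAt ℓ)

lemma sinrAt_top (ℓ : Link) (h : ℝ) : par.sinrAt ℓ h ∞ = 0 := by simp [sinrAt]

/-- The noise keeps the denominator positive, so at finite interference coverage is an open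
half-line in the fading coefficient. Coverage probabilities thus depend on the fading law only
through its tail. -/
lemma lt_sinrAt_iff {γ : ℝ} (hγ : 0 < γ) {ℓ : Link} (hc : 0 < par.txPower ℓ * par.linkGain ℓ)
    (h : ℝ) {i : ℝ≥0∞} (hi : i ≠ ∞) :
    ENNReal.ofReal γ < par.sinrAt ℓ h i ↔
      γ * (par.noise + i.toReal) / (par.txPower ℓ * par.linkGain ℓ) < h := by
  have hn := par.noise_pos
  have hd : ENNReal.ofReal par.noise + i = ENNReal.ofReal (par.noise + i.toReal) := by
    rw [ENNReal.ofReal_add hn.le ENNReal.toReal_nonneg, ENNReal.ofReal_toReal hi]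
  have hpos : 0 < par.noise + i.toReal := by positivity
  rw [sinrAt, hd, ← ENNReal.ofReal_div_of_pos hpos, div_lt_iff₀' hc]
  constructor
  · intro hlt
    have := (ENNReal.ofReal_lt_ofReal_iff'.1 hlt).1
    rwa [lt_div_iff₀ hpos] at this
  · intro hlt
    have h1 : γ < par.txPower ℓ * par.linkGain ℓ * h / (par.noise + i.toReal) := by
      rwa [lt_div_iff₀ hpos]
    exact (ENNReal.ofReal_lt_ofReal_iff (hγ.trans h1)).2 h1

lemma coverageGiven_nonneg (ν : Measure ℝ) (η : Measure ℝ≥0∞) (γ : ℝ) (ℓ : Link) :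
    0 ≤ par.coverageGiven ν η γ ℓ := measureReal_nonneg

lemma coverageGiven_le_one (ν : Measure ℝ) (η : Measure ℝ≥0∞) [IsProbabilityMeasure ν]
    [IsProbabilityMeasure η] (γ : ℝ) (ℓ : Link) :
    par.coverageGiven ν η γ ℓ ≤ 1 := measureReal_le_one

/-- The conditional coverage probability is monotone in the tail of the fading law. -/
lemma coverageGiven_mono {ν₁ ν₂ : Measure ℝ} [IsFiniteMeasure ν₁] [IsFiniteMeasure ν₂]
    (h0 : ν₁ (Iic 0) = 0) (h : ∀ x, ν₁ (Ioi x) ≤ ν₂ (Ioi x))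
    (η : Measure ℝ≥0∞) [IsFiniteMeasure η] {γ : ℝ} (hγ : 0 < γ) (ℓ : Link) :
    par.coverageGiven ν₁ η γ ℓ ≤ par.coverageGiven ν₂ η γ ℓ := by
  refine ENNReal.toReal_mono (measure_ne_top _ _) ?_
  rw [Measure.prod_apply_symm (par.measurableSet_coverage γ ℓ),
    Measure.prod_apply_symm (par.measurableSet_coverage γ ℓ)]
  refine lintegral_mono fun i => ?_
  simp only [preimage_ofPred_eq]
  by_cases hi : i = ∞
  · simp [hi, sinrAt_top]
  by_cases hc : 0 < par.txPower ℓ * par.linkGain ℓ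
  · simp only [par.lt_sinrAt_iff hγ hc _ hi]
    exact h _
  -- With a nonpositive coefficient a positive fading value yields SINR `0`. The event therefore
  -- lies in `Iic 0`, which `ν₁` does not charge.
  · refine le_trans (le_of_eq ?_) zero_le
    refine measure_mono_null (fun x hx => ?_) h0
    by_contra hx0
    have hx0 : 0 < x := not_le.1 hx0
    have h1 : par.sinrAt ℓ x i = 0 := by
      rw [sinrAt, ENNReal.ofReal_of_nonpos (mul_nonpos_of_nonpos_of_nonneg (not_lt.1 hc) hx0.le),
        ENNReal.zero_div]
    rw [mem_ofPred_eq, h1] at hx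
    exact not_lt_zero hx

/-- The alternating binomial expansion of `1 - (1 - x) ^ m`. -/
lemma one_sub_one_sub_pow (m : ℕ) (x : ℝ) :
    1 - (1 - x) ^ m = ∑ k ∈ Finset.Icc 1 m, (m.choose k : ℝ) * (-1) ^ (k + 1) * x ^ k := by
  have h1 : (1 - x) ^ m = ∑ k ∈ Finset.range (m + 1), (-x) ^ k * (m.choose k : ℝ) := by
    rw [sub_eq_neg_add, add_pow]
    simp
  rw [h1, Finset.sum_range_succ', Finset.range_eq_Ico,
    Finset.sum_Ico_add' (fun k => (-x) ^ k * (m.choose k : ℝ)) 0 m 1]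
  simp only [pow_zero, Nat.choose_zero_right, Nat.cast_one, mul_one, zero_add]
  rw [sub_add_cancel_right, ← Finset.sum_neg_distrib]
  refine Finset.sum_congr (by ext; simp) fun k _ => ?_
  rw [neg_pow x, pow_succ]; ring

/-- The coverage formula for the approximate fading law. -/
theorem coverageGiven_expPowLaw {b : ℝ} (hb : 0 < b) (η : Measure ℝ≥0∞) [IsProbabilityMeasure η]
    (hη : ∀ᵐ i ∂η, i ≠ ∞)
    (hL : ∀ s : ℝ, 0 ≤ s → ∫ i, Real.exp (-(s * i.toReal)) ∂η = par.laplace s)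
    {γ : ℝ} (hγ : 0 < γ) {ℓ : Link} (hℓ : ℓ.Proper) :
    par.coverageGiven (expPowLaw (par.mType ℓ.type) b) η γ ℓ = par.coverageSum b γ ℓ := by
  set m := par.mType ℓ.type with hm
  have hm0 : 0 < m := par.mType_pos _
  have hc : 0 < par.txPower ℓ * par.linkGain ℓ := mul_pos (par.txPower_pos hℓ) (par.linkGain_pos hℓ)
  have hn := par.noise_pos
  have := isProbabilityMeasure_expPowLaw hm0 hb
  have hs : 0 ≤ par.sParam γ ℓ := by unfold sParam; positivity
  have hint : ∀ k : ℕ, Integrable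
      (fun i : ℝ≥0∞ => Real.exp (-(k * b * par.sParam γ ℓ * i.toReal))) η := by
    intro k
    refine Integrable.of_bound (Measurable.aestronglyMeasurable (by fun_prop)) 1
      (ae_of_all _ fun i => ?_)
    rw [Real.norm_eq_abs, abs_of_pos (Real.exp_pos _), Real.exp_le_one_iff, neg_nonpos]
    positivity
  -- At a fixed interference the tail expands binomially in powers of a single exponential. Its
  -- exponent is linear in noise plus interference, so each power splits into a noise factor and an
  -- interference factor.
  have hval : ∀ i : ℝ≥0∞, i ≠ ∞ →
      (expPowLaw m b {h | ENNReal.ofReal γ < par.sinrAt ℓ h i}).toReal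
      = ∑ k ∈ Finset.Icc 1 m, (m.choose k : ℝ) * (-1) ^ (k + 1)
        * Real.exp (-(k * b * par.sParam γ ℓ * par.noise))
        * Real.exp (-(k * b * par.sParam γ ℓ * i.toReal)) := by
    intro i hi
    simp only [par.lt_sinrAt_iff hγ hc _ hi]
    have hx : 0 ≤ γ * (par.noise + i.toReal) / (par.txPower ℓ * par.linkGain ℓ) := by positivity
    have hle : Real.exp (-(b * m * (γ * (par.noise + i.toReal) /
        (par.txPower ℓ * par.linkGain ℓ)))) ≤ 1 := by
      rw [Real.exp_le_one_iff, neg_nonpos]; positivity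
    change (expPowLaw m b (Ioi _)).toReal = _
    rw [expPowLaw_Ioi hm0 hb hx, ENNReal.toReal_ofReal, one_sub_one_sub_pow]
    · refine Finset.sum_congr rfl fun k _ => ?_
      rw [mul_assoc _ (Real.exp _) (Real.exp _), ← Real.exp_add, ← Real.exp_nat_mul]
      congr 2
      rw [sParam, ← hm]
      field_simp
      ring
    · rw [sub_nonneg]
      exact pow_le_one₀ (by linarith) (by linarith [Real.exp_pos (-(b * m * (γ * (par.noise +
        i.toReal) / (par.txPower ℓ * par.linkGain ℓ))))])
  have hmeas : Measurable fun i => expPowLaw m b {h | ENNReal.ofReal γ < par.sinrAt ℓ h i} :=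
    measurable_measure_prodMk_right (par.measurableSet_coverage γ ℓ)
  rw [coverageGiven, measureReal_def, Measure.prod_apply_symm (par.measurableSet_coverage γ ℓ)]
  simp only [preimage_ofPred_eq]
  rw [← integral_toReal hmeas.aemeasurable (ae_of_all _ fun i => measure_lt_top _ _),
    integral_congr_ae (hη.mono fun i hi => hval i hi), integral_finsetSum _
      fun k _ => (hint k).const_mul _, coverageSum, ← hm]
  refine Finset.sum_congr rfl fun k _ => ?_
  rw [integral_const_mul, hL _ (by positivity)]

end Params

/-! ### Locally finite measures -/

section Regularize

variable {E : Type*} [MeasurableSpace E]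

open Classical in
/-- The part of a measure on `A` if that is finite. -/
def finitePart (A : Set E) (ν : Measure E) : Measure E := if ν A < ∞ then ν.restrict A else 0

lemma measurable_finitePart {A : Set E} (hA : MeasurableSet A) :
    Measurable (finitePart A) :=
  Measurable.ite (measurableSet_lt (Measure.measurable_coe hA) measurable_const)
    (Measure.measurable_of_measurable_coe _ fun s hs => by
      simpa only [Measure.restrict_apply hs] using Measure.measurable_coe (hs.inter hA))
    measurable_const

/-- The sum of the parts of a measure on those fibres of `φ` whose measure is finite. -/
def regularize (φ : E → ℕ) (ν : Measure E) : Measure E :=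
  Measure.sum fun n => finitePart (φ ⁻¹' {n}) ν

lemma regularize_eq {φ : E → ℕ} (hφ : Measurable φ) {ν : Measure E}
    (h : ∀ n, ν (φ ⁻¹' {n}) < ∞) : regularize φ ν = ν := by
  rw [regularize]
  simp only [finitePart, h, if_true]
  rw [← Measure.restrict_iUnion (fun i j hij => Disjoint.preimage _ (disjoint_singleton.2 hij))
    (fun n => hφ (measurableSet_singleton n)), ← preimage_iUnion]
  simp [iUnion_of_singleton]

/-- A set that moves with a parameter has to be measured by a varying measure. Joint measurability
holds for kernels of finite measures, and `regularize` is a countable sum of such kernels by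
construction. -/
lemma measurable_regularize_section {φ : E → ℕ} (hφ : Measurable φ) {T : Type*}
    [MeasurableSpace T] {S : Set (T × E)} (hS : MeasurableSet S) :
    Measurable fun p : T × Measure E => regularize φ p.2 (Prod.mk p.1 ⁻¹' S) := by
  have h1 : ∀ p : T × Measure E, regularize φ p.2 (Prod.mk p.1 ⁻¹' S)
      = ∑' n, finitePart (φ ⁻¹' {n}) p.2 (Prod.mk p.1 ⁻¹' S) := fun p =>
    Measure.sum_apply _ (measurable_prodMk_left hS)
  simp_rw [h1]
  refine Measurable.tsum fun n => ?_
  let κ : Kernel (T × Measure E) E :=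
    ⟨fun p => finitePart (φ ⁻¹' {n}) p.2,
      (measurable_finitePart (hφ (measurableSet_singleton n))).comp measurable_snd⟩
  have hfin : ∀ p, IsFiniteMeasure (κ p) := by
    intro p
    change IsFiniteMeasure (finitePart _ _)
    unfold finitePart
    split_ifs with h
    · exact ⟨by simpa using h⟩
    · infer_instance
  have hS' : MeasurableSet {q : (T × Measure E) × E | (q.1.1, q.2) ∈ S} :=
    (measurable_fst.fst.prodMk measurable_snd) hS
  exact Kernel.measurable_kernel_prodMk_left_of_finite hS' hfin

end Regularize

/-! ### Contact distances -/

section Contact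

variable {E : Type*} [MeasurableSpace E]

/-- The smallest value of `R` on the atoms of `ν` in `V`. -/
def contact (R : E → ℝ) (V : Set E) (ν : Measure E) : ℝ :=
  sInf {r | 0 ≤ r ∧ ν (V ∩ {x | R x ≤ r}) ≠ 0}

lemma contact_nonneg (R : E → ℝ) (V : Set E) (ν : Measure E) : 0 ≤ contact R V ν :=
  Real.sInf_nonneg fun _ hr => hr.1

lemma contact_le {R : E → ℝ} {V : Set E} {ν : Measure E} {r : ℝ} (hr : 0 ≤ r)
    (h : ν (V ∩ {x | R x ≤ r}) ≠ 0) : contact R V ν ≤ r :=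
  csInf_le ⟨0, fun _ hr => hr.1⟩ ⟨hr, h⟩

/-- `V` is the countable union of its parts in the sublevel sets of `R`, so `hV` makes the set of
radii nonempty. Without it the infimum would be `0` by default and carry no information. -/
lemma ne_zero_of_contact_lt {R : E → ℝ} {V : Set E} {ν : Measure E} (hV : ν V ≠ 0) {r : ℝ}
    (h : contact R V ν < r) : ν (V ∩ {x | R x ≤ r}) ≠ 0 := by
  have hne : {r | 0 ≤ r ∧ ν (V ∩ {x | R x ≤ r}) ≠ 0}.Nonempty := by
    by_contra hempty
    rw [not_nonempty_iff_eq_empty, eq_empty_iff_forall_notMem] at hempty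
    refine hV (measure_mono_null (t := ⋃ n : ℕ, V ∩ {x | R x ≤ n}) ?_
      (measure_iUnion_null fun n => ?_))
    · intro x hx
      obtain ⟨n, hn⟩ := exists_nat_ge (R x)
      exact mem_iUnion.2 ⟨n, hx, hn⟩
    · by_contra hn
      exact hempty n ⟨n.cast_nonneg, hn⟩
  obtain ⟨q, hq, hqr⟩ := exists_lt_of_csInf_lt hne h
  exact fun h0 => hq.2 (measure_mono_null
    (inter_subset_inter_right V fun x (hx : R x ≤ q) => hx.trans hqr.le) h0)

/-- Restricting to rational radii expresses the event by countably many measures of sets, which is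
what measurability of the contact distance requires. -/
lemma contact_lt_iff {R : E → ℝ} {V : Set E} {ν : Measure E} (hV : ν V ≠ 0) {r : ℝ} :
    contact R V ν < r ↔ ∃ q : ℚ, 0 ≤ q ∧ (q : ℝ) < r ∧ ν (V ∩ {x | R x ≤ q}) ≠ 0 := by
  constructor
  · intro h
    obtain ⟨q, hq, hqr⟩ := exists_rat_btwn h
    exact ⟨q, by exact_mod_cast (contact_nonneg R V ν).trans hq.le, hqr,
      ne_zero_of_contact_lt hV hq⟩
  · rintro ⟨q, hq, hqr, h⟩
    exact (contact_le (by exact_mod_cast hq) h).trans_lt hqr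

lemma contact_eq_zero {R : E → ℝ} {V : Set E} {ν : Measure E} (hV : ν V = 0) :
    contact R V ν = 0 := by
  have : {r | 0 ≤ r ∧ ν (V ∩ {x | R x ≤ r}) ≠ 0} = ∅ := by
    rw [eq_empty_iff_forall_notMem]
    exact fun r hr => hr.2 (measure_mono_null inter_subset_left hV)
  rw [contact, this, Real.sInf_empty]

/-- Contact distances are measurable if the measures of the sections are. -/
lemma measurable_contact_of_section {T : Type*} [MeasurableSpace T] {R : E → ℝ}
    {V : T → Set E} {ν : T → Measure E} (hV : Measurable fun p => ν p (V p))
    (hVR : ∀ q : ℝ, Measurable fun p => ν p (V p ∩ {x | R x ≤ q})) :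
    Measurable fun p => contact R (V p) (ν p) := by
  refine measurable_of_Iio fun r => ?_
  -- Where `V p` is null the contact distance is `0` by default. That part is split off, since the
  -- rational description fails there.
  have h1 : (fun p => contact R (V p) (ν p)) ⁻¹' Iio r
      = ({p | ν p (V p) = 0} ∩ {_p | 0 < r}) ∪ ({p | ν p (V p) = 0}ᶜ ∩
        ⋃ q : ℚ, {_p | 0 ≤ q ∧ (q : ℝ) < r} ∩ {p | ν p (V p ∩ {x | R x ≤ q}) = 0}ᶜ) := by
    ext p
    by_cases hp : ν p (V p) = 0
    · simp [hp, contact_eq_zero hp]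
    · simp only [mem_preimage, mem_Iio, contact_lt_iff hp]
      simp [hp, and_assoc]
  rw [h1]
  have h0 : MeasurableSet {p | ν p (V p) = 0} := hV (measurableSet_singleton 0)
  refine (h0.inter (MeasurableSet.const _)).union (h0.compl.inter
    (MeasurableSet.iUnion fun q => (MeasurableSet.const _).inter ?_))
  exact ((hVR q) (measurableSet_singleton 0)).compl

lemma measurable_contact {R : E → ℝ} (hR : Measurable R) {V : Set E} (hV : MeasurableSet V) :
    Measurable (contact R V) :=
  measurable_contact_of_section (V := fun _ => V) (ν := id) (Measure.measurable_coe hV)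
    fun _ => Measure.measurable_coe (hV.inter (hR measurableSet_Iic))

end Contact

/-- The integrand is the derivative of `-exp (-G)`, with `G` the primitive of `g`. Continuity of `g`
is needed only inside the interval, so nothing is required at `0`. -/
lemma lintegral_mul_exp_neg_primitive {g : ℝ → ℝ}
    (hg0 : ∀ r, 0 < r → 0 ≤ g r) (hgi : ∀ a b, IntervalIntegrable g volume a b)
    (hgc : ∀ r, 0 < r → ContinuousAt g r) (hgm : Measurable g) {a : ℝ} (ha : 0 ≤ a) :
    ∫⁻ r in Ioc 0 a, ENNReal.ofReal (g r * Real.exp (-∫ t in (0 : ℝ)..r, g t))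
      = ENNReal.ofReal (1 - Real.exp (-∫ t in (0 : ℝ)..a, g t)) := by
  have hGc : Continuous fun r => ∫ t in (0 : ℝ)..r, g t :=
    intervalIntegral.continuous_primitive hgi 0
  have hint : IntervalIntegrable (fun r => g r * Real.exp (-∫ t in (0 : ℝ)..r, g t)) volume 0 a :=
    (hgi 0 a).mul_continuousOn (by fun_prop)
  have hd : ∀ r ∈ Ioo 0 a, HasDerivAt (fun r => -Real.exp (-∫ t in (0 : ℝ)..r, g t))
      (g r * Real.exp (-∫ t in (0 : ℝ)..r, g t)) r := by
    intro r hr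
    have h1 := intervalIntegral.integral_hasDerivAt_right (hgi 0 r)
      hgm.stronglyMeasurable.stronglyMeasurableAtFilter (hgc r hr.1)
    convert! h1.neg.exp.neg using 1
    simp only [Pi.neg_apply]
    ring
  have h2 := intervalIntegral.integral_eq_sub_of_hasDerivAt_of_le ha (by fun_prop) hd hint
  rw [← ofReal_integral_eq_lintegral_ofReal, ← intervalIntegral.integral_of_le ha, h2]
  · congr 1
    simp
    ring
  · exact (intervalIntegrable_iff_integrableOn_Ioc_of_le ha).1 hint
  · filter_upwards [ae_restrict_mem measurableSet_Ioc] with r hr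
    exact mul_nonneg (hg0 r hr.1) (Real.exp_pos _).le

/-- The law of the contact distance of a Poisson point process. -/
theorem IsPoissonProcess.map_contact {Ω E : Type*} [MeasurableSpace Ω] [MeasurableSpace E]
    {P : Measure Ω} [IsProbabilityMeasure P] {N : Ω → Measure E} {Λ : Measure E}
    (h : IsPoissonProcess P N Λ) {R : E → ℝ} (hR : Measurable R) {V : Set E}
    (hV : MeasurableSet V) {g : ℝ → ℝ} (hg0 : ∀ r, 0 < r → 0 ≤ g r)
    (hgi : ∀ a b, IntervalIntegrable g volume a b)
    (hgc : ∀ r, 0 < r → ContinuousAt g r) (hgm : Measurable g)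
    (hΛ : ∀ r, 0 ≤ r → Λ (V ∩ {x | R x ≤ r}) = ENNReal.ofReal (∫ t in (0 : ℝ)..r, g t)) :
    (P.restrict {ω | N ω V ≠ 0}).map (fun ω => contact R V (N ω))
      = (volume.restrict (Ioi 0)).withDensity fun r =>
        ENNReal.ofReal (g r * Real.exp (-∫ t in (0 : ℝ)..r, g t)) := by
  have hGc : Continuous fun r => ∫ t in (0 : ℝ)..r, g t :=
    intervalIntegral.continuous_primitive hgi 0
  have hG0 : ∀ r, 0 ≤ r → 0 ≤ ∫ t in (0 : ℝ)..r, g t := by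
    intro r hr
    rw [intervalIntegral.integral_of_le hr]
    exact setIntegral_nonneg measurableSet_Ioc fun x hx => hg0 x hx.1
  have hVR : ∀ r, MeasurableSet (V ∩ {x | R x ≤ r}) := fun r => hV.inter (hR measurableSet_Iic)
  -- The complement of a void probability.
  have hprob : ∀ r, 0 ≤ r → P {ω | N ω (V ∩ {x | R x ≤ r}) ≠ 0}
      = ENNReal.ofReal (1 - Real.exp (-∫ t in (0 : ℝ)..r, g t)) := by
    intro r hr
    have h0 := h.measure_eq_zero (hVR r) (by rw [hΛ r hr]; exact ENNReal.ofReal_ne_top)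
    rw [hΛ r hr, ENNReal.toReal_ofReal (hG0 r hr)] at h0
    have hm : MeasurableSet {ω | N ω (V ∩ {x | R x ≤ r}) = 0} :=
      (h.measurable_apply (hVR r)) (measurableSet_singleton 0)
    rw [← compl_ofPred, prob_compl_eq_one_sub hm, h0, ENNReal.ofReal_sub _ (Real.exp_pos _).le,
      ENNReal.ofReal_one]
  have hmc : Measurable fun ω => contact R V (N ω) := (measurable_contact hR hV).comp h.measurable
  have hVm : MeasurableSet {ω | N ω V ≠ 0} :=
    ((h.measurable_apply hV) (measurableSet_singleton 0)).compl
  refine Measure.ext_of_Iic _ _ fun a => ?_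
  rw [Measure.map_apply hmc measurableSet_Iic, Measure.restrict_apply (hmc measurableSet_Iic),
    withDensity_apply _ measurableSet_Iic, Measure.restrict_restrict measurableSet_Iic,
    inter_comm (Iic a) (Ioi 0), Ioi_inter_Iic]
  rcases lt_or_ge a 0 with ha | ha
  · have h1 : (fun ω => contact R V (N ω)) ⁻¹' Iic a = ∅ := by
      ext ω
      simpa using ha.trans_le (contact_nonneg R V (N ω))
    rw [h1, Ioc_eq_empty (by linarith)]
    simp
  rw [lintegral_mul_exp_neg_primitive hg0 hgi hgc hgm ha]
  apply le_antisymm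
  -- An infimum at most `a` only guarantees points within every radius `b > a`. Continuity of the
  -- right-hand side in `b` then gives the bound at `a`.
  · have hlim : Tendsto (fun b => ENNReal.ofReal (1 - Real.exp (-∫ t in (0 : ℝ)..b, g t)))
        (𝓝[>] a) (𝓝 (ENNReal.ofReal (1 - Real.exp (-∫ t in (0 : ℝ)..a, g t)))) := by
      refine ENNReal.tendsto_ofReal (Tendsto.mono_left ?_ nhdsWithin_le_nhds)
      exact Continuous.tendsto (by fun_prop) a
    refine ge_of_tendsto hlim ?_
    filter_upwards [self_mem_nhdsWithin] with b hb
    rw [← hprob b (ha.trans (le_of_lt hb))]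
    exact measure_mono fun ω hω => ne_zero_of_contact_lt hω.2 (lt_of_le_of_lt hω.1 hb)
  · rw [← hprob a ha]
    refine measure_mono fun ω hω => ⟨contact_le ha hω, fun h0 => hω ?_⟩
    exact measure_mono_null inter_subset_left h0

/-! ### Polar coordinates in the plane -/

/-- Integration in polar coordinates. -/
lemma lintegral_norm_arg {f : ℝ → ℝ → ℝ≥0∞} (hf : Measurable (Function.uncurry f)) :
    ∫⁻ z : ℂ, f ‖z‖ z.arg
      = ∫⁻ r in Ioi (0 : ℝ), ENNReal.ofReal r * ∫⁻ θ in Ioo (-Real.pi) Real.pi, f r θ := by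
  rw [← Complex.lintegral_comp_polarCoord_symm]
  have h1 : ∫⁻ p in polarCoord.target, ENNReal.ofReal p.1 •
        f ‖Complex.polarCoord.symm p‖ (Complex.polarCoord.symm p).arg
      = ∫⁻ p in Ioi (0 : ℝ) ×ˢ Ioo (-Real.pi) Real.pi, ENNReal.ofReal p.1 * f p.1 p.2 := by
    refine setLIntegral_congr_fun (measurableSet_Ioi.prod measurableSet_Ioo) fun p hp => ?_
    have hp1 : 0 < p.1 := hp.1
    have e1 : ‖Complex.polarCoord.symm p‖ = p.1 := by
      rw [Complex.norm_polarCoord_symm, abs_of_pos hp1]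
    have e2 : (Complex.polarCoord.symm p).arg = p.2 := by
      rw [Complex.polarCoord_symm_apply]
      push_cast
      exact Complex.arg_mul_cos_add_sin_mul_I hp1 (Ioo_subset_Ioc_self hp.2)
    simp only [e1, e2, smul_eq_mul]
  rw [h1, Measure.volume_eq_prod, ← Measure.prod_restrict, lintegral_prod]
  · refine lintegral_congr fun r => ?_
    exact lintegral_const_mul (f := f r) (ENNReal.ofReal r) (hf.comp measurable_prodMk_left)
  · exact ((ENNReal.measurable_ofReal.comp measurable_fst).mul hf).aemeasurable

/-- Integration of radial functions. -/
lemma lintegral_norm_complex {f : ℝ → ℝ≥0∞} (hf : Measurable f) :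
    ∫⁻ z : ℂ, f ‖z‖
      = ENNReal.ofReal (2 * Real.pi) * ∫⁻ r in Ioi (0 : ℝ), ENNReal.ofReal r * f r := by
  rw [lintegral_norm_arg (f := fun r _ => f r) (hf.comp measurable_fst), ← lintegral_const_mul]
  · refine lintegral_congr fun r => ?_
    rw [setLIntegral_const, Real.volume_Ioo]
    rw [show Real.pi - -Real.pi = 2 * Real.pi by ring]
    ring
  · exact ENNReal.measurable_ofReal.mul hf

/-! ### Association probabilities -/

namespace Params

variable (par : Params)

lemma PLoS_pos (t : ℝ) : 0 < par.PLoS t := Real.exp_pos _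

lemma PLoS_le_one {t : ℝ} (ht : 0 ≤ t) : par.PLoS t ≤ 1 := by
  have := par.blockage_pos
  rw [PLoS, Real.exp_le_one_iff, neg_mul, neg_nonpos]
  positivity

@[fun_prop]
lemma continuous_PLoS : Continuous par.PLoS := by unfold PLoS; fun_prop

@[fun_prop]
lemma measurable_PLoS : Measurable par.PLoS := par.continuous_PLoS.measurable

lemma PRefl_nonneg (tbu t θ : ℝ) : 0 ≤ PRefl tbu t θ := by
  have h := Real.arccos_le_pi
    ((t - tbu * Real.cos θ) / Real.sqrt (tbu ^ 2 + t ^ 2 - 2 * tbu * t * Real.cos θ))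
  have hpi := Real.pi_pos
  rw [PRefl, sub_nonneg, one_div_mul_eq_div, div_le_iff₀ (by positivity)]
  linarith

lemma PRefl_le_half (tbu t θ : ℝ) : PRefl tbu t θ ≤ 1 / 2 := by
  have h := Real.arccos_nonneg
    ((t - tbu * Real.cos θ) / Real.sqrt (tbu ^ 2 + t ^ 2 - 2 * tbu * t * Real.cos θ))
  have hpi := Real.pi_pos
  rw [PRefl, sub_le_self_iff]
  positivity

lemma viable_nonneg (tbu t θ : ℝ) : 0 ≤ par.viable tbu t θ :=
  mul_nonneg (par.PLoS_pos t).le (PRefl_nonneg tbu t θ)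

lemma viable_le (tbu t θ : ℝ) : par.viable tbu t θ ≤ par.PLoS t := by
  have h1 := PRefl_le_half tbu t θ
  have h2 := par.PLoS_pos t
  unfold viable
  nlinarith

lemma measurable_viable :
    Measurable fun p : ℝ × ℝ × ℝ => par.viable p.1 p.2.1 p.2.2 := by
  have := Real.measurable_arccos
  unfold viable PRefl
  fun_prop

lemma integrable_viable (tbu t : ℝ) {s : Set ℝ} (hs : volume s ≠ ∞) :
    IntegrableOn (par.viable tbu t) s := by
  have hm : Measurable (par.viable tbu t) :=
    par.measurable_viable.comp (by fun_prop : Measurable fun θ : ℝ => (tbu, t, θ))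
  refine Measure.integrableOn_of_bounded hs hm.aestronglyMeasurable (M := par.PLoS t)
    (ae_of_all _ fun θ => ?_)
  rw [Real.norm_eq_abs, abs_of_nonneg (par.viable_nonneg tbu t θ)]
  exact par.viable_le tbu t θ

lemma neg_pi_le_pi : -Real.pi ≤ Real.pi := by linarith [Real.pi_pos]

lemma viableBar_eq (tbu t : ℝ) :
    par.viableBar tbu t = ∫ θ in Ioo (-Real.pi) Real.pi, par.viable tbu t θ := by
  rw [viableBar, intervalIntegral.integral_of_le neg_pi_le_pi, integral_Ioc_eq_integral_Ioo]

lemma ofReal_viableBar (tbu t : ℝ) :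
    ENNReal.ofReal (par.viableBar tbu t)
      = ∫⁻ θ in Ioo (-Real.pi) Real.pi, ENNReal.ofReal (par.viable tbu t θ) := by
  rw [viableBar_eq, ofReal_integral_eq_lintegral_ofReal]
  · exact par.integrable_viable tbu t (by simp)
  · exact ae_of_all _ fun θ => par.viable_nonneg tbu t θ

lemma viableBar_nonneg (tbu t : ℝ) : 0 ≤ par.viableBar tbu t := by
  rw [viableBar_eq]
  exact integral_nonneg fun θ => par.viable_nonneg tbu t θ

lemma viableBar_le (tbu t : ℝ) : par.viableBar tbu t ≤ 2 * Real.pi * par.PLoS t := by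
  rw [viableBar_eq]
  calc ∫ θ in Ioo (-Real.pi) Real.pi, par.viable tbu t θ
      ≤ ∫ _ in Ioo (-Real.pi) Real.pi, par.PLoS t :=
        integral_mono (par.integrable_viable tbu t (by simp)) (integrable_const _)
          fun θ => par.viable_le tbu t θ
    _ = 2 * Real.pi * par.PLoS t := by
        have := Real.pi_pos
        rw [setIntegral_const, smul_eq_mul, Real.volume_real_Ioo_of_le (by linarith)]
        ring

lemma measurable_viableBar : Measurable fun p : ℝ × ℝ => par.viableBar p.1 p.2 := by
  simp_rw [viableBar_eq]
  have h : StronglyMeasurable fun q : (ℝ × ℝ) × ℝ => par.viable q.1.1 q.1.2 q.2 :=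
    (par.measurable_viable.comp (by fun_prop :
      Measurable fun q : (ℝ × ℝ) × ℝ => (q.1.1, q.1.2, q.2))).stronglyMeasurable
  exact h.integral_prod_right'.measurable

/-- The expression equals `(t - r)² + 2tr(1 - cos θ)`, and on this open interval the cosine is 1
only at `0`. -/
lemma law_of_cosines_pos {t r θ : ℝ} (ht : 0 < t) (hr : 0 < r)
    (hθ : θ ∈ Ioo (-Real.pi) Real.pi) (hθ0 : θ ≠ 0) :
    0 < t ^ 2 + r ^ 2 - 2 * t * r * Real.cos θ := by
  have hcos : Real.cos θ < 1 := by
    refine lt_of_le_of_ne (Real.cos_le_one θ) fun h => hθ0 ?_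
    exact (Real.cos_eq_one_iff_of_lt_of_lt (by linarith [hθ.1, Real.pi_pos])
      (by linarith [hθ.2, Real.pi_pos])).1 h
  nlinarith [mul_pos ht hr, sq_nonneg (t - r)]

/-- Dominated convergence. The quotient inside the arccosine can degenerate only at the angle `0`, a
null set. Continuity of the rate is what `IsPoissonProcess.map_contact` demands. -/
lemma continuousAt_viableBar {tbu r : ℝ} (ht : 0 < tbu) (hr : 0 < r) :
    ContinuousAt (par.viableBar tbu) r := by
  have h1 : par.viableBar tbu
      = fun r => ∫ θ in Ioo (-Real.pi) Real.pi, par.viable tbu r θ := by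
    ext r; exact par.viableBar_eq tbu r
  rw [h1]
  have hb : ∀ᶠ x in 𝓝 r, par.PLoS x ≤ par.PLoS r + 1 :=
    (par.continuous_PLoS.tendsto r).eventually_le_const (by linarith)
  refine continuousAt_of_dominated (bound := fun _ => par.PLoS r + 1)
    (Eventually.of_forall fun x => ?_) ?_ (integrable_const _) ?_
  · exact (par.measurable_viable.comp
      (by fun_prop : Measurable fun θ : ℝ => (tbu, x, θ))).aestronglyMeasurable
  · filter_upwards [hb] with x hx
    refine ae_of_all _ fun θ => ?_
    rw [Real.norm_eq_abs, abs_of_nonneg (par.viable_nonneg tbu x θ)]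
    exact (par.viable_le tbu x θ).trans hx
  · filter_upwards [ae_restrict_mem measurableSet_Ioo,
      ae_restrict_of_ae (compl_mem_ae_iff.2 (measure_singleton (0 : ℝ)))] with θ hθ hθ0
    have hpos := Real.sqrt_pos.2 (law_of_cosines_pos ht hr hθ hθ0)
    have hsub : ContinuousAt (fun x : ℝ => (x - tbu * Real.cos θ) /
        Real.sqrt (tbu ^ 2 + x ^ 2 - 2 * tbu * x * Real.cos θ)) r :=
      ContinuousAt.div (by fun_prop) (by fun_prop) hpos.ne'
    unfold viable PRefl
    exact par.continuous_PLoS.continuousAt.mul (continuousAt_const.sub (continuousAt_const.mul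
      (Real.continuous_arccos.continuousAt.comp hsub)))

/-- Intensity of the contact distance of the viable RISs. -/
def viableRate (tbu r : ℝ) : ℝ := par.lamR * (par.viableBar tbu r * r)

lemma viableRate_nonneg (tbu : ℝ) {r : ℝ} (hr : 0 < r) : 0 ≤ par.viableRate tbu r :=
  mul_nonneg par.lamR_nonneg (mul_nonneg (par.viableBar_nonneg tbu r) hr.le)

lemma measurable_viableRate : Measurable fun p : ℝ × ℝ => par.viableRate p.1 p.2 :=
  (par.measurable_viableBar.mul measurable_snd).const_mul _

lemma measurable_viableRate_right (tbu : ℝ) : Measurable (par.viableRate tbu) :=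
  par.measurable_viableRate.comp measurable_prodMk_left

lemma norm_viableRate_le (tbu r : ℝ) :
    ‖par.viableRate tbu r‖ ≤ ‖par.lamR * (2 * Real.pi * par.PLoS r * r)‖ := by
  have h0 := par.viableBar_nonneg tbu r
  have h1 := par.viableBar_le tbu r
  have h2 := par.lamR_nonneg
  rw [viableRate, norm_mul, norm_mul, norm_mul, norm_mul (2 * Real.pi * par.PLoS r)]
  gcongr
  rw [Real.norm_eq_abs, Real.norm_eq_abs, abs_of_nonneg h0, abs_of_nonneg (h0.trans h1)]
  exact h1

lemma intervalIntegrable_viableRate (tbu a b : ℝ) :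
    IntervalIntegrable (par.viableRate tbu) volume a b := by
  have h : IntervalIntegrable (fun r => par.lamR * (2 * Real.pi * par.PLoS r * r)) volume a b :=
    Continuous.intervalIntegrable (by fun_prop) _ _
  refine IntervalIntegrable.mono_fun h (par.measurable_viableRate_right tbu).aestronglyMeasurable
    (ae_of_all _ fun r => par.norm_viableRate_le tbu r)

lemma integrableOn_mul_PLoS : IntegrableOn (fun r => par.PLoS r * r) (Ioi 0) := by
  have h := integrableOn_rpow_mul_exp_neg_mul_rpow (p := 1) (s := 1) (b := par.blockage)
    (by norm_num) one_pos par.blockage_pos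
  refine h.congr_fun (fun r _ => ?_) measurableSet_Ioi
  simp [PLoS, mul_comm]

lemma integrableOn_viableRate (tbu : ℝ) : IntegrableOn (par.viableRate tbu) (Ioi 0) := by
  refine Integrable.mono (g := fun r => par.lamR * (2 * Real.pi * par.PLoS r * r)) ?_
    (par.measurable_viableRate_right tbu).aestronglyMeasurable
    (ae_of_all _ fun r => par.norm_viableRate_le tbu r)
  refine (par.integrableOn_mul_PLoS.const_mul (par.lamR * (2 * Real.pi))).congr
    (ae_of_all _ fun r => ?_)
  ring

lemma continuousAt_viableRate {tbu r : ℝ} (ht : 0 < tbu) (hr : 0 < r) :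
    ContinuousAt (par.viableRate tbu) r :=
  continuousAt_const.mul ((par.continuousAt_viableBar ht hr).mul continuousAt_id)

lemma PCL_eq (tbu : ℝ) : par.PCL tbu = 1 - Real.exp (-∫ r in Ioi 0, par.viableRate tbu r) := by
  unfold viableRate
  rw [PCL, integral_const_mul, neg_mul]

lemma PCL_le_one (tbu : ℝ) : par.PCL tbu ≤ 1 := by
  rw [PCL_eq, sub_le_self_iff]
  exact (Real.exp_pos _).le

/-- Density of the distance to the nearest viable RIS, which may be defective. -/
def viableDensity (tbu r : ℝ) : ℝ :=
  par.viableRate tbu r * Real.exp (-∫ s in (0 : ℝ)..r, par.viableRate tbu s)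

lemma viableDensity_nonneg (tbu : ℝ) {r : ℝ} (hr : 0 < r) : 0 ≤ par.viableDensity tbu r :=
  mul_nonneg (par.viableRate_nonneg tbu hr) (Real.exp_pos _).le

lemma measurable_viableDensity_right (tbu : ℝ) : Measurable (par.viableDensity tbu) :=
  (par.measurable_viableRate_right tbu).mul
    (intervalIntegral.continuous_primitive
      (par.intervalIntegrable_viableRate tbu) 0).neg.rexp.measurable

lemma integrableOn_viableDensity (tbu : ℝ) : IntegrableOn (par.viableDensity tbu) (Ioi 0) := by
  refine Integrable.mono (par.integrableOn_viableRate tbu)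
    (par.measurable_viableDensity_right tbu).aestronglyMeasurable ?_
  filter_upwards [ae_restrict_mem measurableSet_Ioi] with r hr
  have h0 : 0 ≤ ∫ s in (0 : ℝ)..r, par.viableRate tbu s := by
    rw [intervalIntegral.integral_of_le (le_of_lt hr)]
    exact setIntegral_nonneg measurableSet_Ioc fun s hs => par.viableRate_nonneg tbu hs.1
  rw [viableDensity, norm_mul]
  refine mul_le_of_le_one_right (norm_nonneg _) ?_
  rw [Real.norm_eq_abs, abs_of_pos (Real.exp_pos _), Real.exp_le_one_iff]
  linarith

/-- The association probability cancels the normalisation by `PCL`. If `PCL` is zero, the left side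
vanishes, and so does the right side almost everywhere, because the nonnegative rate then has
integral zero. -/
lemma assoc_mul_pdfTru (tbu : ℝ) :
    ∀ᵐ r ∂(volume.restrict (Ioi (0 : ℝ))),
      par.assoc .CL tbu * par.pdfTru tbu r = (1 - par.PLoS tbu) * par.viableDensity tbu r := by
  have hexp : ∀ r, par.lamR * r * par.viableBar tbu r *
      Real.exp (-par.lamR * ∫ t in (0 : ℝ)..r, par.viableBar tbu t * t)
      = par.viableDensity tbu r := by
    intro r
    unfold viableDensity viableRate
    rw [intervalIntegral.integral_const_mul, neg_mul]
    ring
  by_cases h : par.PCL tbu = 0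
  · have h1 : ∫ r in Ioi 0, par.viableRate tbu r = 0 := by
      rw [PCL_eq, sub_eq_zero, eq_comm, Real.exp_eq_one_iff, neg_eq_zero] at h
      exact h
    rw [setIntegral_eq_zero_iff_of_nonneg_ae ((ae_restrict_iff' measurableSet_Ioi).2
      (ae_of_all _ fun r hr => par.viableRate_nonneg tbu hr))
    (par.integrableOn_viableRate tbu)] at h1
    filter_upwards [h1] with r hr
    rw [viableDensity, hr, assoc, h]
    simp
  · refine ae_of_all _ fun r => ?_
    rw [assoc, pdfTru, hexp]
    field_simp

lemma lamB_smul_closedBall {r : ℝ} (hr : 0 ≤ r) :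
    (ENNReal.ofReal par.lamB • (volume : Measure ℂ)) (univ ∩ {z : ℂ | ‖z‖ ≤ r})
      = ENNReal.ofReal (∫ t in (0 : ℝ)..r, 2 * Real.pi * par.lamB * t) := by
  have h1 : univ ∩ {z : ℂ | ‖z‖ ≤ r} = Metric.closedBall 0 r := by
    ext z; simp
  have hl := par.lamB_pos
  rw [h1, Measure.smul_apply, Complex.volume_closedBall, smul_eq_mul,
    intervalIntegral.integral_const_mul, integral_id,
    ← ENNReal.ofReal_pow hr, ← NNReal.coe_real_pi, ENNReal.ofReal_mul (by positivity),
    ENNReal.ofReal_mul (by positivity), ENNReal.ofReal_mul (by positivity),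
    ENNReal.ofReal_coe_nnreal]
  rw [show r ^ 2 = 2 * ((r ^ 2 - 0 ^ 2) / 2) by ring, ENNReal.ofReal_mul (by positivity)]
  ring_nf

end Params

/-! ### Uniform laws and the mean measure of the viable RISs -/

lemma uniformLaw_zero_one : uniformLaw 0 1 = volume.restrict (Icc (0 : ℝ) 1) := by
  simp [uniformLaw, ProbabilityTheory.cond]

lemma isProbabilityMeasure_uniformLaw {a b : ℝ} (h : a < b) :
    IsProbabilityMeasure (uniformLaw a b) :=
  ProbabilityTheory.cond_isProbabilityMeasure_of_finite (by simp [h]) (by simp)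

instance : IsProbabilityMeasure (uniformLaw 0 1) := isProbabilityMeasure_uniformLaw one_pos

lemma uniformLaw_Iio {x : ℝ} (h1 : x ≤ 1) :
    uniformLaw 0 1 (Iio x) = ENNReal.ofReal x := by
  have h : Iio x ∩ Icc 0 1 = Ico 0 x := by
    ext y
    simp only [mem_inter_iff, mem_Iio, mem_Icc, mem_Ico]
    constructor
    · exact fun hy => ⟨hy.2.1, hy.1⟩
    · exact fun hy => ⟨hy.2, hy.1, hy.2.le.trans h1⟩
  rw [uniformLaw_zero_one, Measure.restrict_apply measurableSet_Iio, h]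
  simp

lemma lintegral_uniformLaw_ite {x : ℝ} (h0 : 0 ≤ x) (h1 : x ≤ 1) (A B : ℝ≥0∞) :
    ∫⁻ u, (if u < x then A else B) ∂(uniformLaw 0 1)
      = ENNReal.ofReal x * A + ENNReal.ofReal (1 - x) * B := by
  have h := lintegral_add_compl (μ := uniformLaw 0 1) (fun u => if u < x then A else B)
    (measurableSet_Iio (a := x))
  rw [← h, setLIntegral_congr_fun (f := fun u => if u < x then A else B) (g := fun _ => A)
      measurableSet_Iio (fun u hu => if_pos hu),
    setLIntegral_congr_fun (f := fun u => if u < x then A else B) (g := fun _ => B)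
      measurableSet_Iio.compl (fun u hu => if_neg hu), setLIntegral_const, setLIntegral_const,
    prob_compl_eq_one_sub measurableSet_Iio, uniformLaw_Iio h1, ENNReal.ofReal_sub _ h0,
    ENNReal.ofReal_one]
  ring

lemma lintegral_uniformLaw_pi (f : ℝ → ℝ≥0∞) :
    ∫⁻ θ, f θ ∂(uniformLaw (-Real.pi) Real.pi)
      = ENNReal.ofReal (1 / (2 * Real.pi)) * ∫⁻ θ in Ioc (-Real.pi) Real.pi, f θ := by
  rw [uniformLaw, ProbabilityTheory.cond, lintegral_smul_measure, Real.volume_Icc,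
    Measure.restrict_congr_set Ioc_ae_eq_Icc.symm, one_div,
    ENNReal.ofReal_inv_of_pos (by positivity), smul_eq_mul]
  congr 4
  ring

namespace Params

variable (par : Params)

lemma measurableSet_viableSet_prod :
    MeasurableSet {q : ℝ × (ℂ × ℝ) | q.2 ∈ Geometry.viableSet par q.1} := by
  refine measurableSet_lt measurable_snd.snd (par.measurable_viable.comp
    (measurable_fst.prodMk (Measurable.prodMk ?_ ?_)))
  · exact measurable_snd.fst.norm
  · exact Complex.measurable_arg.comp measurable_snd.fst

lemma measurableSet_viableSet (t : ℝ) : MeasurableSet (Geometry.viableSet par t) :=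
  measurable_prodMk_left (par.measurableSet_viableSet_prod)

/-- Mean measure of the viable RISs at a distance in a given set. -/
lemma ris_intensity_apply (t : ℝ) {A : Set ℝ} (hA : MeasurableSet A) :
    ((ENNReal.ofReal par.lamR • (volume : Measure ℂ)).prod (uniformLaw 0 1))
        (Geometry.viableSet par t ∩ {x | ‖x.1‖ ∈ A})
      = ∫⁻ r in A ∩ Ioi 0, ENNReal.ofReal (par.viableRate t r) := by
  have hS : MeasurableSet (Geometry.viableSet par t ∩ {x : ℂ × ℝ | ‖x.1‖ ∈ A}) :=
    (par.measurableSet_viableSet t).inter (measurable_fst.norm hA)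
  rw [Measure.prod_apply hS, lintegral_smul_measure]
  -- At a fixed position the admissible marks have probability `viable`: the marked process realises
  -- the independent thinning.
  have h1 : ∀ z : ℂ, uniformLaw 0 1 (Prod.mk z ⁻¹'
      (Geometry.viableSet par t ∩ {x : ℂ × ℝ | ‖x.1‖ ∈ A}))
      = A.indicator (fun r => ENNReal.ofReal (par.viable t r z.arg)) ‖z‖ := by
    intro z
    by_cases hz : ‖z‖ ∈ A
    · rw [indicator_of_mem hz, ← uniformLaw_Iio
        ((par.viable_le _ _ _).trans (par.PLoS_le_one (norm_nonneg z)))]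
      congr 1
      ext u
      simp [Geometry.viableSet, hz]
    · rw [indicator_of_notMem hz]
      convert! measure_empty (μ := uniformLaw 0 1)
      ext u
      simp [hz]
  simp_rw [h1]
  have hm : Measurable fun p : ℝ × ℝ => A.indicator
      (fun r => ENNReal.ofReal (par.viable t r p.2)) p.1 := by
    have h2 : (fun p : ℝ × ℝ => A.indicator (fun r => ENNReal.ofReal (par.viable t r p.2)) p.1)
        = (Prod.fst ⁻¹' A).indicator fun p : ℝ × ℝ => ENNReal.ofReal (par.viable t p.1 p.2) := by
      ext p
      simp only [indicator]
      congr
    rw [h2]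
    exact ((par.measurable_viable.comp (by fun_prop : Measurable fun p : ℝ × ℝ =>
      (t, p.1, p.2))).ennreal_ofReal).indicator (measurable_fst hA)
  rw [lintegral_norm_arg (f := fun r θ => A.indicator
    (fun r => ENNReal.ofReal (par.viable t r θ)) r) hm, ← setLIntegral_indicator hA,
    smul_eq_mul, ← lintegral_const_mul']
  · refine setLIntegral_congr_fun measurableSet_Ioi fun r hr => ?_
    have hr : 0 < r := hr
    by_cases hrA : r ∈ A
    · simp only [indicator_of_mem hrA]
      rw [← ofReal_viableBar, viableRate, ENNReal.ofReal_mul par.lamR_nonneg,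
        ENNReal.ofReal_mul (par.viableBar_nonneg t r), mul_comm (ENNReal.ofReal r)]
    · simp [indicator_of_notMem hrA]
  · exact ENNReal.ofReal_ne_top

lemma ris_intensity_le (t : ℝ) {r : ℝ} (hr : 0 ≤ r) :
    ((ENNReal.ofReal par.lamR • (volume : Measure ℂ)).prod (uniformLaw 0 1))
        (Geometry.viableSet par t ∩ {x | ‖x.1‖ ≤ r})
      = ENNReal.ofReal (∫ s in (0 : ℝ)..r, par.viableRate t s) := by
  have h := par.ris_intensity_apply t (measurableSet_Iic (a := r))
  simp only [mem_Iic] at h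
  rw [h, inter_comm, Ioi_inter_Iic, intervalIntegral.integral_of_le hr,
    ofReal_integral_eq_lintegral_ofReal]
  · exact (intervalIntegrable_iff_integrableOn_Ioc_of_le hr).1
      (par.intervalIntegrable_viableRate t 0 r)
  · filter_upwards [ae_restrict_mem measurableSet_Ioc] with s hs
    exact par.viableRate_nonneg t hs.1

lemma ris_intensity_viableSet (t : ℝ) :
    ((ENNReal.ofReal par.lamR • (volume : Measure ℂ)).prod (uniformLaw 0 1))
        (Geometry.viableSet par t)
      = ENNReal.ofReal (∫ s in Ioi (0 : ℝ), par.viableRate t s) := by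
  have h := par.ris_intensity_apply t MeasurableSet.univ
  simp only [mem_univ, ofPred_true, inter_univ, univ_inter] at h
  rw [h, ofReal_integral_eq_lintegral_ofReal (par.integrableOn_viableRate t)]
  filter_upwards [ae_restrict_mem measurableSet_Ioi] with s hs
  exact par.viableRate_nonneg t hs

end Params

/-! ### The serving link -/

/-- The largest σ-algebra that makes the three constructors measurable. A function on `Link` is then
measurable as soon as its three restrictions are. -/
instance : MeasurableSpace Link :=
  MeasurableSpace.map Link.direct inferInstance ⊓
    (MeasurableSpace.map (fun p : ℝ × ℝ × ℝ => Link.cascaded p.1 p.2.1 p.2.2) inferInstance ⊓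
      MeasurableSpace.map Link.nlos inferInstance)

namespace Link

lemma measurableSet_iff {s : Set Link} : MeasurableSet s ↔
    MeasurableSet (Link.direct ⁻¹' s) ∧
      MeasurableSet ((fun p : ℝ × ℝ × ℝ => Link.cascaded p.1 p.2.1 p.2.2) ⁻¹' s) ∧
        MeasurableSet (Link.nlos ⁻¹' s) := by
  exact MeasurableSpace.measurableSet_inf.trans
    (and_congr Iff.rfl MeasurableSpace.measurableSet_inf)

lemma measurable_direct : Measurable Link.direct := fun _ hs => (measurableSet_iff.1 hs).1

lemma measurable_cascaded :
    Measurable fun p : ℝ × ℝ × ℝ => Link.cascaded p.1 p.2.1 p.2.2 :=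
  fun _ hs => (measurableSet_iff.1 hs).2.1

lemma measurable_nlos : Measurable Link.nlos := fun _ hs => (measurableSet_iff.1 hs).2.2

lemma measurable_of_constructors {β : Type*} [MeasurableSpace β] {F : Link → β}
    (h1 : Measurable fun t => F (.direct t))
    (h2 : Measurable fun p : ℝ × ℝ × ℝ => F (.cascaded p.1 p.2.1 p.2.2))
    (h3 : Measurable fun t => F (.nlos t)) : Measurable F :=
  fun _ hs => measurableSet_iff.2 ⟨h1 hs, h2 hs, h3 hs⟩

end Link

@[fun_prop]
lemma measurable_distBR : Measurable fun p : ℝ × ℝ × ℝ => Params.distBR p.1 p.2.1 p.2.2 := by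
  unfold Params.distBR; fun_prop

namespace Params

variable (par : Params)

open Classical in
/-- The serving link as a function of the base station distance, the mark of the direct link, the
configuration of the RISs and the angle. -/
def linkOf (t u : ℝ) (ν : Measure (ℂ × ℝ)) (θ : ℝ) : Link :=
  if u < par.PLoS t then .direct t
  else if ν (Geometry.viableSet par t) ≠ 0 then
    .cascaded t (contact (fun x => ‖x.1‖) (Geometry.viableSet par t) ν)
      (distBR t (contact (fun x => ‖x.1‖) (Geometry.viableSet par t) ν) θ)
  else .nlos t

/-- Unit annulus of a marked point. -/
def annulus (x : ℂ × ℝ) : ℕ := ⌊‖x.1‖⌋₊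

lemma measurable_annulus : Measurable annulus :=
  Nat.measurable_floor.comp measurable_fst.norm

/-- The viable set varies with the base station distance, so measurability is required jointly in
the distance and the configuration. For this reason the configuration is regularised. -/
lemma measurable_linkOf : Measurable fun p : (ℝ × Measure (ℂ × ℝ)) × ℝ × ℝ =>
    par.linkOf p.1.1 p.2.1 (regularize annulus p.1.2) p.2.2 := by
  have hV := measurable_regularize_section measurable_annulus par.measurableSet_viableSet_prod
  have hVR : ∀ q : ℝ, Measurable fun p : ℝ × Measure (ℂ × ℝ) =>
      regularize annulus p.2 (Geometry.viableSet par p.1 ∩ {x | ‖x.1‖ ≤ q}) := fun q =>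
    measurable_regularize_section measurable_annulus (S := {p : ℝ × (ℂ × ℝ) |
      p.2 ∈ Geometry.viableSet par p.1} ∩ {p | ‖p.2.1‖ ≤ q})
      (par.measurableSet_viableSet_prod.inter (measurable_snd.fst.norm measurableSet_Iic))
  have hc : Measurable fun p : ℝ × Measure (ℂ × ℝ) =>
      contact (fun x => ‖x.1‖) (Geometry.viableSet par p.1) (regularize annulus p.2) :=
    measurable_contact_of_section hV hVR
  have hc' : Measurable fun p : (ℝ × Measure (ℂ × ℝ)) × ℝ × ℝ =>
      contact (fun x => ‖x.1‖) (Geometry.viableSet par p.1.1) (regularize annulus p.1.2) :=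
    hc.comp measurable_fst
  unfold linkOf
  refine Measurable.ite (measurableSet_lt measurable_snd.fst
    (par.measurable_PLoS.comp measurable_fst.fst))
    (Link.measurable_direct.comp measurable_fst.fst) (Measurable.ite ?_ ?_
    (Link.measurable_nlos.comp measurable_fst.fst))
  · exact ((hV.comp measurable_fst) (measurableSet_singleton 0)).compl
  · exact Link.measurable_cascaded.comp (measurable_fst.fst.prodMk (hc'.prodMk
      (measurable_distBR.comp (measurable_fst.fst.prodMk (hc'.prodMk measurable_snd.snd)))))

/-- Average over the serving link, given the base station distance. -/
def condLinkAverage (F : Link → ℝ≥0∞) (t : ℝ) : ℝ≥0∞ :=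
  ENNReal.ofReal (par.PLoS t) * F (.direct t)
    + ENNReal.ofReal (1 - par.PLoS t) *
      ((∫⁻ r in Ioi 0, ENNReal.ofReal (par.viableDensity t r) *
          ∫⁻ θ, F (.cascaded t r (distBR t r θ)) ∂(uniformLaw (-Real.pi) Real.pi))
        + ENNReal.ofReal (1 - par.PCL t) * F (.nlos t))

end Params

lemma neg_pi_lt_pi : -Real.pi < Real.pi := by linarith [Real.pi_pos]

instance : IsProbabilityMeasure (uniformLaw (-Real.pi) Real.pi) :=
  isProbabilityMeasure_uniformLaw neg_pi_lt_pi

lemma contact_ball (ν : Measure ℂ) :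
    sInf {r | 0 ≤ r ∧ ν (Metric.closedBall 0 r) ≠ 0} = contact (fun z : ℂ => ‖z‖) univ ν := by
  have h : ∀ r : ℝ, Metric.closedBall (0 : ℂ) r = univ ∩ {z | ‖z‖ ≤ r} := by
    intro r; ext z; simp
  simp only [contact, h]

lemma lintegral_ite_const {Ω : Type*} [MeasurableSpace Ω] {P : Measure Ω} {p : Ω → Prop}
    [DecidablePred p]
    (hp : MeasurableSet {ω | p ω}) (f : Ω → ℝ≥0∞) (c : ℝ≥0∞) :
    ∫⁻ ω, (if p ω then f ω else c) ∂P = ∫⁻ ω in {ω | p ω}, f ω ∂P + c * P {ω | p ω}ᶜ := by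
  rw [← lintegral_add_compl _ hp]
  congr 1
  · refine setLIntegral_congr_fun hp fun ω hω => ?_
    rw [mem_ofPred_eq] at hω
    simp only [if_pos hω]
  · rw [← setLIntegral_const]
    refine setLIntegral_congr_fun hp.compl fun ω hω => ?_
    rw [mem_compl_iff, mem_ofPred_eq] at hω
    simp only [if_neg hω]

namespace Geometry

variable {Ω : Type*} [MeasurableSpace Ω] {par : Params} {P : Measure Ω}
  (M : Geometry par P)

lemma tbu_eq (ω : Ω) : M.tbu ω = contact (fun z : ℂ => ‖z‖) univ (M.bs ω) := contact_ball _

lemma servingLink_eq (ω : Ω) :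
    M.servingLink ω = par.linkOf (M.tbu ω) (M.los ω) (M.ris ω) (M.theta ω) := rfl

/-- Law of the distance to the nearest base station. -/
lemma map_tbu [IsProbabilityMeasure P] : P.map M.tbu
    = (volume.restrict (Ioi 0)).withDensity fun t => ENNReal.ofReal (par.pdfTbu t) := by
  have hl := par.lamB_pos
  have hprim : ∀ r : ℝ, ∫ t in (0 : ℝ)..r, 2 * Real.pi * par.lamB * t
      = Real.pi * par.lamB * r ^ 2 := by
    intro r
    rw [intervalIntegral.integral_const_mul, integral_id]
    ring
  have h := M.bs_poisson.map_contact (R := fun z : ℂ => ‖z‖) measurable_norm MeasurableSet.univ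
    (g := fun t => 2 * Real.pi * par.lamB * t) (fun r hr => by positivity)
    (fun a b => Continuous.intervalIntegrable (by fun_prop) _ _)
    (fun r _ => by fun_prop) (by fun_prop) (fun r hr => par.lamB_smul_closedBall hr)
  -- Void probabilities of large discs tend to zero, so a base station exists almost surely and the
  -- law of the contact distance is not defective.
  have hne : ∀ᵐ ω ∂P, M.bs ω univ ≠ 0 := by
    have h0 : ∀ r : ℝ, 0 ≤ r → P {ω | M.bs ω univ = 0}
        ≤ ENNReal.ofReal (Real.exp (-(Real.pi * par.lamB * r ^ 2))) := by
      intro r hr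
      have h1 := M.bs_poisson.measure_eq_zero (B := univ ∩ {z : ℂ | ‖z‖ ≤ r})
        (MeasurableSet.univ.inter (measurable_norm measurableSet_Iic))
        (by rw [par.lamB_smul_closedBall hr]; exact ENNReal.ofReal_ne_top)
      rw [par.lamB_smul_closedBall hr, hprim, ENNReal.toReal_ofReal (by positivity)] at h1
      rw [← h1]
      exact measure_mono fun ω hω => measure_mono_null inter_subset_left hω
    have hlim : Tendsto (fun r : ℝ => ENNReal.ofReal (Real.exp (-(Real.pi * par.lamB * r ^ 2))))
        atTop (𝓝 0) := by
      rw [← ENNReal.ofReal_zero]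
      refine ENNReal.tendsto_ofReal (Real.tendsto_exp_neg_atTop_nhds_zero.comp ?_)
      exact (tendsto_pow_atTop two_ne_zero).const_mul_atTop (by positivity)
    have := ge_of_tendsto hlim (eventually_atTop.2 ⟨0, fun r hr => h0 r hr⟩)
    simpa [ae_iff] using this
  rw [Measure.restrict_eq_self_of_ae_mem (s := {ω | M.bs ω univ ≠ 0}) hne] at h
  have h2 : M.tbu = fun ω => contact (fun z : ℂ => ‖z‖) univ (M.bs ω) := funext M.tbu_eq
  rw [h2, h]
  congr 1
  ext t
  rw [hprim, Params.pdfTbu]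
  congr 3
  ring

/-- Annuli are bounded and thus have finite mean, so almost surely every annulus contains finitely
many RISs and the regularisation changes nothing. -/
lemma ae_regularize_ris : ∀ᵐ ω ∂P, regularize Params.annulus (M.ris ω) = M.ris ω := by
  have h : ∀ n : ℕ, ∀ᵐ ω ∂P, M.ris ω (Params.annulus ⁻¹' {n}) < ∞ := by
    intro n
    refine M.ris_poisson.ae_lt_top (Params.measurable_annulus (measurableSet_singleton n)) ?_
    have hsub : Params.annulus ⁻¹' {n} ⊆ Metric.closedBall (0 : ℂ) (n + 1) ×ˢ univ := by
      intro x hx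
      refine ⟨?_, trivial⟩
      have h1 : ⌊‖x.1‖⌋₊ = n := hx
      rw [mem_closedBall_zero_iff, ← h1]
      exact (Nat.lt_floor_add_one _).le
    refine ne_top_of_le_ne_top ?_ (measure_mono hsub)
    rw [Measure.prod_prod, Measure.smul_apply]
    exact ENNReal.mul_ne_top (ENNReal.mul_ne_top ENNReal.ofReal_ne_top
      measure_closedBall_lt_top.ne) (measure_ne_top _ _)
  filter_upwards [ae_all_iff.2 h] with ω hω
  exact regularize_eq Params.measurable_annulus hω

lemma tbu_measurable : Measurable M.tbu := by
  have h2 : M.tbu = fun ω => contact (fun z : ℂ => ‖z‖) univ (M.bs ω) := funext M.tbu_eq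
  rw [h2]
  exact (measurable_contact measurable_norm MeasurableSet.univ).comp M.bs_poisson.measurable

/-- Average over the configuration of the RISs. -/
lemma lintegral_ris [IsProbabilityMeasure P] {t : ℝ} (ht : 0 < t) {H : ℝ → ℝ≥0∞}
    (hH : Measurable H) (B : ℝ≥0∞) :
    ∫⁻ ω, (if M.ris ω (viableSet par t) ≠ 0 then
      H (contact (fun x => ‖x.1‖) (viableSet par t) (M.ris ω)) else B) ∂P
      = (∫⁻ r in Ioi 0, ENNReal.ofReal (par.viableDensity t r) * H r)
        + ENNReal.ofReal (1 - par.PCL t) * B := by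
  have hVm := par.measurableSet_viableSet t
  have hA : MeasurableSet {ω | M.ris ω (viableSet par t) ≠ 0} :=
    ((M.ris_poisson.measurable_apply hVm) (measurableSet_singleton 0)).compl
  have hmc : Measurable fun ω => contact (fun x : ℂ × ℝ => ‖x.1‖) (viableSet par t) (M.ris ω) :=
    (measurable_contact measurable_fst.norm hVm).comp M.ris_poisson.measurable
  have hlaw : (P.restrict {ω | M.ris ω (viableSet par t) ≠ 0}).map
      (fun ω => contact (fun x : ℂ × ℝ => ‖x.1‖) (viableSet par t) (M.ris ω))
      = (volume.restrict (Ioi 0)).withDensity fun r => ENNReal.ofReal (par.viableDensity t r) :=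
    M.ris_poisson.map_contact (R := fun x : ℂ × ℝ => ‖x.1‖) measurable_fst.norm hVm
    (g := par.viableRate t) (fun r hr => par.viableRate_nonneg t hr)
    (par.intervalIntegrable_viableRate t) (fun r hr => par.continuousAt_viableRate ht hr)
    (par.measurable_viableRate_right t) (fun r hr => par.ris_intensity_le t hr)
  have hvoid : P {ω | M.ris ω (viableSet par t) ≠ 0}ᶜ = ENNReal.ofReal (1 - par.PCL t) := by
    have h0 : 0 ≤ ∫ s in Ioi (0 : ℝ), par.viableRate t s :=
      setIntegral_nonneg measurableSet_Ioi fun r hr => par.viableRate_nonneg t hr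
    have h1 := M.ris_poisson.measure_eq_zero hVm
      (by rw [par.ris_intensity_viableSet]; exact ENNReal.ofReal_ne_top)
    rw [par.ris_intensity_viableSet, ENNReal.toReal_ofReal h0] at h1
    rw [par.PCL_eq, sub_sub_cancel, ← h1]
    congr 1
    ext ω; simp
  rw [lintegral_ite_const hA, hvoid, ← lintegral_map hH hmc, hlaw,
    lintegral_withDensity_eq_lintegral_mul _ (par.measurable_viableDensity_right t).ennreal_ofReal
      hH, mul_comm B]
  rfl

end Geometry

/-! ### Independence of geometry and signal, and the law of the serving link -/

lemma map_prod_regroup {α₁ α₂ α₃ α₄ β : Type*} [MeasurableSpace α₁] [MeasurableSpace α₂]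
    [MeasurableSpace α₃] [MeasurableSpace α₄] [MeasurableSpace β] (μ₁ : Measure α₁)
    (μ₂ : Measure α₂) (μ₃ : Measure α₃) (μ₄ : Measure α₄) (ρ : Measure β) [SFinite μ₁]
    [SFinite μ₂] [SFinite μ₃] [SFinite μ₄] [SFinite ρ] :
    (μ₁.prod (μ₂.prod (μ₃.prod (μ₄.prod ρ)))).map
        (fun x => ((x.1, x.2.1, x.2.2.1, x.2.2.2.1), x.2.2.2.2))
      = (μ₁.prod (μ₂.prod (μ₃.prod μ₄))).prod ρ := by
  have h3 := (measurePreserving_prodAssoc μ₃ μ₄ ρ).symm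
  have h2 := (measurePreserving_prodAssoc μ₂ (μ₃.prod μ₄) ρ).symm.comp
    ((MeasurePreserving.id μ₂).prod h3)
  have h1 := (measurePreserving_prodAssoc μ₁ (μ₂.prod (μ₃.prod μ₄)) ρ).symm.comp
    ((MeasurePreserving.id μ₁).prod h2)
  exact h1.map_eq

lemma measurable_cascaded_distBR : Measurable fun p : ℝ × ℝ × ℝ =>
    Link.cascaded p.1 p.2.1 (Params.distBR p.1 p.2.1 p.2.2) :=
  Link.measurable_cascaded.comp
    (f := fun p : ℝ × ℝ × ℝ => (p.1, p.2.1, Params.distBR p.1 p.2.1 p.2.2)) (by fun_prop)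

namespace Uplink

variable {Ω : Type*} [MeasurableSpace Ω] {par : Params} {P : Measure Ω} (M : Uplink par P)

/-- The random elements that determine the serving link. -/
def geometryTuple (ω : Ω) : Measure ℂ × ℝ × Measure (ℂ × ℝ) × ℝ :=
  (M.bs ω, M.los ω, M.ris ω, M.theta ω)

/-- The fading coefficients and the interfering users. -/
def signalTuple (ω : Ω) : (LinkType → ℝ) × Measure Interferer :=
  (fun q => M.fading q ω, M.users ω)

lemma measurable_fading_pi : Measurable fun ω q => M.fading q ω :=
  measurable_pi_iff.2 M.fading_measurable

lemma measurable_geometryTuple : Measurable M.geometryTuple :=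
  M.bs_poisson.measurable.prodMk (M.los_measurable.prodMk
    (M.ris_poisson.measurable.prodMk M.theta_measurable))

lemma measurable_signalTuple : Measurable M.signalTuple :=
  M.measurable_fading_pi.prodMk M.users_poisson.measurable

lemma sigma_le : M.sigma ≤ (inferInstance : MeasurableSpace Ω) :=
  M.measurable_geometryTuple.comap_le

/-- The serving link as a measurable function of the geometry. -/
def linkFun (par : Params) (x : Measure ℂ × ℝ × Measure (ℂ × ℝ) × ℝ) : Link :=
  par.linkOf (contact (fun z : ℂ => ‖z‖) univ x.1) x.2.1
    (regularize Params.annulus x.2.2.1) x.2.2.2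

lemma measurable_linkFun (par : Params) : Measurable (linkFun par) := by
  refine par.measurable_linkOf.comp (f := fun x : Measure ℂ × ℝ × Measure (ℂ × ℝ) × ℝ =>
    ((contact (fun z : ℂ => ‖z‖) univ x.1, x.2.2.1), x.2.1, x.2.2.2)) ?_
  exact (((measurable_contact measurable_norm MeasurableSet.univ).comp measurable_fst).prodMk
    measurable_snd.snd.fst).prodMk (measurable_snd.fst.prodMk measurable_snd.snd.snd)

/-- The equality is only almost sure, because exceptional configurations are altered by the
regularisation. It still makes the serving link almost everywhere equal to a measurable function of
the geometry. -/
lemma servingLink_ae_eq : M.servingLink =ᵐ[P] fun ω => linkFun par (M.geometryTuple ω) := by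
  filter_upwards [M.ae_regularize_ris] with ω hω
  rw [M.servingLink_eq, M.tbu_eq, linkFun, geometryTuple, hω]

lemma aemeasurable_servingLink : AEMeasurable M.servingLink P :=
  ⟨_, (measurable_linkFun par).comp M.measurable_geometryTuple, M.servingLink_ae_eq⟩

variable [IsProbabilityMeasure P]

lemma map_tuples : P.map (fun ω => (M.geometryTuple ω, M.signalTuple ω))
    = ((P.map M.bs).prod ((P.map M.los).prod ((P.map M.ris).prod (P.map M.theta)))).prod
      ((P.map fun ω q => M.fading q ω).prod (P.map M.users)) := by
  have := Measure.isProbabilityMeasure_map (μ := P) M.bs_poisson.measurable.aemeasurable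
  have := Measure.isProbabilityMeasure_map (μ := P) M.los_measurable.aemeasurable
  have := Measure.isProbabilityMeasure_map (μ := P) M.ris_poisson.measurable.aemeasurable
  have := Measure.isProbabilityMeasure_map (μ := P) M.theta_measurable.aemeasurable
  have := Measure.isProbabilityMeasure_map (μ := P) M.measurable_fading_pi.aemeasurable
  have := Measure.isProbabilityMeasure_map (μ := P) M.users_poisson.measurable.aemeasurable
  rw [← map_prod_regroup, ← M.indep, Measure.map_map (by fun_prop)]
  · rfl
  · exact M.bs_poisson.measurable.prodMk (M.los_measurable.prodMk
      (M.ris_poisson.measurable.prodMk (M.theta_measurable.prodMk M.measurable_signalTuple)))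

lemma map_geometryTuple : P.map M.geometryTuple
    = (P.map M.bs).prod ((P.map M.los).prod ((P.map M.ris).prod (P.map M.theta))) := by
  have := Measure.isProbabilityMeasure_map (μ := P) M.bs_poisson.measurable.aemeasurable
  have := Measure.isProbabilityMeasure_map (μ := P) M.los_measurable.aemeasurable
  have := Measure.isProbabilityMeasure_map (μ := P) M.ris_poisson.measurable.aemeasurable
  have := Measure.isProbabilityMeasure_map (μ := P) M.theta_measurable.aemeasurable
  have := Measure.isProbabilityMeasure_map (μ := P) M.measurable_fading_pi.aemeasurable
  have := Measure.isProbabilityMeasure_map (μ := P) M.users_poisson.measurable.aemeasurable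
  have h := congrArg (Measure.map Prod.fst) M.map_tuples
  rw [Measure.map_map measurable_fst
    (M.measurable_geometryTuple.prodMk M.measurable_signalTuple), Measure.map_fst_prod] at h
  simpa [Function.comp_def] using h

lemma map_signalTuple : P.map M.signalTuple
    = (P.map fun ω q => M.fading q ω).prod (P.map M.users) := by
  have := Measure.isProbabilityMeasure_map (μ := P) M.bs_poisson.measurable.aemeasurable
  have := Measure.isProbabilityMeasure_map (μ := P) M.los_measurable.aemeasurable
  have := Measure.isProbabilityMeasure_map (μ := P) M.ris_poisson.measurable.aemeasurable
  have := Measure.isProbabilityMeasure_map (μ := P) M.theta_measurable.aemeasurable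
  have := Measure.isProbabilityMeasure_map (μ := P) M.measurable_fading_pi.aemeasurable
  have := Measure.isProbabilityMeasure_map (μ := P) M.users_poisson.measurable.aemeasurable
  have h := congrArg (Measure.map Prod.snd) M.map_tuples
  rw [Measure.map_map measurable_snd
    (M.measurable_geometryTuple.prodMk M.measurable_signalTuple), Measure.map_snd_prod] at h
  simpa [Function.comp_def] using h

lemma map_tuples_eq_prod : P.map (fun ω => (M.geometryTuple ω, M.signalTuple ω))
    = (P.map M.geometryTuple).prod (P.map M.signalTuple) := by
  rw [map_tuples, map_geometryTuple, map_signalTuple]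

/-- With the distance frozen the viable set is deterministic, and `Geometry.lintegral_ris` supplies
the contact law and the void probability. The uniform mark then separates the direct LoS link from
the rest. -/
lemma lintegral_linkOf {t : ℝ} (ht : 0 < t) {F : Link → ℝ≥0∞} (hF : Measurable F) :
    ∫⁻ u, ∫⁻ ν, ∫⁻ θ, F (par.linkOf t u (regularize Params.annulus ν) θ)
        ∂(P.map M.theta) ∂(P.map M.ris) ∂(P.map M.los)
      = par.condLinkAverage F t := by
  have hHm : Measurable fun r =>
      ∫⁻ θ, F (.cascaded t r (Params.distBR t r θ)) ∂(uniformLaw (-Real.pi) Real.pi) := by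
    have h : Measurable fun p : ℝ × ℝ => F (.cascaded t p.1 (Params.distBR t p.1 p.2)) :=
      hF.comp (measurable_cascaded_distBR.comp (f := fun p : ℝ × ℝ => (t, p.1, p.2))
        (by fun_prop))
    exact h.lintegral_prod_right'
  have hmν : ∀ u, Measurable fun ν => ∫⁻ θ, F (par.linkOf t u (regularize Params.annulus ν) θ)
      ∂(uniformLaw (-Real.pi) Real.pi) := by
    intro u
    refine Measurable.lintegral_prod_right' (f := fun p : Measure (ℂ × ℝ) × ℝ =>
      F (par.linkOf t u (regularize Params.annulus p.1) p.2)) (hF.comp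
        (par.measurable_linkOf.comp (f := fun p : Measure (ℂ × ℝ) × ℝ => ((t, p.1), u, p.2)) ?_))
    exact (measurable_const.prodMk measurable_fst).prodMk (measurable_const.prodMk measurable_snd)
  rw [M.theta_law, M.los_law]
  have key : ∀ u, ∫⁻ ν, ∫⁻ θ, F (par.linkOf t u (regularize Params.annulus ν) θ)
        ∂(uniformLaw (-Real.pi) Real.pi) ∂(P.map M.ris)
      = if u < par.PLoS t then F (.direct t) else
        ((∫⁻ r in Ioi 0, ENNReal.ofReal (par.viableDensity t r) *
          ∫⁻ θ, F (.cascaded t r (Params.distBR t r θ)) ∂(uniformLaw (-Real.pi) Real.pi))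
        + ENNReal.ofReal (1 - par.PCL t) * F (.nlos t)) := by
    intro u
    rw [lintegral_map (hmν u) M.ris_poisson.measurable]
    by_cases hu : u < par.PLoS t
    · simp [Params.linkOf, hu]
    · rw [if_neg hu, ← M.lintegral_ris ht hHm]
      refine lintegral_congr_ae ?_
      filter_upwards [M.ae_regularize_ris] with ω hω
      rw [hω]
      by_cases hV : M.ris ω (Geometry.viableSet par t) ≠ 0
      · simp [Params.linkOf, hu, hV]
      · simp [Params.linkOf, hu, hV]
  simp_rw [key]
  exact lintegral_uniformLaw_ite (par.PLoS_pos t).le (par.PLoS_le_one ht.le) _ _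

/-- Average over the marks, the RISs and the angle, given the base station distance. -/
def distanceAverage (F : Link → ℝ≥0∞) (t : ℝ) : ℝ≥0∞ :=
  ∫⁻ y, F (par.linkOf t y.1 (regularize Params.annulus y.2.1) y.2.2)
    ∂((P.map M.los).prod ((P.map M.ris).prod (P.map M.theta)))

lemma measurable_comp_linkOf (par : Params) {F : Link → ℝ≥0∞} (hF : Measurable F) :
    Measurable fun p : ℝ × (ℝ × Measure (ℂ × ℝ) × ℝ) =>
      F (par.linkOf p.1 p.2.1 (regularize Params.annulus p.2.2.1) p.2.2.2) := by
  refine hF.comp (par.measurable_linkOf.comp (f := fun p : ℝ × (ℝ × Measure (ℂ × ℝ) × ℝ) =>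
    ((p.1, p.2.2.1), p.2.1, p.2.2.2)) ?_)
  fun_prop

lemma measurable_distanceAverage {F : Link → ℝ≥0∞} (hF : Measurable F) :
    Measurable (M.distanceAverage F) := by
  have := Measure.isProbabilityMeasure_map (μ := P) M.los_measurable.aemeasurable
  have := Measure.isProbabilityMeasure_map (μ := P) M.ris_poisson.measurable.aemeasurable
  have := Measure.isProbabilityMeasure_map (μ := P) M.theta_measurable.aemeasurable
  exact (measurable_comp_linkOf par hF).lintegral_prod_right'

lemma distanceAverage_eq {t : ℝ} (ht : 0 < t) {F : Link → ℝ≥0∞} (hF : Measurable F) :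
    M.distanceAverage F t = par.condLinkAverage F t := by
  have := Measure.isProbabilityMeasure_map (μ := P) M.los_measurable.aemeasurable
  have := Measure.isProbabilityMeasure_map (μ := P) M.ris_poisson.measurable.aemeasurable
  have := Measure.isProbabilityMeasure_map (μ := P) M.theta_measurable.aemeasurable
  have h1 : Measurable fun y : ℝ × Measure (ℂ × ℝ) × ℝ =>
      F (par.linkOf t y.1 (regularize Params.annulus y.2.1) y.2.2) :=
    (measurable_comp_linkOf par hF).comp measurable_prodMk_left
  rw [← M.lintegral_linkOf ht hF, distanceAverage, lintegral_prod _ h1.aemeasurable]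
  refine lintegral_congr fun u => ?_
  have h2 : Measurable fun z : Measure (ℂ × ℝ) × ℝ =>
      F (par.linkOf t u (regularize Params.annulus z.1) z.2) := h1.comp measurable_prodMk_left
  exact lintegral_prod _ h2.aemeasurable

/-- Measurability in the distance is read off from the random model by Tonelli's theorem, and
transferred to the explicit formula, with which it agrees at positive distances. -/
lemma aemeasurable_condLinkAverage (M : Uplink par P) {F : Link → ℝ≥0∞} (hF : Measurable F) :
    AEMeasurable (par.condLinkAverage F) (volume.restrict (Ioi 0)) := by
  refine ⟨_, M.measurable_distanceAverage hF, ?_⟩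
  filter_upwards [ae_restrict_mem measurableSet_Ioi] with t ht
  exact (M.distanceAverage_eq ht hF).symm

/-- Averages over the random serving link. -/
theorem lintegral_servingLink {F : Link → ℝ≥0∞} (hF : Measurable F) :
    ∫⁻ ω, F (M.servingLink ω) ∂P
      = ∫⁻ t in Ioi 0, ENNReal.ofReal (par.pdfTbu t) * par.condLinkAverage F t := by
  have := Measure.isProbabilityMeasure_map (μ := P) M.los_measurable.aemeasurable
  have := Measure.isProbabilityMeasure_map (μ := P) M.ris_poisson.measurable.aemeasurable
  have := Measure.isProbabilityMeasure_map (μ := P) M.theta_measurable.aemeasurable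
  have hΨ := M.measurable_distanceAverage hF
  have hb : Measurable (contact (fun z : ℂ => ‖z‖) univ) :=
    measurable_contact measurable_norm MeasurableSet.univ
  calc ∫⁻ ω, F (M.servingLink ω) ∂P
      = ∫⁻ ω, F (linkFun par (M.geometryTuple ω)) ∂P := by
        refine lintegral_congr_ae ?_
        filter_upwards [M.servingLink_ae_eq] with ω hω
        rw [hω]
    _ = ∫⁻ x, F (linkFun par x) ∂(P.map M.geometryTuple) :=
        (lintegral_map (hF.comp (measurable_linkFun par)) M.measurable_geometryTuple).symm
    _ = ∫⁻ b, M.distanceAverage F (contact (fun z : ℂ => ‖z‖) univ b) ∂(P.map M.bs) := by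
        rw [map_geometryTuple, lintegral_prod]
        · rfl
        · exact (hF.comp (measurable_linkFun par)).aemeasurable
    _ = ∫⁻ ω, M.distanceAverage F (M.tbu ω) ∂P := by
        simp_rw [M.tbu_eq]
        exact lintegral_map (hΨ.comp hb) M.bs_poisson.measurable
    _ = ∫⁻ t, M.distanceAverage F t ∂(P.map M.tbu) := (lintegral_map hΨ M.tbu_measurable).symm
    _ = ∫⁻ t in Ioi 0, ENNReal.ofReal (par.pdfTbu t) * M.distanceAverage F t := by
        have hp : Measurable fun t => ENNReal.ofReal (par.pdfTbu t) := by
          unfold Params.pdfTbu; fun_prop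
        rw [M.map_tbu, lintegral_withDensity_eq_lintegral_mul _ hp hΨ]
        rfl
    _ = _ := setLIntegral_congr_fun measurableSet_Ioi fun t ht => by
        simp only [M.distanceAverage_eq ht hF]

end Uplink

/-! ### The average over the serving link as a real integral -/

namespace Params

variable (par : Params)

lemma distBR_pos {t r θ : ℝ} (ht : 0 < t) (hr : 0 < r)
    (hθ : θ ∈ Ioo (-Real.pi) Real.pi) (hθ0 : θ ≠ 0) : 0 < distBR t r θ :=
  Real.sqrt_pos.2 (law_of_cosines_pos ht hr hθ hθ0)

/-- Averages over the serving link only depend on proper links. -/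
lemma linkAverage_congr {F G : Link → ℝ} (h : ∀ ℓ : Link, ℓ.Proper → F ℓ = G ℓ) :
    par.linkAverage F = par.linkAverage G := by
  refine setIntegral_congr_fun measurableSet_Ioi fun t ht => ?_
  have ht : 0 < t := ht
  have hc : ∫ r in Ioi (0 : ℝ), ∫ θ in (-Real.pi)..Real.pi,
          par.assoc .CL t * F (.cascaded t r (distBR t r θ)) * (1 / (2 * Real.pi) * par.pdfTru t r)
      = ∫ r in Ioi (0 : ℝ), ∫ θ in (-Real.pi)..Real.pi,
          par.assoc .CL t * G (.cascaded t r (distBR t r θ))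
            * (1 / (2 * Real.pi) * par.pdfTru t r) := by
    refine setIntegral_congr_fun measurableSet_Ioi fun r hr => ?_
    refine intervalIntegral.integral_congr_ae ?_
    -- At angle `0` the RIS may coincide with the base station, and the endpoint `π` lies outside
    -- the open interval of `distBR_pos`. Both angles are null.
    filter_upwards [compl_mem_ae_iff.2 (measure_singleton (0 : ℝ)),
      compl_mem_ae_iff.2 (measure_singleton Real.pi)] with θ h0 hpi hθ
    rw [uIoc_of_le neg_pi_le_pi] at hθ
    have hp : (Link.cascaded t r (distBR t r θ)).Proper :=
      ⟨ht, hr, distBR_pos ht hr ⟨hθ.1, lt_of_le_of_ne hθ.2 hpi⟩ h0⟩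
    rw [h _ hp]
  simp only [h (.direct t) ht, h (.nlos t) ht, hc]

/-- Average over the angle of a cascaded link. -/
def angleAverage (F : Link → ℝ) (t r : ℝ) : ℝ :=
  1 / (2 * Real.pi) * ∫ θ in (-Real.pi)..Real.pi, F (.cascaded t r (distBR t r θ))

variable {F : Link → ℝ} {C : ℝ}

lemma integrableOn_cascaded (hF : Measurable F) (h0 : ∀ ℓ, 0 ≤ F ℓ) (hC : ∀ ℓ, F ℓ ≤ C)
    (t r : ℝ) :
    IntegrableOn (fun θ => F (.cascaded t r (distBR t r θ))) (Ioc (-Real.pi) Real.pi) := by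
  have hm : Measurable fun θ => F (.cascaded t r (distBR t r θ)) :=
    hF.comp (measurable_cascaded_distBR.comp (f := fun θ : ℝ => (t, r, θ)) (by fun_prop))
  refine Measure.integrableOn_of_bounded (by simp) hm.aestronglyMeasurable (M := C)
    (ae_of_all _ fun θ => ?_)
  rw [Real.norm_eq_abs, abs_of_nonneg (h0 _)]
  exact hC _

lemma angleAverage_nonneg (h0 : ∀ ℓ, 0 ≤ F ℓ) (t r : ℝ) : 0 ≤ angleAverage F t r := by
  have := Real.pi_pos
  refine mul_nonneg (by positivity) ?_
  exact intervalIntegral.integral_nonneg neg_pi_le_pi fun θ _ => h0 _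

lemma angleAverage_le (hF : Measurable F) (h0 : ∀ ℓ, 0 ≤ F ℓ) (hC : ∀ ℓ, F ℓ ≤ C) (t r : ℝ) :
    angleAverage F t r ≤ C := by
  have := Real.pi_pos
  rw [angleAverage, intervalIntegral.integral_of_le neg_pi_le_pi]
  have h : ∫ θ in Ioc (-Real.pi) Real.pi, F (.cascaded t r (distBR t r θ)) ≤ 2 * Real.pi * C := by
    calc _ ≤ ∫ _ in Ioc (-Real.pi) Real.pi, C :=
          integral_mono (integrableOn_cascaded hF h0 hC t r) (integrable_const _) fun θ => hC _
      _ = 2 * Real.pi * C := by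
          rw [setIntegral_const, smul_eq_mul, Real.volume_real_Ioc_of_le neg_pi_le_pi]
          ring
  calc _ ≤ 1 / (2 * Real.pi) * (2 * Real.pi * C) := by gcongr
    _ = C := by field_simp

lemma measurable_angleAverage (hF : Measurable F) (t : ℝ) : Measurable (angleAverage F t) := by
  have h : Measurable fun p : ℝ × ℝ => F (.cascaded t p.1 (distBR t p.1 p.2)) :=
    hF.comp (measurable_cascaded_distBR.comp (f := fun p : ℝ × ℝ => (t, p.1, p.2)) (by fun_prop))
  unfold angleAverage
  simp_rw [intervalIntegral.integral_of_le neg_pi_le_pi]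
  exact (h.stronglyMeasurable.integral_prod_right').measurable.const_mul _

lemma ofReal_angleAverage (hF : Measurable F) (h0 : ∀ ℓ, 0 ≤ F ℓ) (hC : ∀ ℓ, F ℓ ≤ C) (t r : ℝ) :
    ENNReal.ofReal (angleAverage F t r) = ∫⁻ θ, ENNReal.ofReal (F (.cascaded t r (distBR t r θ)))
      ∂(uniformLaw (-Real.pi) Real.pi) := by
  have := Real.pi_pos
  rw [lintegral_uniformLaw_pi, angleAverage, ENNReal.ofReal_mul (by positivity),
    intervalIntegral.integral_of_le neg_pi_le_pi,
    ofReal_integral_eq_lintegral_ofReal (integrableOn_cascaded hF h0 hC t r)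
      (ae_of_all _ fun θ => h0 _)]

lemma integral_cascaded (F : Link → ℝ) (t : ℝ) :
    ∫ r in Ioi (0 : ℝ), ∫ θ in (-Real.pi)..Real.pi,
        par.assoc .CL t * F (.cascaded t r (distBR t r θ)) * (1 / (2 * Real.pi) * par.pdfTru t r)
      = (1 - par.PLoS t) * ∫ r in Ioi (0 : ℝ), par.viableDensity t r * angleAverage F t r := by
  rw [← integral_const_mul]
  refine integral_congr_ae ?_
  filter_upwards [par.assoc_mul_pdfTru t] with r hr
  rw [← mul_assoc, ← hr, intervalIntegral.integral_mul_const, intervalIntegral.integral_const_mul,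
    angleAverage]
  ring

lemma pdfTbu_nonneg {t : ℝ} (ht : 0 ≤ t) : 0 ≤ par.pdfTbu t := by
  have := par.lamB_pos
  have := Real.pi_pos
  unfold pdfTbu; positivity

/-- The inner average in the definition of `linkAverage`. -/
lemma ofReal_linkAverage_inner (hF : Measurable F) (h0 : ∀ ℓ, 0 ≤ F ℓ) (hC : ∀ ℓ, F ℓ ≤ C)
    {t : ℝ} (ht : 0 < t) :
    par.assoc .DL t * F (.direct t)
      + (∫ r in Ioi (0 : ℝ), ∫ θ in (-Real.pi)..Real.pi,
          par.assoc .CL t * F (.cascaded t r (distBR t r θ))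
            * (1 / (2 * Real.pi) * par.pdfTru t r))
      + par.assoc .DN t * F (.nlos t)
      = (par.condLinkAverage (fun ℓ => ENNReal.ofReal (F ℓ)) t).toReal := by
  have h1 := par.PLoS_pos t
  have h2 : 0 ≤ 1 - par.PLoS t := sub_nonneg.2 (par.PLoS_le_one ht.le)
  have h3 : 0 ≤ 1 - par.PCL t := sub_nonneg.2 (par.PCL_le_one t)
  have hint : IntegrableOn (fun r => par.viableDensity t r * angleAverage F t r) (Ioi 0) := by
    refine (par.integrableOn_viableDensity t).mul_bdd (c := C)
      (measurable_angleAverage hF t).aestronglyMeasurable (ae_of_all _ fun r => ?_)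
    rw [Real.norm_eq_abs, abs_of_nonneg (angleAverage_nonneg h0 t r)]
    exact angleAverage_le hF h0 hC t r
  have hnn : ∀ r ∈ Ioi (0 : ℝ), 0 ≤ par.viableDensity t r * angleAverage F t r := fun r hr =>
    mul_nonneg (par.viableDensity_nonneg t hr) (angleAverage_nonneg h0 t r)
  have hI : 0 ≤ ∫ r in Ioi (0 : ℝ), par.viableDensity t r * angleAverage F t r :=
    setIntegral_nonneg measurableSet_Ioi hnn
  have hl : ∫⁻ r in Ioi 0, ENNReal.ofReal (par.viableDensity t r) *
          ∫⁻ θ, ENNReal.ofReal (F (.cascaded t r (distBR t r θ))) ∂(uniformLaw (-Real.pi) Real.pi)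
      = ENNReal.ofReal (∫ r in Ioi (0 : ℝ), par.viableDensity t r * angleAverage F t r) := by
    rw [ofReal_integral_eq_lintegral_ofReal hint
      ((ae_restrict_iff' measurableSet_Ioi).2 (ae_of_all _ hnn))]
    refine setLIntegral_congr_fun measurableSet_Ioi fun r hr => ?_
    simp only [ENNReal.ofReal_mul (par.viableDensity_nonneg t hr),
      ofReal_angleAverage hF h0 hC]
  rw [condLinkAverage, hl, integral_cascaded, ← ENNReal.ofReal_mul h1.le, ← ENNReal.ofReal_mul h3,
    ← ENNReal.ofReal_add hI (mul_nonneg h3 (h0 _)), ← ENNReal.ofReal_mul h2,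
    ← ENNReal.ofReal_add (mul_nonneg h1.le (h0 _))
      (mul_nonneg h2 (add_nonneg hI (mul_nonneg h3 (h0 _)))), ENNReal.toReal_ofReal]
  · simp only [assoc]
    ring
  · exact add_nonneg (mul_nonneg h1.le (h0 _))
      (mul_nonneg h2 (add_nonneg hI (mul_nonneg h3 (h0 _))))

lemma condLinkAverage_ne_top (hF : Measurable F) (h0 : ∀ ℓ, 0 ≤ F ℓ) (hC : ∀ ℓ, F ℓ ≤ C)
    {t : ℝ} :
    par.condLinkAverage (fun ℓ => ENNReal.ofReal (F ℓ)) t < ∞ := by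
  have hb : ∫⁻ r in Ioi 0, ENNReal.ofReal (par.viableDensity t r) *
      ∫⁻ θ, ENNReal.ofReal (F (.cascaded t r (distBR t r θ))) ∂(uniformLaw (-Real.pi) Real.pi)
      < ∞ := by
    calc _ ≤ ∫⁻ r in Ioi 0, ENNReal.ofReal (par.viableDensity t r) * ENNReal.ofReal C := by
          refine lintegral_mono fun r => ?_
          rw [← ofReal_angleAverage hF h0 hC]
          gcongr
          exact angleAverage_le hF h0 hC t r
      _ = (∫⁻ r in Ioi 0, ENNReal.ofReal (par.viableDensity t r)) * ENNReal.ofReal C :=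
          lintegral_mul_const' _ _ ENNReal.ofReal_ne_top
      _ < ∞ := ENNReal.mul_lt_top
          (par.integrableOn_viableDensity t).lintegral_lt_top ENNReal.ofReal_lt_top
  unfold condLinkAverage
  refine ENNReal.add_lt_top.2 ⟨ENNReal.mul_lt_top ENNReal.ofReal_lt_top ENNReal.ofReal_lt_top,
    ENNReal.mul_lt_top ENNReal.ofReal_lt_top (ENNReal.add_lt_top.2 ⟨hb, ?_⟩)⟩
  exact ENNReal.mul_lt_top ENNReal.ofReal_lt_top ENNReal.ofReal_lt_top

end Params

namespace Uplink

variable {Ω : Type*} [MeasurableSpace Ω] {par : Params} {P : Measure Ω} (M : Uplink par P)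
  [IsProbabilityMeasure P] {F : Link → ℝ} {C : ℝ}

/-- The mean of a bounded function of the serving link is given by `linkAverage`. -/
theorem integral_servingLink (hF : Measurable F) (h0 : ∀ ℓ, 0 ≤ F ℓ) (hC : ∀ ℓ, F ℓ ≤ C) :
    ∫ ω, F (M.servingLink ω) ∂P = par.linkAverage F := by
  have hp : Measurable fun t => ENNReal.ofReal (par.pdfTbu t) := by
    unfold Params.pdfTbu; fun_prop
  have h1 : par.linkAverage F = ∫ t in Ioi (0 : ℝ), (ENNReal.ofReal (par.pdfTbu t) *
      par.condLinkAverage (fun ℓ => ENNReal.ofReal (F ℓ)) t).toReal := by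
    refine setIntegral_congr_fun measurableSet_Ioi fun t ht => ?_
    have ht : 0 < t := ht
    rw [par.ofReal_linkAverage_inner hF h0 hC ht, ENNReal.toReal_mul,
      ENNReal.toReal_ofReal (par.pdfTbu_nonneg ht.le), mul_comm]
  have hm : AEMeasurable (fun t => ENNReal.ofReal (par.pdfTbu t) *
      par.condLinkAverage (fun ℓ => ENNReal.ofReal (F ℓ)) t) (volume.restrict (Ioi 0)) :=
    hp.aemeasurable.mul (M.aemeasurable_condLinkAverage hF.ennreal_ofReal)
  rw [h1, integral_toReal hm (ae_of_all _ fun t => ENNReal.mul_lt_top ENNReal.ofReal_lt_top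
      (par.condLinkAverage_ne_top hF h0 hC)),
    ← M.lintegral_servingLink hF.ennreal_ofReal, integral_eq_lintegral_of_nonneg_ae
      (ae_of_all _ fun ω => h0 _)
      (hF.comp_aemeasurable M.aemeasurable_servingLink).aestronglyMeasurable]

lemma integrable_servingLink (hF : Measurable F) (h0 : ∀ ℓ, 0 ≤ F ℓ) (hC : ∀ ℓ, F ℓ ≤ C) :
    Integrable (fun ω => F (M.servingLink ω)) P := by
  refine Integrable.of_bound
    (hF.comp_aemeasurable M.aemeasurable_servingLink).aestronglyMeasurable C
    (ae_of_all _ fun ω => ?_)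
  rw [Real.norm_eq_abs, abs_of_nonneg (h0 _)]
  exact hC _

end Uplink

/-! ### Conditioning on the geometry -/

instance instMeasurableSpaceLinkType : MeasurableSpace LinkType := ⊤

instance instDiscreteMeasurableSpaceLinkType : DiscreteMeasurableSpace LinkType :=
  ⟨fun _ => trivial⟩

instance instCountableLinkType : Countable LinkType :=
  Function.Injective.countable (f := fun q : LinkType => match q with
    | .DL => (0 : ℕ)
    | .CL => 1
    | .DN => 2) (by intro a b h; cases a <;> cases b <;> simp_all)

lemma Link.measurable_type : Measurable Link.type :=
  Link.measurable_of_constructors measurable_const measurable_const measurable_const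

namespace Params

variable (par : Params)

lemma measurable_txPower : Measurable par.txPower := by
  refine Link.measurable_of_constructors ?_ ?_ ?_
  · unfold txPower
    exact Measurable.ite (measurableSet_lt measurable_id measurable_const) (by fun_prop)
      measurable_const
  · unfold txPower
    exact Measurable.ite (measurableSet_lt (by fun_prop) measurable_const) (by fun_prop)
      measurable_const
  · unfold txPower
    exact Measurable.ite (measurableSet_lt measurable_id measurable_const) (by fun_prop)
      measurable_const

lemma measurable_linkGain : Measurable par.linkGain := by
  refine Link.measurable_of_constructors ?_ ?_ ?_ <;> unfold linkGain <;> fun_prop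

lemma measurable_sinrAt_joint :
    Measurable fun x : Link × ℝ × ℝ≥0∞ => par.sinrAt x.1 x.2.1 x.2.2 := by
  have h1 := par.measurable_txPower
  have h2 := par.measurable_linkGain
  unfold sinrAt
  fun_prop

/-- The conditional coverage probability is measurable if the fading law depends on the type of
the link. -/
lemma measurable_coverageGiven (ν : LinkType → Measure ℝ) [∀ q, IsProbabilityMeasure (ν q)]
    (η : Measure ℝ≥0∞) [IsProbabilityMeasure η] (γ : ℝ) :
    Measurable fun ℓ : Link => par.coverageGiven (ν ℓ.type) η γ ℓ := by
  have h : ∀ q, Measurable fun ℓ : Link => par.coverageGiven (ν q) η γ ℓ := fun q =>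
    (measurable_measure_prodMk_left (ν := (ν q).prod η)
      (measurableSet_lt measurable_const par.measurable_sinrAt_joint)).ennreal_toReal
  exact Link.measurable_of_constructors ((h .DL).comp Link.measurable_direct)
    ((h .CL).comp Link.measurable_cascaded) ((h .DN).comp Link.measurable_nlos)

end Params

namespace Uplink

variable {Ω : Type*} [MeasurableSpace Ω] {par : Params} {P : Measure Ω} (M : Uplink par P)

/-- Set of the realisations in which the SINR exceeds `γ`. -/
def coverageSet (par : Params) (J : Measure Interferer → ℝ≥0∞) (γ : ℝ) :
    Set ((Measure ℂ × ℝ × Measure (ℂ × ℝ) × ℝ) × ((LinkType → ℝ) × Measure Interferer)) :=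
  {x | ENNReal.ofReal γ < par.sinrAt (linkFun par x.1) (x.2.1 (linkFun par x.1).type) (J x.2.2)}

lemma condCoverage_nonneg (I : Ω → ℝ≥0∞) (γ : ℝ) (ℓ : Link) : 0 ≤ M.condCoverage I γ ℓ :=
  par.coverageGiven_nonneg _ _ _ _

lemma coverage_ae_eq (J : Measure Interferer → ℝ≥0∞) (γ : ℝ) :
    {ω | ENNReal.ofReal γ < M.sinr (fun ω => J (M.users ω)) ω}
      =ᵐ[P] {ω | (M.geometryTuple ω, M.signalTuple ω) ∈ coverageSet par J γ} := by
  rw [Filter.eventuallyEq_set]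
  filter_upwards [M.servingLink_ae_eq] with ω hω
  have h : M.sinr (fun ω => J (M.users ω)) ω = par.sinrAt (linkFun par (M.geometryTuple ω))
      (M.fading (linkFun par (M.geometryTuple ω)).type ω) (J (M.users ω)) := by
    rw [← hω]; rfl
  rw [h]
  rfl

variable [IsProbabilityMeasure P]

lemma isProbabilityMeasure_fadingLaw_type (par : Params) (q : LinkType) :
    IsProbabilityMeasure (Params.fadingLaw (par.mType q)) :=
  isProbabilityMeasure_fadingLaw (par.mType_pos q)

lemma condCoverage_le_one {I : Ω → ℝ≥0∞} (hI : AEMeasurable I P) (γ : ℝ) (ℓ : Link) :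
    M.condCoverage I γ ℓ ≤ 1 := by
  have := isProbabilityMeasure_fadingLaw_type par ℓ.type
  have := Measure.isProbabilityMeasure_map hI
  exact par.coverageGiven_le_one _ _ _ _

lemma measurable_eval_type :
    Measurable fun y : (LinkType → ℝ) × LinkType => y.1 y.2 :=
  measurable_from_prod_countable_left fun q => measurable_pi_apply q

lemma measurableSet_coverageSet (par : Params) {J : Measure Interferer → ℝ≥0∞}
    (hJ : Measurable J) (γ : ℝ) : MeasurableSet (coverageSet par J γ) := by
  have hl : Measurable fun x : (Measure ℂ × ℝ × Measure (ℂ × ℝ) × ℝ) ×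
      ((LinkType → ℝ) × Measure Interferer) => linkFun par x.1 :=
    (measurable_linkFun par).comp measurable_fst
  refine measurableSet_lt measurable_const (par.measurable_sinrAt_joint.comp
    (hl.prodMk (Measurable.prodMk ?_ (hJ.comp measurable_snd.snd))))
  exact measurable_eval_type.comp (measurable_snd.fst.prodMk (Link.measurable_type.comp hl))

/-- Once the geometry is frozen, a single fading coefficient is read. Only its marginal law and its
independence of the interferers enter, not the joint law of the coefficients of different types. -/
lemma map_signalTuple_section {J : Measure Interferer → ℝ≥0∞} (hJ : Measurable J) (γ : ℝ)
    (x : Measure ℂ × ℝ × Measure (ℂ × ℝ) × ℝ) :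
    (P.map M.signalTuple) (Prod.mk x ⁻¹' coverageSet par J γ)
      = ENNReal.ofReal (M.condCoverage (fun ω => J (M.users ω)) γ (linkFun par x)) := by
  have := Measure.isProbabilityMeasure_map (μ := P) M.measurable_fading_pi.aemeasurable
  have := Measure.isProbabilityMeasure_map (μ := P) M.users_poisson.measurable.aemeasurable
  have := isProbabilityMeasure_fadingLaw_type par (linkFun par x).type
  have : IsProbabilityMeasure (P.map fun ω => J (M.users ω)) :=
    Measure.isProbabilityMeasure_map (hJ.comp M.users_poisson.measurable).aemeasurable
  have hev : Measurable (Prod.map (fun f : LinkType → ℝ => f (linkFun par x).type) J) :=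
    (measurable_pi_apply _).prodMap hJ
  have hmap : ((P.map fun ω q => M.fading q ω).prod (P.map M.users)).map
        (Prod.map (fun f => f (linkFun par x).type) J)
      = (Params.fadingLaw (par.mType (linkFun par x).type)).prod
        (P.map fun ω => J (M.users ω)) := by
    rw [← Measure.map_prod_map _ _ (measurable_pi_apply _) hJ,
      Measure.map_map (measurable_pi_apply _) M.measurable_fading_pi,
      Measure.map_map hJ M.users_poisson.measurable, ← M.fading_law]
    rfl
  rw [condCoverage, Params.coverageGiven, ofReal_measureReal, ← hmap, map_signalTuple,
    Measure.map_apply hev (par.measurableSet_coverage γ _)]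
  rfl

/-- The conditional coverage probability given the geometry. -/
theorem condExp_coverage {J : Measure Interferer → ℝ≥0∞} (hJ : Measurable J) (γ : ℝ) :
    P⟦{ω | ENNReal.ofReal γ < M.sinr (fun ω => J (M.users ω)) ω} | M.sigma⟧
      =ᵐ[P] fun ω => M.condCoverage (fun ω => J (M.users ω)) γ (M.servingLink ω) := by
  have hX := M.measurable_geometryTuple
  have hY := M.measurable_signalTuple
  have := Measure.isProbabilityMeasure_map (μ := P) hX.aemeasurable
  have := Measure.isProbabilityMeasure_map (μ := P) hY.aemeasurable
  have : IsProbabilityMeasure (P.map fun ω => J (M.users ω)) :=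
    Measure.isProbabilityMeasure_map (hJ.comp M.users_poisson.measurable).aemeasurable
  have hνp := isProbabilityMeasure_fadingLaw_type par
  have hC : Measurable (M.condCoverage (fun ω => J (M.users ω)) γ) :=
    par.measurable_coverageGiven (fun q => Params.fadingLaw (par.mType q)) _ γ
  have hS := measurableSet_coverageSet par hJ γ
  have hA : {ω | ENNReal.ofReal γ < M.sinr (fun ω => J (M.users ω)) ω}
      =ᵐ[P] {ω | (M.geometryTuple ω, M.signalTuple ω) ∈ coverageSet par J γ} :=
    M.coverage_ae_eq J γ
  have hAm : MeasurableSet {ω | (M.geometryTuple ω, M.signalTuple ω) ∈ coverageSet par J γ} :=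
    (hX.prodMk hY) hS
  have hgm : Measurable[M.sigma] fun ω =>
      M.condCoverage (fun ω => J (M.users ω)) γ (linkFun par (M.geometryTuple ω)) :=
    (hC.comp (measurable_linkFun par)).comp (comap_measurable M.geometryTuple)
  have hgi : Integrable (fun ω =>
      M.condCoverage (fun ω => J (M.users ω)) γ (linkFun par (M.geometryTuple ω))) P := by
    refine Integrable.of_bound (hgm.mono M.sigma_le le_rfl).aestronglyMeasurable 1
      (ae_of_all _ fun ω => ?_)
    rw [Real.norm_eq_abs, abs_of_nonneg (M.condCoverage_nonneg _ _ _)]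
    exact M.condCoverage_le_one (hJ.comp M.users_poisson.measurable).aemeasurable _ _
  have hg : (fun ω => M.condCoverage (fun ω => J (M.users ω)) γ (M.servingLink ω))
      =ᵐ[P] fun ω =>
        M.condCoverage (fun ω => J (M.users ω)) γ (linkFun par (M.geometryTuple ω)) := by
    filter_upwards [M.servingLink_ae_eq] with ω hω
    rw [hω]
  have hind : ({ω | ENNReal.ofReal γ < M.sinr (fun ω => J (M.users ω)) ω}.indicator
      fun _ => (1 : ℝ)) =ᵐ[P] {ω | (M.geometryTuple ω, M.signalTuple ω) ∈
        coverageSet par J γ}.indicator fun _ => (1 : ℝ) :=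
    indicator_ae_eq_of_ae_eq_set hA
  refine (condExp_congr_ae hind).trans (EventuallyEq.trans ?_ hg.symm)
  refine (ae_eq_condExp_of_forall_setIntegral_eq M.sigma_le
    ((integrable_const _).indicator hAm) (fun s _ _ => hgi.integrableOn) ?_
    hgm.stronglyMeasurable.aestronglyMeasurable).symm
  rintro s ⟨B, hB, rfl⟩ -
  change ∫ ω in M.geometryTuple ⁻¹' B, _ ∂P = ∫ ω in M.geometryTuple ⁻¹' B, _ ∂P
  have hBm : MeasurableSet (M.geometryTuple ⁻¹' B) := hX hB
  have hB' : MeasurableSet B := hB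
  -- This is the defining property of the conditional expectation on the event that the geometry
  -- lies in `B`. Independence gives a product law, and Tonelli's theorem integrates the
  -- probabilities of the sections over `B`.
  have hl : ∫⁻ ω in M.geometryTuple ⁻¹' B, ENNReal.ofReal
        (M.condCoverage (fun ω => J (M.users ω)) γ (linkFun par (M.geometryTuple ω))) ∂P
      = P ({ω | (M.geometryTuple ω, M.signalTuple ω) ∈ coverageSet par J γ} ∩
        M.geometryTuple ⁻¹' B) := by
    have h1 : {ω | (M.geometryTuple ω, M.signalTuple ω) ∈ coverageSet par J γ} ∩
        M.geometryTuple ⁻¹' B = (fun ω => (M.geometryTuple ω, M.signalTuple ω)) ⁻¹'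
          (coverageSet par J γ ∩ B ×ˢ univ) := by
      ext ω; simp
    rw [h1, ← Measure.map_apply (hX.prodMk hY) (hS.inter (hB'.prod MeasurableSet.univ)),
      map_tuples_eq_prod, Measure.prod_apply (hS.inter (hB'.prod MeasurableSet.univ))]
    have h2 : ∀ x, (P.map M.signalTuple) (Prod.mk x ⁻¹' (coverageSet par J γ ∩ B ×ˢ univ))
        = B.indicator (fun x => ENNReal.ofReal
          (M.condCoverage (fun ω => J (M.users ω)) γ (linkFun par x))) x := by
      intro x
      by_cases hx : x ∈ B
      · rw [indicator_of_mem hx, ← M.map_signalTuple_section hJ]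
        congr 1
        ext y; simp [hx]
      · rw [indicator_of_notMem hx]
        convert! measure_empty (μ := P.map M.signalTuple)
        ext y; simp [hx]
    simp_rw [h2]
    have hm : Measurable fun x => ENNReal.ofReal
        (M.condCoverage (fun ω => J (M.users ω)) γ (linkFun par x)) :=
      (hC.comp (measurable_linkFun par)).ennreal_ofReal
    rw [lintegral_indicator hB', setLIntegral_map hB' hm hX]
  rw [integral_eq_lintegral_of_nonneg_ae (ae_of_all _ fun ω => M.condCoverage_nonneg _ _ _)
    hgi.aestronglyMeasurable.restrict, hl, integral_indicator hAm,
    Measure.restrict_restrict hAm, setIntegral_const, smul_eq_mul, mul_one, measureReal_def]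

/-- The coverage probability is the average of the conditional coverage probability. -/
theorem measureReal_coverage {J : Measure Interferer → ℝ≥0∞} (hJ : Measurable J) (γ : ℝ) :
    P.real {ω | ENNReal.ofReal γ < M.sinr (fun ω => J (M.users ω)) ω}
      = ∫ ω, M.condCoverage (fun ω => J (M.users ω)) γ (M.servingLink ω) ∂P := by
  have hAm : NullMeasurableSet {ω | ENNReal.ofReal γ < M.sinr (fun ω => J (M.users ω)) ω} P :=
    (((M.measurable_geometryTuple.prodMk M.measurable_signalTuple)
      (measurableSet_coverageSet par hJ γ)).nullMeasurableSet).congr (M.coverage_ae_eq J γ).symm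
  rw [← integral_congr_ae (M.condExp_coverage hJ γ), integral_condExp M.sigma_le,
    integral_indicator₀ hAm]
  simp

end Uplink

/-! ### Antenna pattern -/

lemma measurable_pdfPhi : Measurable Params.pdfPhi := by
  unfold Params.pdfPhi
  exact Measurable.ite (measurableSet_Icc (a := -(1 / 2 : ℝ)) (b := 1 / 2)) (by fun_prop)
    measurable_const

lemma pdfPhi_nonneg (x : ℝ) : 0 ≤ Params.pdfPhi x := by
  unfold Params.pdfPhi
  split_ifs
  · have := Real.pi_pos
    positivity
  · exact le_rfl

lemma pdfPhi_of_notMem {x : ℝ} (hx : x ∉ Icc (-(1 / 2) : ℝ) (1 / 2)) : Params.pdfPhi x = 0 := by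
  unfold Params.pdfPhi
  exact if_neg hx

/-- Change of variables `x = cos φ / 2` on an interval where it is injective. -/
lemma lintegral_half_cos_of_injOn {s : Set ℝ} (hs : MeasurableSet s) (hi : InjOn Real.cos s)
    (hsin : ∀ φ ∈ s, Real.sin φ ≠ 0)
    (him : (fun φ => Real.cos φ / 2) '' s = Ioo (-(1 / 2)) (1 / 2)) (g : ℝ → ℝ≥0∞) :
    ∫⁻ φ in s, g (Real.cos φ / 2)
      = ENNReal.ofReal Real.pi * ∫⁻ x, ENNReal.ofReal (Params.pdfPhi x) * g x := by
  have hsupp : ∫⁻ x, ENNReal.ofReal (Params.pdfPhi x) * g x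
      = ∫⁻ x in Ioo (-(1 / 2) : ℝ) (1 / 2), ENNReal.ofReal (Params.pdfPhi x) * g x := by
    rw [setLIntegral_congr Ioo_ae_eq_Icc, ← lintegral_indicator measurableSet_Icc]
    refine lintegral_congr fun x => ?_
    by_cases hx : x ∈ Icc (-(1 / 2) : ℝ) (1 / 2)
    · rw [indicator_of_mem hx]
    · rw [indicator_of_notMem hx, pdfPhi_of_notMem hx]; simp
  have hd : ∀ φ ∈ s, HasDerivWithinAt (fun φ => Real.cos φ / 2) (-Real.sin φ / 2) s φ :=
    fun φ _ => ((Real.hasDerivAt_cos φ).div_const 2).hasDerivWithinAt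
  have hinj : InjOn (fun φ => Real.cos φ / 2) s := fun x hx y hy h =>
    hi hx hy (by simpa using h)
  rw [hsupp, ← him, lintegral_image_eq_lintegral_abs_deriv_mul hs hd hinj,
    ← lintegral_const_mul' _ _ ENNReal.ofReal_ne_top]
  refine setLIntegral_congr_fun hs fun φ hφ => ?_
  have hpi := Real.pi_pos
  -- For `x = cos φ / 2` the root in `pdfPhi` is `|sin φ|`, which cancels the Jacobian `|sin φ| /
  -- 2`. Each half of the circle contributes `π`, and the total `2π` is normalised by the uniform
  -- law.
  have h1 : Real.pi * (|-Real.sin φ / 2| * Params.pdfPhi (Real.cos φ / 2)) = 1 := by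
    unfold Params.pdfPhi
    rw [if_pos ⟨by linarith [Real.neg_one_le_cos φ], by linarith [Real.cos_le_one φ]⟩]
    have h2 : Real.sqrt (1 - 4 * (Real.cos φ / 2) ^ 2) = |Real.sin φ| := by
      rw [← Real.sqrt_sq_eq_abs, Real.sin_sq]
      congr 1; ring
    have h3 : |Real.sin φ| ≠ 0 := abs_ne_zero.2 (hsin φ hφ)
    rw [h2, abs_div, abs_neg, abs_two]
    field_simp
  calc g (Real.cos φ / 2) = ENNReal.ofReal 1 * g (Real.cos φ / 2) := by simp
    _ = _ := by
      rw [← h1, ENNReal.ofReal_mul hpi.le, ENNReal.ofReal_mul (abs_nonneg _)]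
      ring

/-- If `φ` is uniform on `[0, 2π]`, then `cos φ / 2` has density `pdfPhi`. -/
lemma lintegral_uniformLaw_half_cos (g : ℝ → ℝ≥0∞) :
    ∫⁻ φ, g (Real.cos φ / 2) ∂uniformLaw 0 (2 * Real.pi)
      = ∫⁻ x, ENNReal.ofReal (Params.pdfPhi x) * g x := by
  have hpi := Real.pi_pos
  have him : ∀ x ∈ Ioo (-(1 / 2) : ℝ) (1 / 2), 0 < Real.arccos (2 * x) ∧
      Real.arccos (2 * x) < Real.pi ∧ Real.cos (Real.arccos (2 * x)) = 2 * x := fun x hx =>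
    ⟨Real.arccos_pos.2 (by linarith [hx.2]),
      lt_of_le_of_ne (Real.arccos_le_pi _) fun h => by
        rw [Real.arccos_eq_pi] at h; linarith [hx.1],
      Real.cos_arccos (by linarith [hx.1]) (by linarith [hx.2])⟩
  have hcos : ∀ φ, Real.sin φ ≠ 0 → Real.cos φ / 2 ∈ Ioo (-(1 / 2) : ℝ) (1 / 2) := by
    intro φ h
    have h1 : 0 < Real.sin φ ^ 2 := by positivity
    have h2 := Real.sin_sq_add_cos_sq φ
    constructor <;> nlinarith
  have hs1 : ∀ φ ∈ Ioo 0 Real.pi, Real.sin φ ≠ 0 := fun φ h =>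
    (Real.sin_pos_of_pos_of_lt_pi h.1 h.2).ne'
  have hs2 : ∀ φ ∈ Ioo Real.pi (2 * Real.pi), Real.sin φ ≠ 0 := fun φ h => by
    have := Real.sin_pos_of_pos_of_lt_pi (x := 2 * Real.pi - φ) (by linarith [h.2])
      (by linarith [h.1])
    rw [Real.sin_two_pi_sub] at this
    linarith
  have h1 := lintegral_half_cos_of_injOn measurableSet_Ioo
    (Real.injOn_cos.mono Ioo_subset_Icc_self) hs1
    (by
      ext x
      refine ⟨fun ⟨φ, h, e⟩ => e ▸ hcos φ (hs1 φ h), fun hx => ?_⟩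
      obtain ⟨ha, hb, hc⟩ := him x hx
      exact ⟨_, ⟨ha, hb⟩, by simp only [hc]; ring⟩) g
  have h2 := lintegral_half_cos_of_injOn measurableSet_Ioo
    (fun x hx y hy h => by
      have := Real.injOn_cos (x₁ := 2 * Real.pi - x) (x₂ := 2 * Real.pi - y)
        ⟨by linarith [hx.2], by linarith [hx.1]⟩ ⟨by linarith [hy.2], by linarith [hy.1]⟩
        (by simpa using h)
      linarith) hs2
    (by
      ext x
      refine ⟨fun ⟨φ, h, e⟩ => e ▸ hcos φ (hs2 φ h), fun hx => ?_⟩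
      obtain ⟨ha, hb, hc⟩ := him x hx
      refine ⟨2 * Real.pi - Real.arccos (2 * x), ⟨by linarith, by linarith⟩, ?_⟩
      simp only [Real.cos_two_pi_sub, hc]; ring) g
  have hvol : volume (Icc 0 (2 * Real.pi)) = ENNReal.ofReal (2 * Real.pi) := by
    rw [Real.volume_Icc, sub_zero]
  have hsplit : ∫⁻ φ in Icc 0 (2 * Real.pi), g (Real.cos φ / 2)
      = (∫⁻ φ in Ioo 0 Real.pi, g (Real.cos φ / 2))
        + ∫⁻ φ in Ioo Real.pi (2 * Real.pi), g (Real.cos φ / 2) := by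
    rw [← setLIntegral_congr (Ioc_ae_eq_Icc (μ := volume)), setLIntegral_congr (Ioo_ae_eq_Ioc),
      setLIntegral_congr (Ioo_ae_eq_Ioc (a := Real.pi)),
      ← lintegral_union measurableSet_Ioc (Ioc_disjoint_Ioc_of_le le_rfl),
      Ioc_union_Ioc_eq_Ioc hpi.le (by linarith)]
  rw [uniformLaw, ProbabilityTheory.cond, lintegral_smul_measure, hsplit, h1, h2, hvol, ← add_mul,
    ← ENNReal.ofReal_add hpi.le hpi.le, ← two_mul, smul_eq_mul, ← mul_assoc,
    ENNReal.inv_mul_cancel (by simpa using hpi) ENNReal.ofReal_ne_top, one_mul]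

/-- Law of the beam deviation `cos φ / 2 - cos φ' / 2` for independent uniform angles. -/
def deviationLaw : Measure ℝ :=
  volume.withDensity fun y => ∫⁻ x, ENNReal.ofReal (Params.pdfPhi x) *
    ENNReal.ofReal (Params.pdfPhi (y + x))

lemma measurable_deviation_integrand : Measurable fun p : ℝ × ℝ =>
    ENNReal.ofReal (Params.pdfPhi p.2) * ENNReal.ofReal (Params.pdfPhi (p.1 + p.2)) := by
  have := measurable_pdfPhi
  fun_prop

lemma measurable_deviation_density : Measurable fun y =>
    ∫⁻ x, ENNReal.ofReal (Params.pdfPhi x) * ENNReal.ofReal (Params.pdfPhi (y + x)) :=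
  measurable_deviation_integrand.lintegral_prod_right'

/-- The density of a difference of independent variables: translate the first variable by the second
and exchange the integrals. -/
lemma lintegral_deviationLaw {g : ℝ → ℝ≥0∞} (hg : Measurable g) :
    ∫⁻ φ, ∫⁻ φ', g (Real.cos φ / 2 - Real.cos φ' / 2) ∂uniformLaw 0 (2 * Real.pi)
      ∂uniformLaw 0 (2 * Real.pi) = ∫⁻ y, g y ∂deviationLaw := by
  have hp := measurable_pdfPhi
  have h0 : ∀ x, ∫⁻ φ', g (x - Real.cos φ' / 2) ∂uniformLaw 0 (2 * Real.pi)
      = ∫⁻ x', ENNReal.ofReal (Params.pdfPhi x') * g (x - x') := fun x =>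
    lintegral_uniformLaw_half_cos fun x' => g (x - x')
  simp_rw [h0]
  rw [lintegral_uniformLaw_half_cos fun x =>
    ∫⁻ x', ENNReal.ofReal (Params.pdfPhi x') * g (x - x')]
  have h1 : ∀ x, ENNReal.ofReal (Params.pdfPhi x) *
      ∫⁻ x', ENNReal.ofReal (Params.pdfPhi x') * g (x - x')
      = ∫⁻ x', ENNReal.ofReal (Params.pdfPhi x) * (ENNReal.ofReal (Params.pdfPhi x') *
        g (x - x')) := fun x => (lintegral_const_mul _ (by fun_prop)).symm
  simp_rw [h1]
  rw [lintegral_lintegral_swap (by fun_prop), deviationLaw,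
    lintegral_withDensity_eq_lintegral_mul _ measurable_deviation_density hg]
  have h2 : ∀ x', ∫⁻ x, ENNReal.ofReal (Params.pdfPhi x) * (ENNReal.ofReal (Params.pdfPhi x') *
        g (x - x')) = ∫⁻ y, ENNReal.ofReal (Params.pdfPhi (y + x')) *
          (ENNReal.ofReal (Params.pdfPhi x') * g y) := fun x' => by
    rw [← lintegral_add_right_eq_self (fun x => ENNReal.ofReal (Params.pdfPhi x) *
      (ENNReal.ofReal (Params.pdfPhi x') * g (x - x'))) x']
    simp
  simp_rw [h2]
  rw [lintegral_lintegral_swap (by fun_prop)]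
  refine lintegral_congr fun y => ?_
  rw [Pi.mul_apply, ← lintegral_mul_const _ (by fun_prop)]
  exact lintegral_congr fun x => by ring

instance instIsProbabilityMeasureDeviationLaw : IsProbabilityMeasure deviationLaw := by
  have := isProbabilityMeasure_uniformLaw (a := 0) (b := 2 * Real.pi) (by positivity)
  refine ⟨?_⟩
  rw [← lintegral_one, ← lintegral_deviationLaw measurable_const]
  simp

lemma toReal_deviation_density (y : ℝ) :
    (∫⁻ x, ENNReal.ofReal (Params.pdfPhi x) * ENNReal.ofReal (Params.pdfPhi (y + x))).toReal
      = Params.pdfDelta y := by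
  have hp := measurable_pdfPhi
  rw [Params.pdfDelta, intervalIntegral.integral_of_le (by norm_num),
    ← integral_Icc_eq_integral_Ioc, ← integral_indicator measurableSet_Icc,
    integral_eq_lintegral_of_nonneg_ae]
  · congr 1
    refine lintegral_congr fun x => ?_
    rw [← ENNReal.ofReal_mul (pdfPhi_nonneg x)]
    by_cases hx : x ∈ Icc (-(1 / 2) : ℝ) (1 / 2)
    · rw [indicator_of_mem hx]
    · rw [indicator_of_notMem hx, pdfPhi_of_notMem hx, zero_mul]
  · exact ae_of_all _ fun x => indicator_nonneg
      (fun x _ => mul_nonneg (pdfPhi_nonneg _) (pdfPhi_nonneg _)) x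
  · exact (Measurable.indicator (by fun_prop) measurableSet_Icc).aestronglyMeasurable

lemma pdfDelta_nonneg (y : ℝ) : 0 ≤ Params.pdfDelta y := by
  rw [← toReal_deviation_density]; exact ENNReal.toReal_nonneg

lemma pdfDelta_neg (y : ℝ) : Params.pdfDelta (-y) = Params.pdfDelta y := by
  rw [← toReal_deviation_density, ← toReal_deviation_density,
    ← lintegral_add_right_eq_self _ y]
  congr 1
  refine lintegral_congr fun x => ?_
  rw [mul_comm, show -y + (x + y) = x by ring, add_comm x y]

lemma lintegral_deviation_density :
    ∫⁻ y, ∫⁻ x, ENNReal.ofReal (Params.pdfPhi x) * ENNReal.ofReal (Params.pdfPhi (y + x)) = 1 := by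
  have := measure_univ (μ := deviationLaw)
  rwa [deviationLaw, withDensity_apply _ MeasurableSet.univ, Measure.restrict_univ] at this

/-- At `y = 0` the density is infinite, while `pdfDelta` is `0` there as the integral of a
nonintegrable function. Total mass 1 confines such points to a null set. -/
lemma deviation_density_ae_eq :
    (fun y => ∫⁻ x, ENNReal.ofReal (Params.pdfPhi x) * ENNReal.ofReal (Params.pdfPhi (y + x)))
      =ᵐ[volume] fun y => ENNReal.ofReal (Params.pdfDelta y) := by
  have h := ae_lt_top measurable_deviation_density
    (lintegral_deviation_density.trans_ne ENNReal.one_ne_top)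
  filter_upwards [h] with y hy
  rw [← toReal_deviation_density, ENNReal.ofReal_toReal hy.ne]

lemma deviationLaw_eq :
    deviationLaw = volume.withDensity fun y => ENNReal.ofReal (Params.pdfDelta y) :=
  withDensity_congr_ae deviation_density_ae_eq

lemma integrable_pdfDelta : Integrable Params.pdfDelta := by
  have h := integrable_toReal_of_lintegral_ne_top measurable_deviation_density.aemeasurable
    (lintegral_deviation_density.trans_ne ENNReal.one_ne_top)
  exact h.congr (ae_of_all _ toReal_deviation_density)

lemma deviationLaw_absolutelyContinuous : deviationLaw ≪ volume :=
  withDensity_absolutelyContinuous _ _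

lemma deviationLaw_real {s : Set ℝ} (hs : MeasurableSet s) :
    deviationLaw.real s = ∫ y in s, Params.pdfDelta y := by
  rw [measureReal_def, deviationLaw_eq, withDensity_apply _ hs,
    integral_eq_lintegral_of_nonneg_ae (ae_of_all _ pdfDelta_nonneg)
      integrable_pdfDelta.aestronglyMeasurable.restrict]

lemma deviationLaw_real_abs_mem_Ioc {a b : ℝ} (ha : 0 ≤ a) (hab : a ≤ b) :
    deviationLaw.real {y | |y| ∈ Ioc a b} = 2 * ∫ y in a..b, Params.pdfDelta y := by
  have h : {y : ℝ | |y| ∈ Ioc a b} = Ioc a b ∪ Ico (-b) (-a) := by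
    ext y
    simp only [mem_ofPred_eq, mem_union, mem_Ioc, mem_Ico]
    rcases le_total 0 y with h | h
    · rw [abs_of_nonneg h]; constructor
      · exact Or.inl
      · rintro (h | h)
        · exact h
        · linarith
    · rw [abs_of_nonpos h]; constructor
      · exact fun h => Or.inr ⟨by linarith, by linarith⟩
      · rintro (h | h)
        · linarith
        · exact ⟨by linarith, by linarith⟩
  rw [h, measureReal_union _ measurableSet_Ico, deviationLaw_real measurableSet_Ioc,
    deviationLaw_real measurableSet_Ico, integral_Ico_eq_integral_Ioc,
    ← intervalIntegral.integral_of_le hab, ← intervalIntegral.integral_of_le (by linarith),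
    ← intervalIntegral.integral_comp_neg]
  · simp_rw [pdfDelta_neg]; ring
  · refine Set.disjoint_left.2 fun y h1 h2 => ?_
    linarith [h1.1, h2.2]

lemma deviationLaw_compl_Icc : deviationLaw (Icc (-1) 1)ᶜ = 0 := by
  rw [deviationLaw, withDensity_apply _ measurableSet_Icc.compl]
  refine setLIntegral_eq_zero measurableSet_Icc.compl fun y hy => ?_
  refine lintegral_eq_zero_of_ae_eq_zero (ae_of_all _ fun x => ?_)
  by_contra h
  simp only [Pi.zero_apply, mul_eq_zero, not_or] at h
  have h1 : x ∈ Icc (-(1 / 2) : ℝ) (1 / 2) := by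
    by_contra hx; exact h.1 (by simp [pdfPhi_of_notMem hx])
  have h2 : y + x ∈ Icc (-(1 / 2) : ℝ) (1 / 2) := by
    by_contra hx; exact h.2 (by simp [pdfPhi_of_notMem hx])
  exact hy ⟨by linarith [h1.2, h2.1], by linarith [h1.1, h2.2]⟩

namespace Params

variable (par : Params)

lemma Nb_cast_pos : (0 : ℝ) < par.Nb := by
  have := par.two_le_Nb
  exact_mod_cast (by omega : 0 < par.Nb)

lemma half_Nb_pos : 0 < par.Nb / 2 := Nat.div_pos par.two_le_Nb two_pos

lemma GULA_nonneg (x : ℝ) : 0 ≤ par.GULA x := by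
  unfold GULA
  split_ifs <;> positivity

lemma gainLevel_nonneg (n : ℕ) : 0 ≤ par.gainLevel n := by
  have h := fun x => mul_nonneg (half_pos par.delta_pos).le (par.GULA_nonneg x)
  unfold gainLevel
  split_ifs
  exacts [h _, h _, le_rfl]

lemma gainLevel_half : par.gainLevel (par.Nb / 2) = 0 := by
  simp [gainLevel, par.half_Nb_pos.ne']

/-- The interval of the absolute deviations with gain level `n`. -/
def lobeInterval (n : ℕ) : Set ℝ := Ioc ((n : ℝ) / par.Nb) (((n : ℝ) + 1) / par.Nb)

lemma measurableSet_lobeInterval (n : ℕ) : MeasurableSet (par.lobeInterval n) :=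
  measurableSet_Ioc

lemma lobeInterval_le_half {n : ℕ} (hn : n < par.Nb / 2) : ((n : ℝ) + 1) / par.Nb ≤ 1 / 2 := by
  rw [div_le_div_iff₀ par.Nb_cast_pos two_pos]
  have h : (n + 1) * 2 ≤ 1 * par.Nb := by omega
  exact_mod_cast h

lemma eq_of_mem_lobeInterval {n k : ℕ} {x : ℝ} (hn : x ∈ par.lobeInterval n)
    (hk : x ∈ par.lobeInterval k) : n = k := by
  have hN := par.Nb_cast_pos
  have h1 : (n : ℝ) < k + 1 := by
    have := hn.1.trans_le hk.2
    rwa [div_lt_div_iff_of_pos_right hN] at this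
  have h2 : (k : ℝ) < n + 1 := by
    have := hk.1.trans_le hn.2
    rwa [div_lt_div_iff_of_pos_right hN] at this
  have h1' : n < k + 1 := by exact_mod_cast h1
  have h2' : k < n + 1 := by exact_mod_cast h2
  omega

lemma lobe_of_mem {n : ℕ} (hn : n < par.Nb / 2) {x : ℝ} (hx : |x| ∈ par.lobeInterval n) :
    par.lobe x = par.gainLevel n := by
  rcases Nat.eq_zero_or_pos n with rfl | h0
  · rw [lobe, if_pos (by simpa using hx.2)]
  · have h1 : ¬|x| ≤ 1 / par.Nb := by
      refine not_le.2 (lt_of_le_of_lt ?_ hx.1)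
      have : (1 : ℝ) ≤ n := by exact_mod_cast h0
      gcongr
    rw [lobe, if_neg h1, Finset.sum_eq_single n]
    · exact if_pos hx
    · intro k _ hk
      exact if_neg fun h => hk (par.eq_of_mem_lobeInterval h hx)
    · intro h
      exact absurd (Finset.mem_Icc.2 ⟨h0, by omega⟩) h

/-- The origin is excluded because it belongs to the main lobe but to none of the half-open
intervals. -/
lemma lobe_of_notMem {x : ℝ} (h0 : x ≠ 0) (hx : ∀ n < par.Nb / 2, |x| ∉ par.lobeInterval n) :
    par.lobe x = 0 := by
  have h1 : ¬|x| ≤ 1 / par.Nb := fun h =>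
    hx 0 par.half_Nb_pos ⟨by simpa using h0, by simpa using h⟩
  rw [lobe, if_neg h1]
  refine Finset.sum_eq_zero fun n hn => if_neg ?_
  rw [Finset.mem_Icc] at hn
  have := par.half_Nb_pos
  exact hx n (by omega)

lemma lobe_abs (x : ℝ) : par.lobe |x| = par.lobe x := by
  simp [lobe]

lemma lobe_nonneg (x : ℝ) : 0 ≤ par.lobe x := by
  unfold lobe
  split_ifs
  · exact par.gainLevel_nonneg _
  · refine Finset.sum_nonneg fun n _ => ?_
    split_ifs
    exacts [par.gainLevel_nonneg _, le_rfl]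

lemma measurable_lobe : Measurable par.lobe := by
  unfold lobe
  have h : Measurable fun x : ℝ => |x| := by fun_prop
  refine Measurable.ite (measurableSet_le h measurable_const) measurable_const
    (Finset.measurable_sum _ fun n _ => ?_)
  refine Measurable.ite ?_ measurable_const measurable_const
  exact (measurableSet_lt measurable_const h).inter (measurableSet_le h measurable_const)

lemma GB_nonneg (x : ℝ) : 0 ≤ par.GB x := by
  unfold GB
  split_ifs <;> exact par.lobe_nonneg _

lemma measurable_GB : Measurable par.GB := by
  have := par.measurable_lobe
  unfold GB
  exact Measurable.ite (measurableSet_lt measurable_id measurable_const) (by fun_prop)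
    (Measurable.ite (measurableSet_lt measurable_const measurable_id) (by fun_prop) this)

/-- The pattern depends on the deviation only through its distance to the nearest integer. -/
lemma GB_eq_lobe {y : ℝ} (hy : y ∈ Icc (-1 : ℝ) 1) : par.GB y = par.lobe (min |y| (1 - |y|)) := by
  obtain ⟨h1, h2⟩ := hy
  unfold GB
  split_ifs with h3 h4
  · rw [abs_of_neg (a := y) (by linarith), abs_of_nonneg (by linarith), min_eq_right (by linarith)]
    congr 1; ring
  · rw [abs_of_pos (a := y) (by linarith), abs_of_nonpos (by linarith), min_eq_right (by linarith)]
    congr 1; ring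
  · have : |y| ≤ 1 / 2 := abs_le.2 ⟨by linarith, by linarith⟩
    rw [min_eq_left (by linarith), lobe_abs]

/-- The lobe lies in `[0, 1/2]`, so unfolding the distance to the nearest integer gives the lobe and
its mirror image under `z ↦ 1 - z`. These are the two integrals in `gainProbAux`. Reflection
exchanges open and closed ends, hence the finite exceptional set. -/
lemma ae_min_mem_lobeInterval_iff {n : ℕ} (hn : n < par.Nb / 2) :
    {y : ℝ | min |y| (1 - |y|) ∈ par.lobeInterval n} =ᵐ[volume]
      ({y | |y| ∈ par.lobeInterval n} ∪
        {y | |y| ∈ Ioc (1 - ((n : ℝ) + 1) / par.Nb) (1 - (n : ℝ) / par.Nb)} : Set ℝ) := by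
  have hhalf := par.lobeInterval_le_half hn
  have hN := par.Nb_cast_pos
  set a := (n : ℝ) / par.Nb with ha
  set b := ((n : ℝ) + 1) / par.Nb with hb
  have hab : a < b := by rw [ha, hb]; gcongr; linarith
  have hfin : ({1 / 2, -(1 / 2), 1 - a, -(1 - a), 1 - b, -(1 - b)} : Set ℝ).Finite := by simp
  rw [Filter.eventuallyEq_set]
  filter_upwards [hfin.countable.ae_notMem volume] with y hy
  simp only [mem_insert_iff, mem_singleton_iff, not_or] at hy
  obtain ⟨h1, h2, h3, h4, h5, h6⟩ := hy
  have e : ∀ c : ℝ, y ≠ c → y ≠ -c → |y| ≠ c := fun c hc hc' h => by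
    rcases abs_choice y with h' | h' <;> rw [h'] at h
    exacts [hc h, hc' (by linarith)]
  have e1 := e _ h1 h2
  have e2 := e _ h3 h4
  have e3 := e _ h5 h6
  change min |y| (1 - |y|) ∈ Ioc a b ↔ |y| ∈ Ioc a b ∨ |y| ∈ Ioc (1 - b) (1 - a)
  generalize |y| = z at e1 e2 e3 ⊢
  simp only [mem_Ioc]
  rcases lt_or_gt_of_ne e1 with h | h
  · rw [min_eq_left (by linarith)]
    refine ⟨Or.inl, ?_⟩
    rintro (h' | h')
    · exact h'
    · linarith
  · rw [min_eq_right (by linarith)]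
    refine ⟨fun h' => Or.inr ⟨lt_of_le_of_ne (by linarith) e3.symm, by linarith⟩, ?_⟩
    rintro (h' | h')
    · linarith
    · exact ⟨lt_of_le_of_ne (by linarith) fun h => e2 (by linarith), by linarith⟩

/-- Probability of the gain level `n < ⌊N_b / 2⌋`. -/
lemma deviationLaw_lobeInterval {n : ℕ} (hn : n < par.Nb / 2) :
    deviationLaw.real {y | min |y| (1 - |y|) ∈ par.lobeInterval n} = par.gainProb n := by
  have hhalf := par.lobeInterval_le_half hn
  have hN := par.Nb_cast_pos
  have h0 : 0 ≤ (n : ℝ) / par.Nb := by positivity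
  have hab : (n : ℝ) / par.Nb ≤ ((n : ℝ) + 1) / par.Nb := by gcongr; linarith
  rw [measureReal_congr (deviationLaw_absolutelyContinuous.ae_eq
    (par.ae_min_mem_lobeInterval_iff hn)), measureReal_union, lobeInterval,
    deviationLaw_real_abs_mem_Ioc h0 hab, deviationLaw_real_abs_mem_Ioc (by linarith) (by linarith),
    gainProb, if_pos hn, gainProbAux]
  · refine Set.disjoint_left.2 fun y h1 h2 => ?_
    linarith [h1.2, h2.1]
  · exact measurable_norm measurableSet_Ioc

/-- The gain of the antenna pattern under a random deviation takes the value `gainLevel n` with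
probability `gainProb n`. -/
lemma integral_GB (h : ℝ → ℝ) :
    ∫ y, h (par.GB y) ∂deviationLaw
      = ∑ n ∈ Finset.range (par.Nb / 2 + 1), par.gainProb n * h (par.gainLevel n) := by
  have hset : ∀ n, MeasurableSet {y : ℝ | min |y| (1 - |y|) ∈ par.lobeInterval n} := fun n => by
    have : Measurable fun y : ℝ => min |y| (1 - |y|) := by fun_prop
    exact this (par.measurableSet_lobeInterval n)
  -- Starting from the value `h 0` and correcting it on the disjoint lobes leaves the remaining
  -- probability on the level `0`, which is the last term of the sum.
  have h1 : ∀ᵐ y ∂deviationLaw, h (par.GB y) = h 0 + ∑ n ∈ Finset.range (par.Nb / 2),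
      {y : ℝ | min |y| (1 - |y|) ∈ par.lobeInterval n}.indicator
        (fun _ => h (par.gainLevel n) - h 0) y := by
    have hz : ∀ᵐ y ∂deviationLaw, y ∉ ({0, 1, -1} : Set ℝ) :=
      deviationLaw_absolutelyContinuous.ae_le
        ((by simp : ({0, 1, -1} : Set ℝ).Finite).countable.ae_notMem volume)
    have hc : ∀ᵐ y ∂deviationLaw, y ∈ Icc (-1 : ℝ) 1 := by
      rw [ae_iff]; exact deviationLaw_compl_Icc
    filter_upwards [hz, hc] with y hy hy1
    rw [par.GB_eq_lobe hy1]
    simp only [mem_insert_iff, mem_singleton_iff, not_or] at hy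
    have h01 : |y| < 1 := abs_lt.2 ⟨lt_of_le_of_ne hy1.1 (Ne.symm hy.2.2),
      lt_of_le_of_ne hy1.2 hy.2.1⟩
    have hpos : 0 < min |y| (1 - |y|) := lt_min (abs_pos.2 hy.1) (by linarith)
    by_cases hk : ∃ k < par.Nb / 2, min |y| (1 - |y|) ∈ par.lobeInterval k
    · obtain ⟨k, hk, hm⟩ := hk
      rw [par.lobe_of_mem hk (by rwa [abs_of_pos hpos]), Finset.sum_eq_single k]
      · have hm' : y ∈ {y : ℝ | min |y| (1 - |y|) ∈ par.lobeInterval k} := hm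
        rw [indicator_of_mem hm']; ring
      · intro j _ hj
        exact indicator_of_notMem (s := {y : ℝ | min |y| (1 - |y|) ∈ par.lobeInterval j})
          (fun h => hj (par.eq_of_mem_lobeInterval h hm)) _
      · exact fun h => absurd (Finset.mem_range.2 hk) h
    · push Not at hk
      rw [par.lobe_of_notMem hpos.ne' (by rwa [abs_of_pos hpos]), Finset.sum_eq_zero, add_zero]
      exact fun n hn => indicator_of_notMem
        (s := {y : ℝ | min |y| (1 - |y|) ∈ par.lobeInterval n}) (hk n (Finset.mem_range.1 hn)) _
  have h2 : ∀ n ∈ Finset.range (par.Nb / 2), Integrable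
      ({y : ℝ | min |y| (1 - |y|) ∈ par.lobeInterval n}.indicator
        (fun _ => h (par.gainLevel n) - h 0)) deviationLaw :=
    fun n _ => (integrable_const _).indicator (hset n)
  rw [integral_congr_ae h1, integral_add (integrable_const _) (integrable_finsetSum _ h2),
    integral_finsetSum _ h2, Finset.sum_range_succ, gainLevel_half, gainProb,
    if_neg (lt_irrefl _), integral_const, probReal_univ, one_smul]
  have h3 : ∀ n ∈ Finset.range (par.Nb / 2),
      ∫ y, {y : ℝ | min |y| (1 - |y|) ∈ par.lobeInterval n}.indicator
        (fun _ => h (par.gainLevel n) - h 0) y ∂deviationLaw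
        = par.gainProb n * h (par.gainLevel n) - par.gainProbAux n * h 0 := fun n hn => by
    rw [integral_indicator_const _ (hset n), par.deviationLaw_lobeInterval (Finset.mem_range.1 hn),
      smul_eq_mul, mul_sub]
    congr 2
    exact if_pos (Finset.mem_range.1 hn)
  rw [Finset.sum_congr rfl h3, Finset.sum_sub_distrib, ← Finset.sum_mul]
  ring

lemma kappa_eq_integral (v : LinkState) (x : ℝ) :
    par.kappa v x
      = ∫ y, ((1 + x * par.GB y / par.mState v) ^ par.mState v)⁻¹ ∂deviationLaw :=
  (par.integral_GB fun g => ((1 + x * g / par.mState v) ^ par.mState v)⁻¹).symm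

lemma GB_le : ∃ C, ∀ y, par.GB y ≤ C := by
  have hl : ∀ x, par.lobe x ≤ par.gainLevel 0 +
      ∑ n ∈ Finset.Icc 1 (par.Nb / 2 - 1), par.gainLevel n := fun x => by
    have h0 := par.gainLevel_nonneg 0
    have h1 := Finset.sum_nonneg fun n (_ : n ∈ Finset.Icc 1 (par.Nb / 2 - 1)) =>
      par.gainLevel_nonneg n
    unfold lobe
    split_ifs
    · linarith
    · refine le_add_of_nonneg_of_le h0 (Finset.sum_le_sum fun n _ => ?_)
      split_ifs
      exacts [le_rfl, par.gainLevel_nonneg n]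
  refine ⟨par.gainLevel 0 + ∑ n ∈ Finset.Icc 1 (par.Nb / 2 - 1), par.gainLevel n, fun y => ?_⟩
  unfold GB
  split_ifs <;> exact hl _

end Params

/-! ### Transmit powers -/

/-- All distances of the link are nonnegative. -/
def Link.Nonneg : Link → Prop
  | .direct t => 0 ≤ t
  | .cascaded t r d => 0 ≤ t ∧ 0 ≤ r ∧ 0 ≤ d
  | .nlos t => 0 ≤ t

lemma Link.Proper.nonneg {ℓ : Link} (h : ℓ.Proper) : ℓ.Nonneg := by
  cases ℓ with
  | direct t => exact le_of_lt h
  | cascaded t r d => exact ⟨h.1.le, h.2.1.le, h.2.2.le⟩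
  | nlos t => exact le_of_lt h

namespace Params

variable (par : Params)

lemma txPower_nonneg {ℓ : Link} (h : ℓ.Nonneg) : 0 ≤ par.txPower ℓ := by
  have := par.p0_pos
  have := par.pmax_pos
  have := par.Gr_pos
  cases ℓ with
  | direct t => have ht : 0 ≤ t := h; simp only [txPower]; split_ifs <;> positivity
  | cascaded t r d =>
    obtain ⟨-, hr, hd⟩ : 0 ≤ t ∧ 0 ≤ r ∧ 0 ≤ d := h
    simp only [txPower]; split_ifs <;> positivity
  | nlos t => have ht : 0 ≤ t := h; simp only [txPower]; split_ifs <;> positivity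

lemma Tmax_pos : 0 < par.Tmax :=
  Real.rpow_pos_of_pos (div_pos par.pmax_pos par.p0_pos) _

/-- At `Tmax` the power law reaches `pmax`. The other two thresholds are rescalings of this one, so
the power never exceeds `pmax`. -/
lemma p0_mul_Tmax_rpow : par.p0 * par.Tmax ^ (par.alphaL * par.eps) = par.pmax := by
  have h := mul_pos par.alphaL_pos par.eps_pos
  have h0 := par.p0_pos
  rw [Tmax, ← Real.rpow_mul (div_pos par.pmax_pos par.p0_pos).le, one_div_mul_cancel h.ne',
    Real.rpow_one]
  field_simp

lemma txPower_le {ℓ : Link} (h : ℓ.Nonneg) : par.txPower ℓ ≤ par.pmax := by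
  have h0 := par.p0_pos
  have hT := par.Tmax_pos
  have hL := par.alphaL_pos
  have hN : 0 < par.alphaN := two_pos.trans par.two_lt_alphaN
  have he := par.eps_pos
  have hG := par.Gr_pos
  cases ℓ with
  | direct t =>
    have ht : 0 ≤ t := h
    simp only [txPower]
    split_ifs with hc
    · rw [← p0_mul_Tmax_rpow]
      gcongr
    · exact le_rfl
  | cascaded t r d =>
    obtain ⟨-, hr, hd⟩ : 0 ≤ t ∧ 0 ≤ r ∧ 0 ≤ d := h
    simp only [txPower]
    split_ifs with hc
    · rw [← p0_mul_Tmax_rpow, Real.rpow_mul hT.le]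
      have h1 : (d * r) ^ par.alphaL ≤ par.Tmax ^ par.alphaL * par.Gr := by
        calc (d * r) ^ par.alphaL ≤ (par.Tmax * par.Gr ^ (1 / par.alphaL)) ^ par.alphaL := by
              gcongr
          _ = _ := by
            rw [Real.mul_rpow hT.le (by positivity), ← Real.rpow_mul hG.le,
              one_div_mul_cancel hL.ne', Real.rpow_one]
      gcongr
      rwa [← div_eq_mul_inv, div_le_iff₀ hG]
    · exact le_rfl
  | nlos t =>
    have ht : 0 ≤ t := h
    simp only [txPower]
    split_ifs with hc
    · rw [← p0_mul_Tmax_rpow]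
      have h1 : t ^ (par.alphaN * par.eps) ≤ par.Tmax ^ (par.alphaL * par.eps) := by
        calc t ^ (par.alphaN * par.eps)
            ≤ (par.Tmax ^ (par.alphaL / par.alphaN)) ^ (par.alphaN * par.eps) := by gcongr
          _ = _ := by
            rw [← Real.rpow_mul hT.le]
            congr 1
            field_simp
      gcongr
    · exact le_rfl

/-- The transmit power, truncated to `[0, pmax]`. -/
def clippedPower (ℓ : Link) : ℝ := max 0 (min (par.txPower ℓ) par.pmax)

/-- The averaging theorem asks for bounds on all links, including those with negative distances,
which never serve. Truncation provides these bounds without changing the power of any possible link.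
-/
lemma clippedPower_eq {ℓ : Link} (h : ℓ.Nonneg) : par.clippedPower ℓ = par.txPower ℓ := by
  rw [clippedPower, min_eq_left (par.txPower_le h), max_eq_right (par.txPower_nonneg h)]

lemma measurable_clippedPower : Measurable par.clippedPower :=
  measurable_const.max (par.measurable_txPower.min measurable_const)

lemma clippedPower_nonneg (ℓ : Link) : 0 ≤ par.clippedPower ℓ := le_max_left _ _

lemma clippedPower_le (ℓ : Link) : par.clippedPower ℓ ≤ par.pmax :=
  max_le par.pmax_pos.le (min_le_right _ _)

end Params

namespace Uplink

variable {Ω : Type*} [MeasurableSpace Ω] {par : Params} {P : Measure Ω} (M : Uplink par P)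

lemma servingLink_nonneg (ω : Ω) : (M.servingLink ω).Nonneg := by
  have h1 : 0 ≤ M.tbu ω := Real.sInf_nonneg fun r hr => hr.1
  have h2 : 0 ≤ M.tru ω := Real.sInf_nonneg fun r hr => hr.1
  unfold Geometry.servingLink
  split_ifs
  exacts [h1, ⟨h1, h2, Real.sqrt_nonneg _⟩, h1]

lemma power_eq : M.power = fun ω => par.clippedPower (M.servingLink ω) :=
  funext fun ω => (par.clippedPower_eq (M.servingLink_nonneg ω)).symm

lemma aemeasurable_power : AEMeasurable M.power P :=
  par.measurable_txPower.comp_aemeasurable M.aemeasurable_servingLink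

variable [IsProbabilityMeasure P]

lemma integrable_power : Integrable M.power P := by
  rw [power_eq]
  exact M.integrable_servingLink par.measurable_clippedPower par.clippedPower_nonneg
    par.clippedPower_le

lemma integral_power : ∫ ω, M.power ω ∂P = par.meanPower := by
  rw [power_eq, M.integral_servingLink par.measurable_clippedPower par.clippedPower_nonneg
    par.clippedPower_le, Params.meanPower]
  exact par.linkAverage_congr fun ℓ h => par.clippedPower_eq h.nonneg

include M in
lemma meanPower_nonneg : 0 ≤ par.meanPower := by
  rw [← M.integral_power]
  exact integral_nonneg fun ω => par.txPower_nonneg (M.servingLink_nonneg ω)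

end Uplink

/-! ### Convergence of the Laplace exponent of the interference -/

namespace Params

variable (par : Params)

lemma lamIU_nonneg (d : ℝ) : 0 ≤ par.lamIU d := by
  have h : Real.exp (-Real.pi * par.lamB * d ^ 2) ≤ 1 := Real.exp_le_one_iff.2 (by
    have := Real.pi_pos
    have := par.lamB_pos
    have : 0 ≤ Real.pi * par.lamB * d ^ 2 := by positivity
    linarith)
  exact mul_nonneg par.lamB_pos.le (by linarith)

lemma lamIU_le (d : ℝ) : par.lamIU d ≤ par.lamB := by
  have := Real.exp_pos (-Real.pi * par.lamB * d ^ 2)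
  have := par.lamB_pos
  unfold lamIU
  nlinarith

@[fun_prop]
lemma measurable_lamIU : Measurable par.lamIU := by unfold lamIU; fun_prop

/-- The function `1 - E exp (-y H)` of `y ≥ 0` for a fading coefficient `H` with parameter `m`. -/
def fadingLoss (m : ℕ) (y : ℝ) : ℝ := 1 - ((1 + y / m) ^ m)⁻¹

lemma fadingLoss_nonneg (m : ℕ) {y : ℝ} (hy : 0 ≤ y) : 0 ≤ fadingLoss m y :=
  sub_nonneg.2 (inv_le_one_of_one_le₀ (one_le_pow₀ (by
    have : 0 ≤ y / m := by positivity
    linarith)))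

lemma fadingLoss_le_one (m : ℕ) {y : ℝ} (hy : 0 ≤ y) : fadingLoss m y ≤ 1 :=
  sub_le_self _ (by positivity)

/-- From `(1 + y/m)^m ≤ exp y` and `1 - exp (-y) ≤ y`. The linear bound controls weak, distant
interferers. -/
lemma fadingLoss_le {m : ℕ} (hm : 0 < m) {y : ℝ} (hy : 0 ≤ y) : fadingLoss m y ≤ y := by
  have hm' : (0 : ℝ) < m := by exact_mod_cast hm
  have h1 : (1 + y / m) ^ m ≤ Real.exp y := by
    calc (1 + y / m) ^ m ≤ Real.exp (y / m) ^ m := by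
          gcongr
          linarith [Real.add_one_le_exp (y / m)]
      _ = Real.exp y := by
          rw [← Real.exp_nat_mul]
          congr 1
          field_simp
  have h2 : Real.exp (-y) ≤ ((1 + y / m) ^ m)⁻¹ := by
    rw [Real.exp_neg]
    gcongr
  unfold fadingLoss
  linarith [Real.add_one_le_exp (-y)]

@[fun_prop]
lemma measurable_fadingLoss (m : ℕ) : Measurable (fadingLoss m) := by
  unfold fadingLoss; fun_prop

lemma integrable_fadingLoss_GB (v : LinkState) {x : ℝ} (hx : 0 ≤ x) :
    Integrable (fun y => fadingLoss (par.mState v) (x * par.GB y)) deviationLaw := by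
  have := par.measurable_GB
  refine Integrable.of_bound (C := 1) (by fun_prop : Measurable _).aestronglyMeasurable
    (ae_of_all _ fun y => ?_)
  have h := mul_nonneg hx (par.GB_nonneg y)
  rw [Real.norm_eq_abs, abs_of_nonneg (fadingLoss_nonneg _ h)]
  exact fadingLoss_le_one _ h

lemma one_sub_kappa (v : LinkState) {x : ℝ} (hx : 0 ≤ x) :
    1 - par.kappa v x = ∫ y, fadingLoss (par.mState v) (x * par.GB y) ∂deviationLaw := by
  have h : ∀ y, ((1 + x * par.GB y / par.mState v) ^ par.mState v)⁻¹
      = 1 - fadingLoss (par.mState v) (x * par.GB y) := fun y => by simp [fadingLoss]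
  simp_rw [kappa_eq_integral, h]
  rw [integral_sub (integrable_const _) (par.integrable_fadingLoss_GB v hx)]
  simp

lemma one_sub_kappa_nonneg (v : LinkState) {x : ℝ} (hx : 0 ≤ x) : 0 ≤ 1 - par.kappa v x := by
  rw [par.one_sub_kappa v hx]
  exact integral_nonneg fun y => fadingLoss_nonneg _ (mul_nonneg hx (par.GB_nonneg y))

lemma one_sub_kappa_le_one (v : LinkState) {x : ℝ} (hx : 0 ≤ x) : 1 - par.kappa v x ≤ 1 := by
  rw [par.one_sub_kappa v hx]
  refine (integral_mono (par.integrable_fadingLoss_GB v hx) (integrable_const 1) fun y =>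
    fadingLoss_le_one _ (mul_nonneg hx (par.GB_nonneg y))).trans_eq ?_
  simp

lemma one_sub_kappa_le : ∃ C, 0 ≤ C ∧ ∀ v x, 0 ≤ x → 1 - par.kappa v x ≤ C * x := by
  obtain ⟨C, hC⟩ := par.GB_le
  refine ⟨C, (par.GB_nonneg 0).trans (hC 0), fun v x hx => ?_⟩
  rw [par.one_sub_kappa v hx]
  refine (integral_mono (par.integrable_fadingLoss_GB v hx) (integrable_const (C * x))
    fun y => (fadingLoss_le (par.mState_pos v) (mul_nonneg hx (par.GB_nonneg y))).trans ?_).trans_eq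
    (by simp)
  rw [mul_comm]
  exact mul_le_mul_of_nonneg_right (hC y) hx

@[fun_prop]
lemma measurable_kappa (v : LinkState) : Measurable (par.kappa v) := by
  unfold kappa; fun_prop

lemma PState_nonneg (v : LinkState) {d : ℝ} (hd : 0 ≤ d) : 0 ≤ par.PState v d := by
  cases v
  · exact (par.PLoS_pos d).le
  · exact sub_nonneg.2 (par.PLoS_le_one hd)

lemma measurable_PState (v : LinkState) : Measurable (par.PState v) := by
  cases v
  · exact par.measurable_PLoS
  · exact measurable_const.sub par.measurable_PLoS

/-- Density of the Laplace exponent of the interference with respect to the distance. -/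
def lossDensity (v : LinkState) (p s d : ℝ) : ℝ :=
  (1 - par.kappa v (s * p * par.zeta * d ^ (-par.alpha v))) * d * par.lamIU d * par.PState v d

lemma measurable_lossDensity (v : LinkState) (p s : ℝ) : Measurable (par.lossDensity v p s) := by
  have := par.measurable_PState v
  unfold lossDensity
  fun_prop

lemma kappa_arg_nonneg (v : LinkState) {p s d : ℝ} (hp : 0 ≤ p) (hs : 0 ≤ s) (hd : 0 ≤ d) :
    0 ≤ s * p * par.zeta * d ^ (-par.alpha v) := by
  have := par.zeta_pos
  positivity

lemma lossDensity_nonneg (v : LinkState) {p s d : ℝ} (hp : 0 ≤ p) (hs : 0 ≤ s) (hd : 0 ≤ d) :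
    0 ≤ par.lossDensity v p s d :=
  mul_nonneg (mul_nonneg (mul_nonneg
    (par.one_sub_kappa_nonneg v (par.kappa_arg_nonneg v hp hs hd)) hd) (par.lamIU_nonneg d))
    (par.PState_nonneg v hd)

/-- The exponential decay of the LoS probability suffices, so the path-loss exponent plays no role.
-/
lemma integrableOn_lossDensity_L {p s : ℝ} (hp : 0 ≤ p) (hs : 0 ≤ s) :
    IntegrableOn (par.lossDensity .L p s) (Ioi 0) := by
  refine Integrable.mono' (par.integrableOn_mul_PLoS.const_mul par.lamB)
    (par.measurable_lossDensity _ _ _).aestronglyMeasurable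
    ((ae_restrict_iff' measurableSet_Ioi).2 (ae_of_all _ fun d hd => ?_))
  have hd : 0 < d := hd
  rw [Real.norm_eq_abs, abs_of_nonneg (par.lossDensity_nonneg _ hp hs hd.le)]
  calc par.lossDensity .L p s d ≤ 1 * d * par.lamB * par.PLoS d := by
        have := par.lamB_pos
        have := par.PLoS_pos d
        have := par.lamIU_nonneg d
        unfold lossDensity
        gcongr
        · exact par.one_sub_kappa_le_one _ (par.kappa_arg_nonneg _ hp hs hd.le)
        · exact par.lamIU_le d
        · exact le_rfl
    _ = _ := by ring

/-- Up to distance 1 the loss is bounded by 1, which absorbs the singular path loss. Beyond it the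
linear bound gives a multiple of `d ^ (1 - αN)`, integrable because `αN > 2`. -/
lemma integrableOn_lossDensity_N {p s : ℝ} (hp : 0 ≤ p) (hs : 0 ≤ s) :
    IntegrableOn (par.lossDensity .N p s) (Ioi 0) := by
  obtain ⟨C, hC0, hC⟩ := par.one_sub_kappa_le
  have hz := par.zeta_pos
  have hlam := par.lamB_pos
  have hbound : ∀ d, 0 < d → ∀ K, 0 ≤ K →
      1 - par.kappa .N (s * p * par.zeta * d ^ (-par.alphaN)) ≤ K →
      ‖par.lossDensity .N p s d‖ ≤ K * d * par.lamB := fun d hd K hK0 hK => by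
    rw [Real.norm_eq_abs, abs_of_nonneg (par.lossDensity_nonneg _ hp hs hd.le)]
    calc par.lossDensity .N p s d ≤ K * d * par.lamB * 1 := by
          have := par.lamIU_nonneg d
          unfold lossDensity
          gcongr
          · exact par.PState_nonneg _ hd.le
          · exact hK
          · exact par.lamIU_le d
          · exact sub_le_self _ (par.PLoS_pos d).le
      _ = _ := mul_one _
  rw [← Ioc_union_Ioi_eq_Ioi zero_le_one]
  refine IntegrableOn.union ?_ ?_
  · refine Integrable.mono' (g := fun _ => par.lamB) (integrable_const _)
      (par.measurable_lossDensity _ _ _).aestronglyMeasurable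
      ((ae_restrict_iff' measurableSet_Ioc).2 (ae_of_all _ fun d hd => ?_))
    refine (hbound d hd.1 1 zero_le_one
      (par.one_sub_kappa_le_one _ (par.kappa_arg_nonneg .N hp hs hd.1.le))).trans ?_
    nlinarith [hd.2]
  · have hi : IntegrableOn (fun d : ℝ => d ^ (1 - par.alphaN)) (Ioi 1) :=
      integrableOn_Ioi_rpow_of_lt (by linarith [par.two_lt_alphaN]) one_pos
    refine Integrable.mono' (hi.const_mul (C * (s * p * par.zeta) * par.lamB))
      (par.measurable_lossDensity _ _ _).aestronglyMeasurable
      ((ae_restrict_iff' measurableSet_Ioi).2 (ae_of_all _ fun d hd => ?_))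
    have hd : 0 < d := one_pos.trans hd
    have ha := par.kappa_arg_nonneg .N hp hs hd.le
    refine (hbound d hd _ (mul_nonneg hC0 ha) (hC .N _ ha)).trans_eq ?_
    rw [sub_eq_add_neg, Real.rpow_add hd, Real.rpow_one]
    simp only [alpha]
    ring

lemma integrableOn_lossDensity (v : LinkState) {p s : ℝ} (hp : 0 ≤ p) (hs : 0 ≤ s) :
    IntegrableOn (par.lossDensity v p s) (Ioi 0) := by
  cases v
  exacts [par.integrableOn_lossDensity_L hp hs, par.integrableOn_lossDensity_N hp hs]

end Params

/-! ### Interference -/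

lemma sigmaFinite_interfererIntensity (par : Params) (ρ : Measure ℝ) [IsProbabilityMeasure ρ] :
    SigmaFinite (interfererIntensity par ρ) := by
  have := isProbabilityMeasure_uniformLaw (a := 0) (b := 2 * Real.pi) (by positivity)
  have := isProbabilityMeasure_fadingLaw par.mL_pos
  have := isProbabilityMeasure_fadingLaw par.mN_pos
  unfold interfererIntensity
  infer_instance

/-- Integral with respect to the marked intensity as an iterated integral. -/
lemma lintegral_interfererIntensity (par : Params) (ρ : Measure ℝ) [IsProbabilityMeasure ρ]
    {f : Interferer → ℝ≥0∞} (hf : Measurable f) :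
    ∫⁻ x, f x ∂interfererIntensity par ρ
      = ∫⁻ z : ℂ, ENNReal.ofReal (par.lamIU ‖z‖) * ∫⁻ u, ∫⁻ p, ∫⁻ φ, ∫⁻ φ', ∫⁻ hL, ∫⁻ hN,
        f (z, u, p, φ, φ', hL, hN) ∂Params.fadingLaw par.mN ∂Params.fadingLaw par.mL
        ∂uniformLaw 0 (2 * Real.pi) ∂uniformLaw 0 (2 * Real.pi) ∂ρ ∂uniformLaw 0 1 := by
  have := isProbabilityMeasure_uniformLaw (a := 0) (b := 2 * Real.pi) (by positivity)
  have := isProbabilityMeasure_fadingLaw par.mL_pos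
  have := isProbabilityMeasure_fadingLaw par.mN_pos
  have hl : Measurable fun z : ℂ => ENNReal.ofReal (par.lamIU ‖z‖) := by fun_prop
  unfold interfererIntensity
  rw [lintegral_prod _ hf.aemeasurable,
    lintegral_withDensity_eq_lintegral_mul _ hl hf.lintegral_prod_right']
  refine lintegral_congr fun z => ?_
  rw [Pi.mul_apply]
  congr 1
  rw [lintegral_prod _ (by fun_prop)]
  refine lintegral_congr fun u => ?_
  rw [lintegral_prod _ (by fun_prop)]
  refine lintegral_congr fun p => ?_
  rw [lintegral_prod _ (by fun_prop)]
  refine lintegral_congr fun φ => ?_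
  rw [lintegral_prod _ (by fun_prop)]
  refine lintegral_congr fun φ' => ?_
  rw [lintegral_prod _ (by fun_prop)]

lemma measurable_interferingPower (par : Params) {q : Interferer → ℝ} (hq : Measurable q) :
    Measurable fun x => interferingPower par (q x) x := by
  have h1 := par.measurable_GB
  have h2 := par.measurable_PLoS
  have h3 : Measurable fun x : Interferer => if x.2.1 < par.PLoS ‖x.1‖
      then ‖x.1‖ ^ (-par.alphaL) * x.2.2.2.2.2.1 else ‖x.1‖ ^ (-par.alphaN) * x.2.2.2.2.2.2 :=
    Measurable.ite (measurableSet_lt (by fun_prop) (by fun_prop)) (by fun_prop) (by fun_prop)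
  have h4 : Measurable fun x : Interferer => q x *
      par.GB (Real.cos x.2.2.2.1 / 2 - Real.cos x.2.2.2.2.1 / 2) * par.zeta := by fun_prop
  exact h4.mul h3

/-- Mean loss over the fading. -/
lemma lintegral_fadingLaw_expNeg {m : ℕ} (hm : 0 < m) {a : ℝ} (ha : 0 ≤ a) :
    ∫⁻ h, ENNReal.ofReal (1 - expNeg (ENNReal.ofReal (a * h))) ∂Params.fadingLaw m
      = ENNReal.ofReal (Params.fadingLoss m a) := by
  have := isProbabilityMeasure_fadingLaw hm
  have hpos : ∀ᵐ h ∂Params.fadingLaw m, 0 < h := by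
    rw [ae_iff]
    simpa [not_lt, Iic_def] using fadingLaw_Iic hm
  have hb : ∀ᵐ h ∂Params.fadingLaw m, ‖Real.exp (-(a * h))‖ ≤ 1 := by
    filter_upwards [hpos] with h hh
    rw [Real.norm_eq_abs, Real.abs_exp]
    exact Real.exp_le_one_iff.2 (by have := mul_nonneg ha hh.le; linarith)
  have hi : Integrable (fun h => Real.exp (-(a * h))) (Params.fadingLaw m) :=
    Integrable.of_bound (by fun_prop) 1 hb
  rw [Params.fadingLoss, ← integral_exp_neg_fadingLaw hm ha]
  have h1 : ∫⁻ h, ENNReal.ofReal (1 - expNeg (ENNReal.ofReal (a * h))) ∂Params.fadingLaw m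
      = ∫⁻ h, ENNReal.ofReal (1 - Real.exp (-(a * h))) ∂Params.fadingLaw m := by
    refine lintegral_congr_ae ?_
    filter_upwards [hpos] with h hh
    rw [expNeg_ofReal (mul_nonneg ha hh.le)]
  have hsub : Integrable (fun h => 1 - Real.exp (-(a * h))) (Params.fadingLaw m) :=
    (integrable_const 1).sub hi
  rw [h1, ← ofReal_integral_eq_lintegral_ofReal hsub,
    integral_sub (integrable_const _) hi]
  · simp
  · filter_upwards [hb] with h hh
    rw [Real.norm_eq_abs, Real.abs_exp] at hh
    simpa using hh

/-- Mean loss over the fading and the beam directions. -/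
lemma lintegral_beam_fadingLoss (par : Params) (v : LinkState) {x : ℝ} (hx : 0 ≤ x) :
    ∫⁻ φ, ∫⁻ φ', ENNReal.ofReal (Params.fadingLoss (par.mState v)
        (x * par.GB (Real.cos φ / 2 - Real.cos φ' / 2)))
      ∂uniformLaw 0 (2 * Real.pi) ∂uniformLaw 0 (2 * Real.pi)
      = ENNReal.ofReal (1 - par.kappa v x) := by
  have h := par.measurable_GB
  have hm : Measurable fun y => ENNReal.ofReal (Params.fadingLoss (par.mState v) (x * par.GB y)) :=
    by fun_prop
  rw [lintegral_deviationLaw hm, par.one_sub_kappa v hx,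
    ofReal_integral_eq_lintegral_ofReal (par.integrable_fadingLoss_GB v hx)]
  exact ae_of_all _ fun y => Params.fadingLoss_nonneg _ (mul_nonneg hx (par.GB_nonneg y))

/-- Mean loss over all the marks of an interferer at `z`. -/
lemma lintegral_marks (par : Params) (ρ : Measure ℝ) [IsProbabilityMeasure ρ] {p s : ℝ}
    (hp : 0 ≤ p) (hs : 0 ≤ s) (z : ℂ) :
    ∫⁻ u, ∫⁻ p', ∫⁻ φ, ∫⁻ φ', ∫⁻ hL, ∫⁻ hN,
        ENNReal.ofReal (1 - expNeg (ENNReal.ofReal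
          (s * interferingPower par p (z, u, p', φ, φ', hL, hN))))
        ∂Params.fadingLaw par.mN ∂Params.fadingLaw par.mL
        ∂uniformLaw 0 (2 * Real.pi) ∂uniformLaw 0 (2 * Real.pi) ∂ρ ∂uniformLaw 0 1
      = ENNReal.ofReal (par.PLoS ‖z‖) *
          ENNReal.ofReal (1 - par.kappa .L (s * p * par.zeta * ‖z‖ ^ (-par.alphaL)))
        + ENNReal.ofReal (1 - par.PLoS ‖z‖) *
          ENNReal.ofReal (1 - par.kappa .N (s * p * par.zeta * ‖z‖ ^ (-par.alphaN))) := by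
  have := isProbabilityMeasure_fadingLaw par.mL_pos
  have := isProbabilityMeasure_fadingLaw par.mN_pos
  have hz := norm_nonneg z
  rw [← lintegral_uniformLaw_ite (par.PLoS_pos _).le (par.PLoS_le_one hz)]
  refine lintegral_congr fun u => ?_
  have hxL := par.kappa_arg_nonneg .L hp hs hz
  have hxN := par.kappa_arg_nonneg .N hp hs hz
  simp only [Params.alpha] at hxL hxN
  split_ifs with hu
  · rw [← lintegral_beam_fadingLoss par .L hxL]
    -- The mark fixes the link state, so only the fading of that state matters. The power mark and
    -- the other fading coefficient integrate to 1.
    have h : ∀ φ φ', ∫⁻ hL, ENNReal.ofReal (1 - expNeg (ENNReal.ofReal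
          (s * (p * par.GB (Real.cos φ / 2 - Real.cos φ' / 2) * par.zeta *
            (‖z‖ ^ (-par.alphaL) * hL)))))
        ∂Params.fadingLaw par.mL
        = ENNReal.ofReal (Params.fadingLoss par.mL (s * p * par.zeta * ‖z‖ ^ (-par.alphaL) *
          par.GB (Real.cos φ / 2 - Real.cos φ' / 2))) := fun φ φ' => by
      rw [← lintegral_fadingLaw_expNeg par.mL_pos (mul_nonneg hxL (par.GB_nonneg _))]
      refine lintegral_congr fun hL => ?_
      congr 4
      ring
    simp only [interferingPower, if_pos hu, h, lintegral_const, measure_univ, mul_one]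
    rfl
  · rw [← lintegral_beam_fadingLoss par .N hxN]
    have h : ∀ φ φ', ∫⁻ hN, ENNReal.ofReal (1 - expNeg (ENNReal.ofReal
          (s * (p * par.GB (Real.cos φ / 2 - Real.cos φ' / 2) * par.zeta *
            (‖z‖ ^ (-par.alphaN) * hN)))))
        ∂Params.fadingLaw par.mN
        = ENNReal.ofReal (Params.fadingLoss par.mN (s * p * par.zeta * ‖z‖ ^ (-par.alphaN) *
          par.GB (Real.cos φ / 2 - Real.cos φ' / 2))) := fun φ φ' => by
      rw [← lintegral_fadingLaw_expNeg par.mN_pos (mul_nonneg hxN (par.GB_nonneg _))]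
      refine lintegral_congr fun hN => ?_
      congr 4
      ring
    simp only [interferingPower, if_neg hu, h, lintegral_const, measure_univ, mul_one]
    rfl

/-- Laplace exponent of the interference with fixed transmit power. -/
lemma lintegral_loss (par : Params) (ρ : Measure ℝ) [IsProbabilityMeasure ρ] {p s : ℝ}
    (hp : 0 ≤ p) (hs : 0 ≤ s) :
    ∫⁻ x, ENNReal.ofReal (1 - expNeg (ENNReal.ofReal (s * interferingPower par p x)))
        ∂interfererIntensity par ρ
      = ENNReal.ofReal (2 * Real.pi * ∫ d in Ioi (0 : ℝ), par.lossDensity .L p s d)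
        + ENNReal.ofReal (2 * Real.pi * ∫ d in Ioi (0 : ℝ), par.lossDensity .N p s d) := by
  have hm : Measurable fun x =>
      ENNReal.ofReal (1 - expNeg (ENNReal.ofReal (s * interferingPower par p x))) := by
    have h1 := measurable_interferingPower par (q := fun _ => p) measurable_const
    have h2 := measurable_expNeg
    fun_prop
  have hP := par.measurable_PLoS
  have hg : Measurable fun d : ℝ => ENNReal.ofReal (par.lamIU d) * (ENNReal.ofReal (par.PLoS d) *
          ENNReal.ofReal (1 - par.kappa .L (s * p * par.zeta * d ^ (-par.alphaL)))
        + ENNReal.ofReal (1 - par.PLoS d) *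
          ENNReal.ofReal (1 - par.kappa .N (s * p * par.zeta * d ^ (-par.alphaN)))) := by
    fun_prop
  have hpi : (0 : ℝ) ≤ 2 * Real.pi := by positivity
  have hint : ∀ v, ENNReal.ofReal (2 * Real.pi * ∫ d in Ioi (0 : ℝ), par.lossDensity v p s d)
      = ENNReal.ofReal (2 * Real.pi) *
        ∫⁻ d in Ioi (0 : ℝ), ENNReal.ofReal (par.lossDensity v p s d) := fun v => by
    rw [ENNReal.ofReal_mul hpi, ofReal_integral_eq_lintegral_ofReal
      (par.integrableOn_lossDensity v hp hs)]
    exact (ae_restrict_iff' measurableSet_Ioi).2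
      (ae_of_all _ fun d hd => par.lossDensity_nonneg v hp hs (le_of_lt hd))
  rw [lintegral_interfererIntensity par ρ hm]
  simp_rw [lintegral_marks par ρ hp hs]
  rw [lintegral_norm_complex hg, hint, hint, ← mul_add,
    ← lintegral_add_left (par.measurable_lossDensity _ _ _).ennreal_ofReal]
  congr 1
  refine setLIntegral_congr_fun measurableSet_Ioi fun d hd => ?_
  have hd : 0 ≤ d := le_of_lt hd
  have h : ∀ v, ENNReal.ofReal (par.lossDensity v p s d) = ENNReal.ofReal d *
      (ENNReal.ofReal (par.lamIU d) * (ENNReal.ofReal (par.PState v d) *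
        ENNReal.ofReal (1 - par.kappa v (s * p * par.zeta * d ^ (-par.alpha v))))) := fun v => by
    rw [← ENNReal.ofReal_mul (par.PState_nonneg v hd), ← ENNReal.ofReal_mul (par.lamIU_nonneg d),
      ← ENNReal.ofReal_mul hd, Params.lossDensity]
    congr 1
    ring
  simp only [h]
  rw [← mul_add, ← mul_add]
  rfl

namespace Uplink

variable {Ω : Type*} [MeasurableSpace Ω] {par : Params} {P : Measure Ω} (M : Uplink par P)
  [IsProbabilityMeasure P]

lemma avgInterference_ae_ne_top : ∀ᵐ ω ∂P, M.avgInterference ω ≠ ∞ := by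
  have := Measure.isProbabilityMeasure_map M.aemeasurable_power
  have := sigmaFinite_interfererIntensity par (P.map M.power)
  refine M.users_poisson.ae_lintegral_ne_top
    (measurable_interferingPower par measurable_const).ennreal_ofReal
    (fun _ => ENNReal.ofReal_ne_top) ?_
  have h := lintegral_loss par (P.map M.power) M.meanPower_nonneg zero_le_one
  simp only [one_mul] at h
  exact h.trans_ne (ENNReal.add_ne_top.2 ⟨ENNReal.ofReal_ne_top, ENNReal.ofReal_ne_top⟩)

/-- Laplace transform of the interference with averaged transmit powers. -/
theorem integral_exp_neg_avgInterference {s : ℝ} (hs : 0 ≤ s) :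
    ∫ ω, Real.exp (-(s * (M.avgInterference ω).toReal)) ∂P = par.laplace s := by
  have := Measure.isProbabilityMeasure_map M.aemeasurable_power
  have := sigmaFinite_interfererIntensity par (P.map M.power)
  have hm := measurable_interferingPower par (q := fun _ => par.meanPower) measurable_const
  have hp := M.meanPower_nonneg
  -- Almost sure finiteness is essential: at infinite interference `toReal` is `0` by default, and
  -- the left side would be 1 instead of the limiting value `0` for `s > 0`.
  have h1 : ∀ᵐ ω ∂P, Real.exp (-(s * (M.avgInterference ω).toReal))
      = expNeg (∫⁻ x, ENNReal.ofReal (s * interferingPower par par.meanPower x) ∂M.users ω) := by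
    filter_upwards [M.avgInterference_ae_ne_top] with ω hω
    simp_rw [ENNReal.ofReal_mul hs]
    rw [lintegral_const_mul _ hm.ennreal_ofReal]
    change _ = expNeg (ENNReal.ofReal s * M.avgInterference ω)
    rw [expNeg_of_ne_top (ENNReal.mul_ne_top ENNReal.ofReal_ne_top hω), ENNReal.toReal_mul,
      ENNReal.toReal_ofReal hs]
  have hn : ∀ v, 0 ≤ 2 * Real.pi * ∫ d in Ioi (0 : ℝ), par.lossDensity v par.meanPower s d :=
    fun v => mul_nonneg (by positivity) (setIntegral_nonneg measurableSet_Ioi fun d hd =>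
      par.lossDensity_nonneg v hp hs (le_of_lt hd))
  have hv : ∀ v, par.laplaceState v s
      = Real.exp (-(2 * Real.pi * ∫ d in Ioi (0 : ℝ), par.lossDensity v par.meanPower s d)) :=
    fun v => by rw [Params.laplaceState, neg_mul]; rfl
  rw [integral_congr_ae h1,
    M.users_poisson.integral_expNeg_lintegral (hm.const_mul s).ennreal_ofReal,
    lintegral_loss par _ hp hs, expNeg_add, expNeg_ofReal (hn _), expNeg_ofReal (hn _),
    Params.laplace, hv, hv]

end Uplink

/-! ### Coverage probability -/

namespace Uplink

variable {Ω : Type*} [MeasurableSpace Ω] {par : Params} {P : Measure Ω} (M : Uplink par P)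

lemma measurable_lintegral_interferingPower (par : Params) {q : Interferer → ℝ}
    (hq : Measurable q) : Measurable fun ν : Measure Interferer =>
      ∫⁻ x, ENNReal.ofReal (interferingPower par (q x) x) ∂ν :=
  Measure.measurable_lintegral (measurable_interferingPower par hq).ennreal_ofReal

lemma measurable_avgInterference : Measurable M.avgInterference :=
  (measurable_lintegral_interferingPower par measurable_const).comp M.users_poisson.measurable

variable [IsProbabilityMeasure P]

/-- The coverage probability as an average over the serving link. -/
lemma coverage_of_functional {J : Measure Interferer → ℝ≥0∞} (hJ : Measurable J) (γ : ℝ) :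
    (P⟦{ω | ENNReal.ofReal γ < M.sinr (fun ω => J (M.users ω)) ω} | M.sigma⟧
        =ᵐ[P] fun ω => M.condCoverage (fun ω => J (M.users ω)) γ (M.servingLink ω)) ∧
    P.real {ω | ENNReal.ofReal γ < M.sinr (fun ω => J (M.users ω)) ω}
      = par.linkAverage (M.condCoverage (fun ω => J (M.users ω)) γ) := by
  have hI : Measurable fun ω => J (M.users ω) := hJ.comp M.users_poisson.measurable
  have := Measure.isProbabilityMeasure_map (μ := P) hI.aemeasurable
  have := isProbabilityMeasure_fadingLaw_type par
  refine ⟨M.condExp_coverage hJ γ, ?_⟩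
  rw [M.measureReal_coverage hJ γ]
  exact M.integral_servingLink
    (par.measurable_coverageGiven (fun q => Params.fadingLaw (par.mType q)) _ γ)
    (M.condCoverage_nonneg _ γ) (M.condCoverage_le_one hI.aemeasurable γ)

theorem condExp_and_coverage {I : Ω → ℝ≥0∞} (hI : I = M.interference ∨ I = M.avgInterference)
    (γ : ℝ) :
    (P⟦{ω | ENNReal.ofReal γ < M.sinr I ω} | M.sigma⟧
        =ᵐ[P] fun ω => M.condCoverage I γ (M.servingLink ω)) ∧
    P.real {ω | ENNReal.ofReal γ < M.sinr I ω} = par.linkAverage (M.condCoverage I γ) := by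
  rcases hI with rfl | rfl
  · exact M.coverage_of_functional
      (measurable_lintegral_interferingPower par measurable_snd.snd.fst) γ
  · exact M.coverage_of_functional
      (measurable_lintegral_interferingPower par measurable_const) γ

/-- The coverage sum is the conditional coverage probability under the fading law `expPowLaw`. -/
lemma coverageGiven_expPowLaw_avgInterference {b : ℝ} (hb : 0 < b) {γ : ℝ} (hγ : 0 < γ) {ℓ : Link}
    (hℓ : ℓ.Proper) :
    par.coverageGiven (expPowLaw (par.mType ℓ.type) b) (P.map M.avgInterference) γ ℓ
      = par.coverageSum b γ ℓ := by
  have hI := M.measurable_avgInterference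
  have := Measure.isProbabilityMeasure_map (μ := P) hI.aemeasurable
  refine par.coverageGiven_expPowLaw hb _ ?_ (fun s hs => ?_) hγ hℓ
  · exact (ae_map_iff hI.aemeasurable (measurableSet_singleton ∞).compl).2
      M.avgInterference_ae_ne_top
  · rw [integral_map hI.aemeasurable (by fun_prop)]
    exact M.integral_exp_neg_avgInterference hs

lemma condCoverage_le_coverageGiven {γ : ℝ} (hγ : 0 < γ) (ℓ : Link) :
    M.condCoverage M.avgInterference γ ℓ
      ≤ par.coverageGiven (expPowLaw (par.mType ℓ.type)
        (Params.fadingConst (par.mType ℓ.type))) (P.map M.avgInterference) γ ℓ := by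
  have hm := par.mType_pos ℓ.type
  have := Measure.isProbabilityMeasure_map (μ := P) M.measurable_avgInterference.aemeasurable
  have := isProbabilityMeasure_fadingLaw hm
  have := isProbabilityMeasure_expPowLaw hm (fadingConst_pos (par.mType ℓ.type))
  exact par.coverageGiven_mono (fadingLaw_Iic hm) (fadingLaw_Ioi_le hm) _ hγ ℓ

lemma coverageGiven_le_condCoverage {γ : ℝ} (hγ : 0 < γ) (ℓ : Link) :
    par.coverageGiven (expPowLaw (par.mType ℓ.type) 1) (P.map M.avgInterference) γ ℓ
      ≤ M.condCoverage M.avgInterference γ ℓ := by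
  have hm := par.mType_pos ℓ.type
  have := Measure.isProbabilityMeasure_map (μ := P) M.measurable_avgInterference.aemeasurable
  have := isProbabilityMeasure_fadingLaw hm
  have := isProbabilityMeasure_expPowLaw hm one_pos
  exact par.coverageGiven_mono (expPowLaw_Iic _ _) (expPowLaw_one_Ioi_le hm) _ hγ ℓ

/-- Lower and upper bounds for the conditional coverage probability. -/
theorem condCoverage_bounds {γ : ℝ} (hγ : 0 < γ) {ℓ : Link} (hℓ : ℓ.Proper) :
    par.coverageSum 1 γ ℓ ≤ M.condCoverage M.avgInterference γ ℓ ∧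
      M.condCoverage M.avgInterference γ ℓ ≤ par.coverageApprox γ ℓ ∧
      (par.mType ℓ.type = 1 →
        M.condCoverage M.avgInterference γ ℓ = par.coverageApprox γ ℓ) := by
  have hl := M.coverageGiven_le_condCoverage hγ ℓ
  have hu := M.condCoverage_le_coverageGiven hγ ℓ
  rw [M.coverageGiven_expPowLaw_avgInterference one_pos hγ hℓ] at hl
  rw [M.coverageGiven_expPowLaw_avgInterference (fadingConst_pos _) hγ hℓ] at hu
  refine ⟨hl, hu, fun hm => le_antisymm hu ?_⟩
  rwa [Params.coverageApprox, hm, fadingConst_one]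

/-- The average of the coverage sum is the mean of the conditional coverage probability under the
fading law `expPowLaw`. -/
lemma linkAverage_coverageSum {b : LinkType → ℝ} (hb : ∀ q, 0 < b q) {γ : ℝ} (hγ : 0 < γ) :
    Integrable (fun ω => par.coverageGiven (expPowLaw (par.mType (M.servingLink ω).type)
      (b (M.servingLink ω).type)) (P.map M.avgInterference) γ (M.servingLink ω)) P ∧
    ∫ ω, par.coverageGiven (expPowLaw (par.mType (M.servingLink ω).type)
      (b (M.servingLink ω).type)) (P.map M.avgInterference) γ (M.servingLink ω) ∂P
      = par.linkAverage fun ℓ => par.coverageSum (b ℓ.type) γ ℓ := by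
  have := Measure.isProbabilityMeasure_map (μ := P) M.measurable_avgInterference.aemeasurable
  have := fun q => isProbabilityMeasure_expPowLaw (par.mType_pos q) (hb q)
  have hm := par.measurable_coverageGiven (fun q => expPowLaw (par.mType q) (b q))
    (P.map M.avgInterference) γ
  have h0 : ∀ ℓ : Link, 0 ≤ par.coverageGiven (expPowLaw (par.mType ℓ.type) (b ℓ.type))
    (P.map M.avgInterference) γ ℓ := fun ℓ => par.coverageGiven_nonneg _ _ _ _
  have h1 : ∀ ℓ : Link, par.coverageGiven (expPowLaw (par.mType ℓ.type) (b ℓ.type))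
    (P.map M.avgInterference) γ ℓ ≤ 1 := fun ℓ => par.coverageGiven_le_one _ _ _ _
  refine ⟨M.integrable_servingLink hm h0 h1, (M.integral_servingLink hm h0 h1).trans ?_⟩
  -- The coverage sum is identified on proper links only. The bounded, measurable coverage
  -- probability represents it on the others.
  exact par.linkAverage_congr fun ℓ hℓ =>
    M.coverageGiven_expPowLaw_avgInterference (hb _) hγ hℓ

/-- Lower and upper bounds for the coverage probability. -/
theorem coverage_bounds {γ : ℝ} (hγ : 0 < γ) :
    par.linkAverage (par.coverageSum 1 γ)
      ≤ P.real {ω | ENNReal.ofReal γ < M.sinr M.avgInterference ω} ∧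
    P.real {ω | ENNReal.ofReal γ < M.sinr M.avgInterference ω}
      ≤ par.linkAverage (par.coverageApprox γ) ∧
    (par.mL = 1 → par.mN = 1 →
      P.real {ω | ENNReal.ofReal γ < M.sinr M.avgInterference ω}
        = par.linkAverage (par.coverageApprox γ)) := by
  have hI := M.measurable_avgInterference
  have := Measure.isProbabilityMeasure_map (μ := P) hI.aemeasurable
  have := isProbabilityMeasure_fadingLaw_type par
  have hJ : Measurable fun ν : Measure Interferer =>
      ∫⁻ x, ENNReal.ofReal (interferingPower par par.meanPower x) ∂ν :=
    measurable_lintegral_interferingPower par measurable_const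
  have hcov : P.real {ω | ENNReal.ofReal γ < M.sinr M.avgInterference ω}
      = ∫ ω, M.condCoverage M.avgInterference γ (M.servingLink ω) ∂P :=
    M.measureReal_coverage hJ γ
  have hi : Integrable (fun ω => M.condCoverage M.avgInterference γ (M.servingLink ω)) P :=
    M.integrable_servingLink
      (par.measurable_coverageGiven (fun q => Params.fadingLaw (par.mType q)) _ γ)
      (M.condCoverage_nonneg _ γ) (M.condCoverage_le_one hI.aemeasurable γ)
  obtain ⟨hi1, he1⟩ := M.linkAverage_coverageSum (b := fun _ => 1) (fun _ => one_pos) hγ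
  obtain ⟨hi2, he2⟩ := M.linkAverage_coverageSum
    (b := fun q => Params.fadingConst (par.mType q)) (fun _ => fadingConst_pos _) hγ
  have hl : par.linkAverage (par.coverageSum 1 γ)
      ≤ P.real {ω | ENNReal.ofReal γ < M.sinr M.avgInterference ω} := by
    rw [hcov]
    exact he1.symm.trans_le
      (integral_mono hi1 hi fun ω => M.coverageGiven_le_condCoverage hγ _)
  have hu : P.real {ω | ENNReal.ofReal γ < M.sinr M.avgInterference ω}
      ≤ par.linkAverage (par.coverageApprox γ) := by
    rw [hcov]
    exact (integral_mono hi hi2 fun ω => M.condCoverage_le_coverageGiven hγ _).trans_eq he2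
  -- When both Nakagami parameters are 1, `fadingConst` is 1 for every type and the two bounds
  -- coincide.
  refine ⟨hl, hu, fun hL hN => le_antisymm hu (le_of_eq_of_le ?_ hl)⟩
  congr 1
  funext ℓ
  have h1 : par.mType ℓ.type = 1 := by
    cases ℓ
    exacts [hL, hL, hN]
  rw [Params.coverageApprox, h1, fadingConst_one]

end Uplink

end

end RISUplink

theorem theorem4 {Ω : Type*} [MeasurableSpace Ω] (P : Measure Ω) [IsProbabilityMeasure P]
    (par : Params) (M : Uplink par P) (γ : ℝ) (hγ : 0 < γ) :
    -- conditional coverage and its distance-averaged, association-weighted sum, for the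
    -- interference with individual and with averaged transmit powers
    (∀ I, I = M.interference ∨ I = M.avgInterference →
      (P⟦{ω | ENNReal.ofReal γ < M.sinr I ω} | M.sigma⟧
          =ᵐ[P] fun ω => M.condCoverage I γ (M.servingLink ω)) ∧
      P.real {ω | ENNReal.ofReal γ < M.sinr I ω} = par.linkAverage (M.condCoverage I γ)) ∧
    -- the averaged transmit power, and the Laplace transform of the interference built on it
    (Integrable M.power P ∧ ∫ ω, M.power ω ∂P = par.meanPower) ∧
    (∀ᵐ ω ∂P, M.avgInterference ω ≠ ∞) ∧
    (∀ s : ℝ, 0 ≤ s →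
      ∫ ω, Real.exp (-(s * (M.avgInterference ω).toReal)) ∂P = par.laplace s) ∧
    -- the conditional coverage formula: exact for the approximate fading law, an upper bound for
    -- the true one (a lower bound if the constant is replaced by 1), exact for Rayleigh fading
    (∀ ℓ : Link, ℓ.Proper →
      par.coverageGiven (Params.approxFadingLaw (par.mType ℓ.type)) (P.map M.avgInterference) γ ℓ
          = par.coverageApprox γ ℓ ∧
      par.coverageSum 1 γ ℓ ≤ M.condCoverage M.avgInterference γ ℓ ∧
      M.condCoverage M.avgInterference γ ℓ ≤ par.coverageApprox γ ℓ ∧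
      (par.mType ℓ.type = 1 →
        M.condCoverage M.avgInterference γ ℓ = par.coverageApprox γ ℓ)) ∧
    -- the resulting uplink coverage probability
    par.linkAverage (par.coverageSum 1 γ)
      ≤ P.real {ω | ENNReal.ofReal γ < M.sinr M.avgInterference ω} ∧
    P.real {ω | ENNReal.ofReal γ < M.sinr M.avgInterference ω}
      ≤ par.linkAverage (par.coverageApprox γ) ∧
    (par.mL = 1 → par.mN = 1 →
      P.real {ω | ENNReal.ofReal γ < M.sinr M.avgInterference ω}
        = par.linkAverage (par.coverageApprox γ)) := by
  refine ⟨fun I hI => M.condExp_and_coverage hI γ, ⟨M.integrable_power, M.integral_power⟩,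
    M.avgInterference_ae_ne_top, fun s hs => M.integral_exp_neg_avgInterference hs,
    fun ℓ hℓ => ⟨?_, M.condCoverage_bounds hγ hℓ⟩, M.coverage_bounds hγ⟩
  rw [approxFadingLaw_eq]
  exact M.coverageGiven_expPowLaw_avgInterference (fadingConst_pos _) hγ hℓ
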